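/- Let $c\in L^\infty(\mathbb R)$ be real, a.e. nonnegative, compactly supported and not a.e. zero. Let $K=\sum_{i=1}^N k_i^2\langle\cdot,\mathcal P_i\rangle\mathcal P_i$ in $L^2(-1,1)$, where $k_i>0$ and the $\mathcal P_i$ are real polynomials, orthonormal in $L^2(-1,1)$, and assume that the constant function is an eigenfunction of $K$ with a nonzero eigenvalue. (Inner products are linear in the first argument, $\ln$ is the principal branch, cut along the negative half-axis, and $\mathbb C_+=\{\operatorname{Im}z>0\}$.) In $H=L^2(\mathbb R\times[-1,1])$ let $L_0=i\mu\partial_x$ be the self-adjoint operator whose domain consists of the $f\in H$ such that $f(\cdot,\mu)$ is (locally) absolutely continuous for a.e. $\mu$ and $\mu\partial_xf\in H$. Put $V=c(x)K\ge 0$, $L=L_0-iV$, $T=L^*$, $E=\overline{\operatorname{Ran}V}$, and for $z\in\mathbb C_+$ $$S(z)=I+2i\sqrt V(T^*-z)^{-1}\sqrt V\big|_E,\qquad Q(z)=i\sqrt V(L_0-z)^{-1}\sqrt V\big|_E ;$$ $S$ is the characteristic function of $T$. Let $\ell\in E$, $\ell(x,\mu)=\sqrt{c(x)}\sum_i k_i\mathcal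 P_i(0)\mathcal P_i(\mu)$, and let $\mathcal O=\mathbb C\setminus\{-it:t\ge0\}$. Then the following holds. (0) The norm limit $B=\lim_{z\to0,\,z\in\mathbb C_+}\big(Q(z)-\ln(-iz)\langle\cdot,\ell\rangle\ell\big)$ exists. With $\widetilde Q(z)=\ln(-iz)\langle\cdot,\ell\rangle\ell+B$ one has $Q(z)=\widetilde Q(z)+\Theta(z)$ for $z\in\mathbb C_+$, where $\Theta$ is an analytic operator function in $\mathcal O$ with $\|\Theta(z)\|\le C|z\ln z|$ for $z\in\mathcal O$, $|z|\le 1/2$. There is a $\delta>0$ such that $I-\widetilde Q(i\delta)$ is boundedly invertible. (1) The function $S$ is analytic on the real axis except at the point $0$ (that is, it continues analytically to a neighbourhood of every real $k\ne0$), extends to a norm-continuous function on $\overline{\mathbb C_+}$, and admits an analytic continuation from $\mathbb C_+$ to $\Pi=\{z\ne0:\arg z\ne-\pi/2,\ |z|\le\delta_0\}$ for some $\delta_0>0$. These extensions are denoted by $S$ again. (2) For every $\delta>0$ such that $I-\widetilde Q(i\delta)$ is boundedly invertible, put $$\alpha(z)=-\ln\left(-\frac{iz}\delta\right),\qquad \vartheta_c=\left\langle(I-\widetilde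 Q(i\delta))^{-1}\ell,\ell\right\rangle .$$ Then $\vartheta_c\ne0$, $$S(0)=\frac{I+\widetilde Q(i\delta)}{I-\widetilde Q(i\delta)}-\frac2{\vartheta_c}\left\langle\cdot,(I-\widetilde Q^*(i\delta))^{-1}\ell\right\rangle(I-\widetilde Q(i\delta))^{-1}\ell ,$$ and in the operator norm, uniformly in $\arg z$, $$S(z)=S(0)+\frac2{\vartheta_c(1+\alpha(z)\vartheta_c)}\left\langle\cdot,(I-\widetilde Q^*(i\delta))^{-1}\ell\right\rangle(I-\widetilde Q(i\delta))^{-1}\ell+O(|z\ln z|),\qquad z\in\Pi,\ z\to0 .$$ -/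

import Mathlib

open MeasureTheory Set Filter Topology
open scoped ENNReal InnerProductSpace

namespace SlabTransport
noncomputable section

section Abstract
variable {H : Type*} [NormedAddCommGroup H] [InnerProductSpace ℂ H]

/-- `R = (A - z)⁻¹` as a bounded operator, for an unbounded operator `A`. -/
def IsResolventAt (A : H →ₗ.[ℂ] H) (z : ℂ) (R : H →L[ℂ] H) : Prop :=
  (∀ f : H, ∃ h : R f ∈ A.domain, A ⟨R f, h⟩ - z • R f = f) ∧
    ∀ u : A.domain, R (A u - z • (u : H)) = u

open Classical in
/-- The resolvent `(A - z)⁻¹` at a point `z` of the resolvent set (and `0` elsewhere). -/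
def resolventOp (A : H →ₗ.[ℂ] H) (z : ℂ) : H →L[ℂ] H :=
  if h : ∃ R, IsResolventAt A z R then h.choose else 0

theorem IsResolventAt.resolventOp_eq {A : H →ₗ.[ℂ] H} {z : ℂ} {R : H →L[ℂ] H}
    (hR : IsResolventAt A z R) : resolventOp A z = R := by
  have h : ∃ R, IsResolventAt A z R := ⟨R, hR⟩
  rw [resolventOp, dif_pos h]
  ext f
  obtain ⟨hf, e⟩ := hR.1 f
  conv_lhs => rw [← e]
  exact h.choose_spec.2 ⟨R f, hf⟩

variable [CompleteSpace H]

/-- The closure of the range of `V`. -/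
abbrev rangeClosure (V : H →L[ℂ] H) : Submodule ℂ H :=
  (LinearMap.range (V : H →ₗ[ℂ] H)).topologicalClosure

theorem sqrt_apply_mem_rangeClosure (V : H →L[ℂ] H) (f : H) :
    CFC.sqrt V f ∈ rangeClosure V := by
  by_cases hV : 0 ≤ V
  · have hsa : ContinuousLinearMap.adjoint (CFC.sqrt V) = CFC.sqrt V :=
      (CFC.sqrt_nonneg V).isSelfAdjoint
    have hcl : IsClosed (rangeClosure V : Set H) := Submodule.isClosed_topologicalClosure _
    rw [← Submodule.orthogonal_orthogonal (rangeClosure V)]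
    rw [Submodule.mem_orthogonal]
    intro u hu
    have h1 : ⟪V u, u⟫_ℂ = 0 :=
      (Submodule.mem_orthogonal _ _).1 hu _ (Submodule.le_topologicalClosure _ ⟨u, rfl⟩)
    have h2 : CFC.sqrt V u = 0 := by
      rw [← CFC.sqrt_mul_sqrt_self V hV] at h1
      rw [mul_apply_eq_comp, ← ContinuousLinearMap.adjoint_inner_right, hsa] at h1
      exact inner_self_eq_zero.1 h1
    rw [← ContinuousLinearMap.adjoint_inner_left, hsa, h2, inner_zero_left]
  · rw [CFC.sqrt_of_not_nonneg hV]
    exact zero_mem _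

/-- `√V`, viewed as an operator into `closure (Ran V)`. -/
def sqrtTo (V : H →L[ℂ] H) : H →L[ℂ] rangeClosure V :=
  (CFC.sqrt V).codRestrict (rangeClosure V) (sqrt_apply_mem_rangeClosure V)

/-- `√V`, restricted to `closure (Ran V)`. -/
def sqrtFrom (V : H →L[ℂ] H) : rangeClosure V →L[ℂ] H :=
  CFC.sqrt V ∘L (rangeClosure V).subtypeL

/-- `i √V (A₀ - z)⁻¹ √V`, restricted to `closure (Ran V)`. -/
def borderedResolvent (A₀ : H →ₗ.[ℂ] H) (V : H →L[ℂ] H) (z : ℂ) :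
    rangeClosure V →L[ℂ] rangeClosure V :=
  Complex.I • (sqrtTo V ∘L resolventOp A₀ z ∘L sqrtFrom V)

/-- The characteristic function `I + 2 i √V (A* - z)⁻¹ √V` on `closure (Ran V)` of a maximal
dissipative operator `A` with bounded imaginary part `V`. -/
def characteristicFunction (A : H →ₗ.[ℂ] H) (V : H →L[ℂ] H) (z : ℂ) :
    rangeClosure V →L[ℂ] rangeClosure V :=
  1 + (2 * Complex.I) • (sqrtTo V ∘L resolventOp A.adjoint z ∘L sqrtFrom V)

end Abstract

/-- Lebesgue measure on `[-1, 1]`. -/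
abbrev angleMeasure : Measure ℝ := volume.restrict (Icc (-1) 1)
abbrev phaseMeasure : Measure (ℝ × ℝ) := (volume : Measure ℝ).prod angleMeasure
/-- The space `L²(ℝ × [-1, 1])`. -/
abbrev PhaseSpace : Type := Lp ℂ 2 phaseMeasure

/-- `f` has a representative that is (locally) absolutely continuous in `x` for a.e. `μ`, and
`g = i μ ∂ₓ f` almost everywhere (so that `μ ∂ₓ f` is square integrable). -/
def IsStreamingPair (f g : PhaseSpace) : Prop :=
  ∃ F : ℝ × ℝ → ℂ, f =ᵐ[phaseMeasure] F ∧
    (∀ᵐ μ ∂angleMeasure, ∀ a b : ℝ,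
      AbsolutelyContinuousOnInterval (fun x => F (x, μ)) a b) ∧
    ∀ᵐ p ∂phaseMeasure, DifferentiableAt ℝ (fun x => F (x, p.2)) p.1 ∧
      g p = Complex.I * p.2 * deriv (fun x => F (x, p.2)) p.1

/-- The graph of `i μ ∂ₓ`. -/
def streamingGraph : Submodule ℂ (PhaseSpace × PhaseSpace) where
  carrier := {fg | IsStreamingPair fg.1 fg.2}
  zero_mem' := by
    refine ⟨0, Lp.coeFn_zero _ _ _, ?_, ?_⟩
    · refine Eventually.of_forall fun μ a b => ?_
      rw [absolutelyContinuousOnInterval_iff]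
      intro ε hε
      exact ⟨1, one_pos, fun E _ _ => by simpa using hε⟩
    · filter_upwards [Lp.coeFn_zero ℂ 2 phaseMeasure] with p hp
      have e : (fun x : ℝ => (0 : ℝ × ℝ → ℂ) (x, p.2)) = fun _ => 0 := rfl
      rw [e]
      refine ⟨differentiableAt_const _, ?_⟩
      simpa using hp
  add_mem' := by
    rintro ⟨f, g⟩ ⟨f', g'⟩ ⟨F, hF, hac, hd⟩ ⟨F', hF', hac', hd'⟩
    refine ⟨F + F', ?_, ?_, ?_⟩
    · exact (Lp.coeFn_add _ _).trans (hF.add hF')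
    · filter_upwards [hac, hac'] with μ h h' a b
      exact (h a b).add (h' a b)
    · filter_upwards [hd, hd', Lp.coeFn_add g g'] with p h h' hg
      have e : (fun x : ℝ => (F + F') (x, p.2)) =
        (fun x : ℝ => F (x, p.2)) + fun x : ℝ => F' (x, p.2) := rfl
      rw [e]
      refine ⟨h.1.add h'.1, ?_⟩
      rw [deriv_add h.1 h'.1, mul_add, ← h.2, ← h'.2]
      exact hg
  smul_mem' := by
    rintro a ⟨f, g⟩ ⟨F, hF, hac, hd⟩
    refine ⟨a • F, ?_, ?_, ?_⟩
    · exact (Lp.coeFn_smul _ _).trans (hF.const_smul a)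
    · filter_upwards [hac] with μ h b b'
      exact (h b b').const_smul a
    · filter_upwards [hd, Lp.coeFn_smul a g] with p h hg
      have e : (fun x : ℝ => (a • F) (x, p.2)) = a • fun x : ℝ => F (x, p.2) := rfl
      rw [e]
      refine ⟨h.1.const_smul a, ?_⟩
      rw [deriv_const_smul _ h.1]
      refine hg.trans ?_
      simp only [Pi.smul_apply, smul_eq_mul, h.2]
      ring

/-- The graph is single valued: the absolutely continuous representative, and hence its derivative,
is determined by the class `f`. -/
theorem streamingGraph_functional (fg : PhaseSpace × PhaseSpace) (h : fg ∈ streamingGraph)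
    (h0 : fg.1 = 0) : fg.2 = 0 := by
  obtain ⟨f, g⟩ := fg
  obtain ⟨F, hF, hac, hd⟩ := h
  simp only at h0 hF hd ⊢
  subst h0
  have h1 : ∀ᵐ p ∂phaseMeasure, F p = 0 := by
    filter_upwards [hF, Lp.coeFn_zero ℂ 2 phaseMeasure] with p h h'
    rw [← h, h']; rfl
  have h2 : ∀ᵐ μ ∂angleMeasure, ∀ᵐ x : ℝ, F (x, μ) = 0 :=
    Measure.ae_ae_of_ae_prod 
      (Measure.measurePreserving_swap.quasiMeasurePreserving.ae h1)
  have h3 : ∀ᵐ μ ∂angleMeasure, ∀ x : ℝ, F (x, μ) = 0 := by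
    filter_upwards [h2, hac] with μ h hc x
    have hcont : Continuous fun x => F (x, μ) := by
      rw [continuous_iff_continuousAt]
      intro y
      refine ((hc (y-1) (y+1)).continuousOn).continuousAt ?_
      rw [uIcc_of_le (by linarith)]
      exact Icc_mem_nhds (by linarith) (by linarith)
    exact congrFun ((hcont.ae_eq_iff_eq volume continuous_const).1 h) x
  have h4 : ∀ᵐ p ∂phaseMeasure, ∀ x : ℝ, F (x, p.2) = 0 :=
    Measure.quasiMeasurePreserving_snd.ae h3
  rw [Lp.eq_zero_iff_ae_eq_zero]
  filter_upwards [h4, hd] with p h h'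
  have e : (fun x : ℝ => F (x, p.2)) = fun _ => 0 := funext h
  rw [h'.2, e]; simp

/-- The self-adjoint operator `L₀ = i μ ∂ₓ` in `L²(ℝ × [-1, 1])`, with the domain of those `f` which
are absolutely continuous in `x` for a.e. `μ` and have `μ ∂ₓ f` in `L²`. -/
def streamingOp : PhaseSpace →ₗ.[ℂ] PhaseSpace := streamingGraph.toLinearPMap


/-- The function `x ↦ ∫_{-1}^{1} f(x, μ) p(μ) dμ`. -/
def angleAverage (p : Polynomial ℝ) (f : ℝ × ℝ → ℂ) (x : ℝ) : ℂ :=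
  ∫ μ, f (x, μ) * ((p.eval μ : ℝ) : ℂ) ∂angleMeasure

theorem exists_eval_bound (p : Polynomial ℝ) :
    ∃ M : NNReal, ∀ μ ∈ Icc (-1 : ℝ) 1, ‖((p.eval μ : ℝ) : ℂ)‖ₑ ≤ M := by
  obtain ⟨C, hC⟩ := (isCompact_Icc (a := (-1 : ℝ)) (b := 1)).exists_bound_of_continuousOn
    p.continuous.continuousOn
  refine ⟨C.toNNReal, fun μ hμ => ?_⟩
  have h := hC μ hμ
  rw [← ofReal_norm, Complex.norm_real]
  exact ENNReal.ofReal_le_ofReal h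

theorem angleMeasure_univ : angleMeasure univ = 2 := by
  simp [angleMeasure]; norm_num

theorem sq_lintegral_le {g : ℝ → ℝ≥0∞} (hg : AEMeasurable g angleMeasure) :
    (∫⁻ μ, g μ ∂angleMeasure) ^ 2 ≤ 2 * ∫⁻ μ, g μ ^ 2 ∂angleMeasure := by
  have h := ENNReal.lintegral_mul_le_Lp_mul_Lq angleMeasure Real.HolderConjugate.two_two hg
    (aemeasurable_const (b := (1 : ℝ≥0∞)))
  simp only [Pi.mul_apply, mul_one, ENNReal.one_rpow, lintegral_const, one_mul,
    angleMeasure_univ] at h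
  calc _ ≤ _ := pow_le_pow_left' h 2
    _ = _ := by
      rw [mul_pow, ← ENNReal.rpow_natCast, ← ENNReal.rpow_mul, ← ENNReal.rpow_natCast,
        ← ENNReal.rpow_mul]
      norm_num [mul_comm]

theorem aestronglyMeasurable_angleAverage (p : Polynomial ℝ) {f : ℝ × ℝ → ℂ}
    (hf : AEStronglyMeasurable f phaseMeasure) :
    AEStronglyMeasurable (angleAverage p f) volume := by
  refine AEStronglyMeasurable.integral_prod_right' (f := fun q : ℝ × ℝ => f q * ((p.eval q.2 : ℝ) : ℂ)) ?_
  refine hf.mul (Continuous.aestronglyMeasurable ?_)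
  exact Complex.continuous_ofReal.comp (p.continuous.comp continuous_snd)

theorem eLpNorm_angleAverage_le (p : Polynomial ℝ) :
    ∃ C : NNReal, ∀ f : ℝ × ℝ → ℂ, AEStronglyMeasurable f phaseMeasure →
      eLpNorm (fun q : ℝ × ℝ => angleAverage p f q.1 * ((p.eval q.2 : ℝ) : ℂ)) 2 phaseMeasure ≤
        C * eLpNorm f 2 phaseMeasure := by
  obtain ⟨M, hM⟩ := exists_eval_bound p
  refine ⟨2 * M ^ 2, fun f hf => ?_⟩
  have key : ∀ g : ℝ × ℝ → ℂ, eLpNorm g 2 phaseMeasure =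
      (∫⁻ q, ‖g q‖ₑ ^ 2 ∂phaseMeasure) ^ (1 / 2 : ℝ) := by
    intro g
    rw [eLpNorm_eq_lintegral_rpow_enorm_toReal (by norm_num) (by norm_num)]
    simp
  have hslice : ∀ᵐ x : ℝ, AEStronglyMeasurable (fun μ => f (x, μ)) angleMeasure :=
    hf.prodMk_left
  have hmeas : AEMeasurable
      (fun q : ℝ × ℝ => ‖angleAverage p f q.1 * ((p.eval q.2 : ℝ) : ℂ)‖ₑ ^ 2) phaseMeasure := by
    refine AEMeasurable.pow_const (AEStronglyMeasurable.enorm ?_) 2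
    refine (aestronglyMeasurable_angleAverage p hf).comp_fst.mul
      (Continuous.aestronglyMeasurable ?_)
    exact Complex.continuous_ofReal.comp (p.continuous.comp continuous_snd)
  have main : ∫⁻ q, ‖angleAverage p f q.1 * ((p.eval q.2 : ℝ) : ℂ)‖ₑ ^ 2 ∂phaseMeasure ≤
      (2 * (M : ℝ≥0∞) ^ 2) ^ 2 * ∫⁻ q, ‖f q‖ₑ ^ 2 ∂phaseMeasure := by
    rw [lintegral_prod _ hmeas, lintegral_prod _ (hf.enorm.pow_const 2),
      ← lintegral_const_mul' _ _ (by finiteness)]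
    refine lintegral_mono_ae ?_
    filter_upwards [hslice] with x hx
    have h1 : ‖angleAverage p f x‖ₑ ≤ M * ∫⁻ μ, ‖f (x, μ)‖ₑ ∂angleMeasure := by
      rw [← lintegral_const_mul' _ _ (by simp)]
      refine (enorm_integral_le_lintegral_enorm _).trans (lintegral_mono_ae ?_)
      filter_upwards [ae_restrict_mem measurableSet_Icc] with μ hμ
      rw [enorm_mul, mul_comm]
      gcongr
      exact hM μ hμ
    have h2 := sq_lintegral_le hx.enorm
    calc ∫⁻ μ, ‖angleAverage p f x * ((p.eval μ : ℝ) : ℂ)‖ₑ ^ 2 ∂angleMeasure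
        ≤ ∫⁻ _μ, ((M * ∫⁻ μ, ‖f (x, μ)‖ₑ ∂angleMeasure) * M) ^ 2 ∂angleMeasure := by
          refine lintegral_mono_ae ?_
          filter_upwards [ae_restrict_mem measurableSet_Icc] with μ hμ
          rw [enorm_mul]
          gcongr
          exact hM μ hμ
      _ = 2 * M ^ 4 * (∫⁻ μ, ‖f (x, μ)‖ₑ ∂angleMeasure) ^ 2 := by
          rw [lintegral_const, angleMeasure_univ]; ring
      _ ≤ 2 * M ^ 4 * (2 * ∫⁻ μ, ‖f (x, μ)‖ₑ ^ 2 ∂angleMeasure) := by gcongr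
      _ = (2 * (M : ℝ≥0∞) ^ 2) ^ 2 * ∫⁻ μ, ‖f (x, μ)‖ₑ ^ 2 ∂angleMeasure := by ring
  rw [key, key]
  calc _ ≤ ((2 * (M : ℝ≥0∞) ^ 2) ^ 2 * ∫⁻ q, ‖f q‖ₑ ^ 2 ∂phaseMeasure) ^ (1 / 2 : ℝ) := by
        gcongr
    _ = _ := by
        rw [ENNReal.mul_rpow_of_nonneg _ _ (by norm_num), ← ENNReal.rpow_natCast,
          ← ENNReal.rpow_mul]
        norm_num

theorem memLp_angleAverage_mul (p : Polynomial ℝ) {f : ℝ × ℝ → ℂ} (hf : MemLp f 2 phaseMeasure) :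
    MemLp (fun q : ℝ × ℝ => angleAverage p f q.1 * ((p.eval q.2 : ℝ) : ℂ)) 2 phaseMeasure := by
  obtain ⟨C, hC⟩ := eLpNorm_angleAverage_le p
  refine ⟨?_, (hC f hf.1).trans_lt (ENNReal.mul_lt_top (by simp) hf.2)⟩
  refine (aestronglyMeasurable_angleAverage p hf.1).comp_fst.mul
    (Continuous.aestronglyMeasurable ?_)
  exact Complex.continuous_ofReal.comp (p.continuous.comp continuous_snd)

theorem ae_integrable_slice (p : Polynomial ℝ) {f : ℝ × ℝ → ℂ} (hf : MemLp f 2 phaseMeasure) :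
    ∀ᵐ x : ℝ, Integrable (fun μ => f (x, μ) * ((p.eval μ : ℝ) : ℂ)) angleMeasure := by
  obtain ⟨M, hM⟩ := exists_eval_bound p
  have h1 : Integrable (fun q => ‖f q‖ ^ 2) phaseMeasure := hf.integrable_norm_pow (by norm_num)
  filter_upwards [h1.prod_right_ae, hf.1.prodMk_left] with x h2 h3
  have h4 : MemLp (fun μ => f (x, μ)) 2 angleMeasure :=
    (memLp_two_iff_integrable_sq_norm h3).2 h2
  refine (h4.integrable (by norm_num)).mul_bdd (c := M) ?_ ?_
  · exact (Complex.continuous_ofReal.comp p.continuous).aestronglyMeasurable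
  · filter_upwards [ae_restrict_mem measurableSet_Icc] with μ hμ
    have := hM μ hμ
    rwa [enorm_le_coe] at this

theorem angleAverage_congr (p : Polynomial ℝ) {f g : ℝ × ℝ → ℂ} (h : f =ᵐ[phaseMeasure] g) :
    angleAverage p f =ᵐ[volume] angleAverage p g := by
  filter_upwards [Measure.ae_ae_of_ae_prod h] with x hx
  refine integral_congr_ae ?_
  filter_upwards [hx] with μ hμ
  rw [hμ]

/-- The operator `f ↦ (∫_{-1}^{1} f(x, μ') p(μ') dμ') p(μ)` in `L²(ℝ × [-1, 1])`. -/
def angleProjection (p : Polynomial ℝ) : PhaseSpace →L[ℂ] PhaseSpace :=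
  LinearMap.mkContinuousOfExistsBound
    { toFun := fun f => (memLp_angleAverage_mul p (Lp.memLp f)).toLp
        (fun q : ℝ × ℝ => angleAverage p f q.1 * ((p.eval q.2 : ℝ) : ℂ))
      map_add' := by
        intro f g
        rw [← MemLp.toLp_add]
        refine MemLp.toLp_congr _ _ ?_
        have h1 : ∀ᵐ x : ℝ, angleAverage p (f + g : PhaseSpace) x =
            angleAverage p f x + angleAverage p g x := by
          filter_upwards [angleAverage_congr p (Lp.coeFn_add f g),
            ae_integrable_slice p (Lp.memLp f), ae_integrable_slice p (Lp.memLp g)] with x h hf hg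
          rw [h]
          simp only [angleAverage, Pi.add_apply, add_mul]
          exact integral_add hf hg
        filter_upwards [Measure.quasiMeasurePreserving_fst.ae h1] with q hq
        simp only [Pi.add_apply, hq, add_mul]
      map_smul' := by
        intro a f
        rw [RingHom.id_apply, ← MemLp.toLp_const_smul]
        refine MemLp.toLp_congr _ _ ?_
        have h1 : ∀ᵐ x : ℝ, angleAverage p (a • f : PhaseSpace) x = a * angleAverage p f x := by
          filter_upwards [angleAverage_congr p (Lp.coeFn_smul a f)] with x h
          rw [h]
          simp only [angleAverage, Pi.smul_apply, smul_eq_mul, mul_assoc]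
          exact integral_const_mul _ _
        filter_upwards [Measure.quasiMeasurePreserving_fst.ae h1] with q hq
        simp only [Pi.smul_apply, smul_eq_mul, hq, mul_assoc] }
    (by
      obtain ⟨C, hC⟩ := eLpNorm_angleAverage_le p
      refine ⟨C, fun f => ?_⟩
      simp only [LinearMap.coe_mk, AddHom.coe_mk]
      rw [Lp.norm_toLp, Lp.norm_def]
      have := ENNReal.toReal_mono (ENNReal.mul_ne_top (by simp) (Lp.eLpNorm_ne_top f))
        (hC f (Lp.aestronglyMeasurable f))
      simpa using this)

theorem coeFn_angleProjection (p : Polynomial ℝ) (f : PhaseSpace) :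
    angleProjection p f =ᵐ[phaseMeasure]
      fun q : ℝ × ℝ => angleAverage p f q.1 * ((p.eval q.2 : ℝ) : ℂ) :=
  MemLp.coeFn_toLp (memLp_angleAverage_mul p (Lp.memLp f))

/-- The data of the slab transport problem: the multiplication coefficient `c`, and the collision
operator `K = ∑ᵢ kᵢ² ⟨·, 𝒫ᵢ⟩ 𝒫ᵢ` with polynomial orthonormal eigenfunctions `𝒫ᵢ`, such that the
constant function is an eigenfunction of `K` (with a nonzero eigenvalue). -/
structure Medium where
  c : ℝ → ℝ
  memLp_c : MemLp c ∞ volume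
  c_nonneg : ∀ᵐ x, 0 ≤ c x
  c_support : ∃ R : ℝ, ∀ᵐ x, R < |x| → c x = 0
  N : ℕ
  k : Fin N → ℝ
  k_pos : ∀ i, 0 < k i
  P : Fin N → Polynomial ℝ
  orthonormal : ∀ i j, ∫ μ, (P i).eval μ * (P j).eval μ ∂angleMeasure = if i = j then 1 else 0
  const_eigen : ∃ κ : ℝ, κ ≠ 0 ∧ ∀ μ ∈ Icc (-1 : ℝ) 1,
    ∑ i, k i ^ 2 * (∫ μ', (P i).eval μ' ∂angleMeasure) * (P i).eval μ = κ

namespace Medium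
variable (d : Medium)

theorem memLp_c_fst : MemLp (fun q : ℝ × ℝ => (d.c q.1 : ℂ)) ∞ phaseMeasure := by
  obtain ⟨h, h'⟩ := d.memLp_c
  refine memLp_top_of_bound (Complex.continuous_ofReal.comp_aestronglyMeasurable h.comp_fst)
    (eLpNorm d.c ∞ volume).toReal ?_
  have h1 : ∀ᵐ x : ℝ, ‖d.c x‖ ≤ (eLpNorm d.c ∞ volume).toReal := by
    filter_upwards [ae_le_eLpNormEssSup (f := d.c) (μ := volume)] with x hx
    have := ENNReal.toReal_mono h'.ne (by simpa [eLpNorm_exponent_top] using hx)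
    simpa using this
  filter_upwards [Measure.quasiMeasurePreserving_fst.ae h1] with q hq
  simpa using hq

/-- `K` (that is, `I ⊗ K`) in `L²(ℝ × [-1, 1])`. -/
def collisionOp : PhaseSpace →L[ℂ] PhaseSpace :=
  ∑ i, ((d.k i ^ 2 : ℝ) : ℂ) • angleProjection (d.P i)

/-- Multiplication by `c(x)`. -/
def mulC : PhaseSpace →L[ℂ] PhaseSpace :=
  (ContinuousLinearMap.mul ℂ ℂ).holderL phaseMeasure ∞ 2 2 (d.memLp_c_fst.toLp _)

/-- `V = c K`, the imaginary part of `T`. -/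
def V : PhaseSpace →L[ℂ] PhaseSpace := d.mulC ∘L d.collisionOp

theorem coeFn_V (f : PhaseSpace) : d.V f =ᵐ[phaseMeasure] fun q => (d.c q.1 : ℂ) *
    ∑ i, ((d.k i ^ 2 : ℝ) : ℂ) * (angleAverage (d.P i) f q.1 * ((d.P i).eval q.2 : ℝ)) := by
  have h1 : d.V f =ᵐ[phaseMeasure] fun q => (d.c q.1 : ℂ) * d.collisionOp f q := by
    refine ((ContinuousLinearMap.mul ℂ ℂ).coeFn_holder (r := 2) (d.memLp_c_fst.toLp _)
      (d.collisionOp f)).trans ?_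
    filter_upwards [d.memLp_c_fst.coeFn_toLp] with q hq
    rw [hq]; rfl
  have h2 : d.collisionOp f =ᵐ[phaseMeasure] fun q =>
      ∑ i, ((d.k i ^ 2 : ℝ) : ℂ) * (angleAverage (d.P i) f q.1 * ((d.P i).eval q.2 : ℝ)) := by
    have e : d.collisionOp f = ∑ i, ((d.k i ^ 2 : ℝ) : ℂ) • angleProjection (d.P i) f := by
      simp [collisionOp]
    rw [e]
    refine (Lp.coeFn_finsetSum _ _).trans ?_
    have h3 : ∀ᵐ q ∂phaseMeasure, ∀ i,
        (((d.k i ^ 2 : ℝ) : ℂ) • angleProjection (d.P i) f : PhaseSpace) q =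
        ((d.k i ^ 2 : ℝ) : ℂ) * (angleAverage (d.P i) f q.1 * ((d.P i).eval q.2 : ℝ)) := by
      rw [ae_all_iff]
      intro i
      filter_upwards [coeFn_angleProjection (d.P i) f,
        Lp.coeFn_smul ((d.k i ^ 2 : ℝ) : ℂ) (angleProjection (d.P i) f)] with q h h'
      rw [h', Pi.smul_apply, h, smul_eq_mul]
    filter_upwards [h3] with q hq
    rw [Finset.sum_apply]
    exact Finset.sum_congr rfl fun i _ => hq i
  filter_upwards [h1, h2] with q h h'
  rw [h, h']

/-- The function `ℓ(x, μ) = √c(x) ∑ᵢ kᵢ 𝒫ᵢ(0) 𝒫ᵢ(μ)`; in the basis `(𝒫ᵢ)` it is the vector function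
`√c(x) (k₁ 𝒫₁(0), …, k_N 𝒫_N(0))`. -/
def ellFun (q : ℝ × ℝ) : ℂ :=
  ((√(d.c q.1) * ∑ i, d.k i * (d.P i).eval 0 * (d.P i).eval q.2 : ℝ) : ℂ)

theorem memLp_ellFun : MemLp d.ellFun 2 phaseMeasure := by
  obtain ⟨R, hR⟩ := d.c_support
  obtain ⟨h, h'⟩ := d.memLp_c
  obtain ⟨C, hC⟩ := (isCompact_Icc (a := (-1 : ℝ)) (b := 1)).exists_bound_of_continuousOn
    (f := fun μ => ∑ i, d.k i * (d.P i).eval 0 * (d.P i).eval μ) (by fun_prop)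
  have hs : MeasurableSet (Icc (-R) R ×ˢ (univ : Set ℝ)) := measurableSet_Icc.prod .univ
  have hfin : phaseMeasure (Icc (-R) R ×ˢ (univ : Set ℝ)) ≠ ∞ := by
    rw [Measure.prod_prod, angleMeasure_univ]
    exact ENNReal.mul_ne_top (by simp) (by simp)
  refine (memLp_indicator_const 2 hs (√(eLpNorm d.c ∞ volume).toReal * C) (Or.inr hfin)).mono' ?_ ?_
  · refine Complex.continuous_ofReal.comp_aestronglyMeasurable ?_
    refine (Real.continuous_sqrt.comp_aestronglyMeasurable h).comp_fst.mul
      (Continuous.aestronglyMeasurable ?_)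
    fun_prop
  · have h1 : ∀ᵐ x : ℝ, ‖d.c x‖ ≤ (eLpNorm d.c ∞ volume).toReal := by
      filter_upwards [ae_le_eLpNormEssSup (f := d.c) (μ := volume)] with x hx
      have := ENNReal.toReal_mono h'.ne (by simpa [eLpNorm_exponent_top] using hx)
      simpa using this
    filter_upwards [Measure.quasiMeasurePreserving_fst.ae h1,
      Measure.quasiMeasurePreserving_fst.ae hR,
      Measure.quasiMeasurePreserving_snd.ae (ae_restrict_mem (μ := volume)
        (measurableSet_Icc (a := (-1 : ℝ)) (b := 1)))] with q hq hq' hq2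
    rw [ellFun, Complex.norm_real, norm_mul]
    by_cases hx : q.1 ∈ Icc (-R) R
    · rw [indicator_of_mem (by exact ⟨hx, mem_univ _⟩), Real.norm_of_nonneg (Real.sqrt_nonneg _)]
      have := hC _ hq2
      gcongr
      exact (le_abs_self _).trans hq
    · rw [hq' (by rw [mem_Icc, ← abs_le] at hx; exact not_le.1 hx)]
      simp only [Real.sqrt_zero, norm_zero, zero_mul]
      exact indicator_nonneg (fun _ _ => by
        have : 0 ≤ C := (norm_nonneg _).trans (hC 0 (by simp))
        positivity) _

/-- The quadratic form of `V`: `⟨V u, u⟩ = ∫ c(x) ∑ᵢ kᵢ² |∫ u(x, μ) 𝒫ᵢ(μ) dμ|² dx`. -/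
theorem inner_V_self (u : PhaseSpace) : Integrable (fun x => d.c x *
      ∑ i, d.k i ^ 2 * ‖angleAverage (d.P i) u x‖ ^ 2) ∧
    ⟪d.V u, u⟫_ℂ = ((∫ x, d.c x * ∑ i, d.k i ^ 2 * ‖angleAverage (d.P i) u x‖ ^ 2 : ℝ) : ℂ) := by
  have hint := L2.integrable_inner (𝕜 := ℂ) (d.V u) u
  have hsl : ∀ᵐ x : ℝ, ∀ i,
      Integrable (fun μ => u (x, μ) * (((d.P i).eval μ : ℝ) : ℂ)) angleMeasure := by
    rw [ae_all_iff]
    exact fun i => ae_integrable_slice (d.P i) (Lp.memLp u)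
  have key : ∀ᵐ x : ℝ, ∫ μ, ⟪d.V u (x, μ), u (x, μ)⟫_ℂ ∂angleMeasure =
      ((d.c x * ∑ i, d.k i ^ 2 * ‖angleAverage (d.P i) u x‖ ^ 2 : ℝ) : ℂ) := by
    filter_upwards [hsl, Measure.ae_ae_of_ae_prod (d.coeFn_V u)] with x hx hV
    have e : ∀ᵐ μ ∂angleMeasure, ⟪d.V u (x, μ), u (x, μ)⟫_ℂ =
        ∑ i, ((d.c x * d.k i ^ 2 : ℝ) : ℂ) * (starRingEnd ℂ) (angleAverage (d.P i) u x) *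
          (u (x, μ) * (((d.P i).eval μ : ℝ) : ℂ)) := by
      filter_upwards [hV] with μ hμ
      rw [hμ]
      simp only [RCLike.inner_apply, map_mul, map_sum, Complex.conj_ofReal, Finset.mul_sum]
      refine Finset.sum_congr rfl fun i _ => ?_
      push_cast; ring
    rw [integral_congr_ae e, integral_finsetSum _ (fun i _ => (hx i).const_mul _)]
    push_cast
    rw [Finset.mul_sum]
    refine Finset.sum_congr rfl fun i _ => ?_
    rw [integral_const_mul, ← Complex.conj_mul']
    change _ * _ * angleAverage (d.P i) u x = _
    ring
  have hint2 := (hint.integral_prod_left).congr key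
  refine ⟨hint2.re, ?_⟩
  rw [L2.inner_def, integral_prod _ hint, integral_congr_ae key]
  exact integral_complex_ofReal

theorem ellFun_mem : d.memLp_ellFun.toLp d.ellFun ∈ rangeClosure d.V := by
  have hcl : IsClosed (rangeClosure d.V : Set PhaseSpace) := Submodule.isClosed_topologicalClosure _
  rw [← Submodule.orthogonal_orthogonal (rangeClosure d.V), Submodule.mem_orthogonal']
  intro u hu
  have h1 : ⟪d.V u, u⟫_ℂ = 0 :=
    (Submodule.mem_orthogonal _ _).1 hu _ (Submodule.le_topologicalClosure _ ⟨u, rfl⟩)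
  obtain ⟨hi, hV⟩ := d.inner_V_self u
  rw [hV, Complex.ofReal_eq_zero, integral_eq_zero_iff_of_nonneg_ae ?_ hi] at h1
  swap
  · filter_upwards [d.c_nonneg] with x hx
    exact mul_nonneg hx (Finset.sum_nonneg fun i _ => by positivity)
  have hsl : ∀ᵐ x : ℝ, ∀ i,
      Integrable (fun μ => u (x, μ) * (((d.P i).eval μ : ℝ) : ℂ)) angleMeasure := by
    rw [ae_all_iff]
    exact fun i => ae_integrable_slice (d.P i) (Lp.memLp u)
  have hint := L2.integrable_inner (𝕜 := ℂ) (d.memLp_ellFun.toLp d.ellFun) u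
  rw [L2.inner_def, integral_prod _ hint]
  refine integral_eq_zero_of_ae ?_
  filter_upwards [h1, hsl, d.c_nonneg,
    Measure.ae_ae_of_ae_prod d.memLp_ellFun.coeFn_toLp] with x hx hs hc hl
  have e : ∀ᵐ μ ∂angleMeasure, ⟪d.memLp_ellFun.toLp d.ellFun (x, μ), u (x, μ)⟫_ℂ =
      ∑ i, ((√(d.c x) * d.k i * (d.P i).eval 0 : ℝ) : ℂ) *
        (u (x, μ) * (((d.P i).eval μ : ℝ) : ℂ)) := by
    filter_upwards [hl] with μ hμ
    rw [hμ, ellFun, RCLike.inner_apply, Complex.conj_ofReal]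
    push_cast
    rw [Finset.mul_sum, Finset.mul_sum]
    refine Finset.sum_congr rfl fun i _ => ?_
    ring
  rw [integral_congr_ae e, integral_finsetSum _ (fun i _ => (hs i).const_mul _)]
  refine Finset.sum_eq_zero fun i _ => ?_
  rw [integral_const_mul]
  change _ * angleAverage (d.P i) u x = 0
  rcases mul_eq_zero.1 hx with h0 | h0
  · simp [h0]
  · have h2 := (Finset.sum_eq_zero_iff_of_nonneg (fun i _ => by positivity)).1 h0 i
      (Finset.mem_univ i)
    have h3 : angleAverage (d.P i) u x = 0 := by
      have := (d.k_pos i).ne'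
      simpa [this] using h2
    rw [h3, mul_zero]

/-- `E = closure (Ran V)`. -/
abbrev E : Submodule ℂ PhaseSpace := rangeClosure d.V

/-- The vector `ℓ` as an element of `E`. -/
def ell : d.E := ⟨d.memLp_ellFun.toLp d.ellFun, d.ellFun_mem⟩

/-- The transport operator `L = i μ ∂ₓ - i c K`. -/
def L : PhaseSpace →ₗ.[ℂ] PhaseSpace :=
  ((-Complex.I) • (d.V : PhaseSpace →ₗ[ℂ] PhaseSpace)) +ᵥ streamingOp

/-- The dissipative operator `T = L*`. -/
def T : PhaseSpace →ₗ.[ℂ] PhaseSpace := d.L.adjoint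

/-- The characteristic function of `T`. -/
def S (z : ℂ) : d.E →L[ℂ] d.E := characteristicFunction d.T d.V z

/-- `Q(z) = i √V (L₀ - z)⁻¹ √V` on `E`. -/
def Q (z : ℂ) : d.E →L[ℂ] d.E := borderedResolvent streamingOp d.V z

/-- `ln(-iz) ⟨·, ℓ⟩ ℓ`. -/
def logTerm (z : ℂ) : d.E →L[ℂ] d.E :=
  Complex.log (-Complex.I * z) • InnerProductSpace.rankOne ℂ d.ell d.ell

/-- The constant term `B = lim (Q(z) - ln(-iz) ⟨·, ℓ⟩ ℓ)` for `z → 0` in the upper half-plane. -/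
def B : d.E →L[ℂ] d.E :=
  limUnder (𝓝[{z : ℂ | 0 < z.im}] 0) fun z => d.Q z - d.logTerm z

/-- `Q̃(z) = ln(-iz) ⟨·, ℓ⟩ ℓ + B`. -/
def Qtilde (z : ℂ) : d.E →L[ℂ] d.E := d.logTerm z + d.B

/-- `(I - Q̃(iδ))⁻¹`, if `I - Q̃(iδ)` is boundedly invertible. -/
def qInv (δ : ℝ) : d.E →L[ℂ] d.E := Ring.inverse (1 - d.Qtilde (Complex.I * δ))

/-- `(I - Q̃*(iδ))⁻¹`, if `I - Q̃*(iδ)` is boundedly invertible. -/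
def qAdjInv (δ : ℝ) : d.E →L[ℂ] d.E :=
  Ring.inverse (1 - ContinuousLinearMap.adjoint (d.Qtilde (Complex.I * δ)))

/-- `ϑ_c = ⟨(I - Q̃(iδ))⁻¹ ℓ, ℓ⟩`, the product being linear in its first argument. -/
def theta (δ : ℝ) : ℂ := inner ℂ d.ell (d.qInv δ d.ell)

/-- The rank one operator `⟨·, (I - Q̃*(iδ))⁻¹ ℓ⟩ (I - Q̃(iδ))⁻¹ ℓ`. -/
def rankOneTerm (δ : ℝ) : d.E →L[ℂ] d.E :=
  InnerProductSpace.rankOne ℂ (d.qInv δ d.ell) (d.qAdjInv δ d.ell)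

end Medium

/-- `α(z) = - ln(-iz/δ)`. -/
def alpha (δ : ℝ) (z : ℂ) : ℂ := -Complex.log (-(Complex.I * z) / δ)

/-- The plane cut along the half-line `{-it : t ≥ 0}`. -/
def cutPlane : Set ℂ := {z | z ≠ 0 ∧ z.arg ≠ -(Real.pi / 2)}

/-- The slit disc `Π` of radius `δ₀`. -/
def slitDisc (δ₀ : ℝ) : Set ℂ := {z | z ∈ cutPlane ∧ ‖z‖ ≤ δ₀}

end
end SlabTransport

/-! The group attached to `L₀` is U(t)f(x, μ) = f(x + tμ, μ), so for Im z > 0 one has (L₀ - z)⁻¹ = i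
∫₀^∞ e^{izt} U(t) dt and Q(z) = -∫₀^∞ e^{izt} √V U(t) √V dt. The singularity of Q at the origin
comes from large times. Let c vanish outside [-R, R]. For t > 2R the substitution s = x + tμ' in the
angular integral produces the kernel t⁻¹ (𝒫ᵢ𝒫ⱼ)((s - x)/t). Thus √V U(t) √V is a polynomial in 1/t
without constant term, with finite rank coefficients, the first of which is ⟨·, ℓ⟩ℓ
(`root_V_shift_root_V`, `tailCoeff_zero`). The integral of e^{izt} t^{-m-1} over (a, ∞) is an entire
function minus (iz)^m/m! · ln(-iz) (`exists_expTail_eq`), and bounded times contribute an entire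
function. Hence Q(z) = ln(-iz)⟨·, ℓ⟩ℓ + B + Θ(z), where Θ consists of terms z^m ln(-iz) with m ≥ 1
and an entire function vanishing at 0 (`exists_Q_expansion`).

The second ingredient is dissipativity. Since U(t) is isometric, Re Q(z) ≤ 0 in the upper
half-plane, so I - Q(z) is invertible there and, by continuity, on the real axis without 0. The
resolvent identity gives (I - Q)S = I + Q, that is S = 2(I - Q)⁻¹ - I
(`one_sub_borderedResolvent_mul`, `S_eq`), and the continuation of Q carries S along.

At the origin, I - Q̃(z) = (I - Q̃(iδ)) + α(z)⟨·, ℓ⟩ℓ is a rank one perturbation whose coefficient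
tends to infinity. The Sherman–Morrison formula (`inverse_add_smul`) inverts it explicitly, and the
inverse converges once ϑ_c ≠ 0. If ϑ_c were 0, the vector (I - Q̃(iδ))⁻¹ℓ would be orthogonal to ℓ;
there the logarithm is invisible and Re B ≤ 0, which forces ℓ = 0 (`theta_ne_zero`). But ℓ ≠ 0,
because a nonzero constant is a combination of the 𝒫ᵢ, which therefore do not all vanish at μ = 0.
Restoring Θ changes the inverse by O(‖Θ‖) (`isBigO_inverse_sub_sub_inverse`), and this is the error
term. -/

namespace SlabTransport
noncomputable section

/-! ### Resolvents, adjoints and the Cayley transform -/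

section AbstractResolvent
variable {H : Type*} [NormedAddCommGroup H] [InnerProductSpace ℂ H]

/-- The resolvent of a perturbation of `A` by the bounded operator `-iV`. -/
theorem IsResolventAt.sub_I_smul {A : H →ₗ.[ℂ] H} {z : ℂ} {R : H →L[ℂ] H}
    (hR : IsResolventAt A z R) (V : H →L[ℂ] H) (hV : IsUnit (1 - Complex.I • (R * V))) :
    IsResolventAt (((-Complex.I) • (V : H →ₗ[ℂ] H)) +ᵥ A) z
      (Ring.inverse (1 - Complex.I • (R * V)) * R) := by
  set N := 1 - Complex.I • (R * V) with hN
  have hl : ∀ x, Ring.inverse N (N x) = x := fun x =>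
    congrArg (fun T : H →L[ℂ] H => T x) (Ring.inverse_mul_cancel N hV)
  have hr : ∀ x, N (Ring.inverse N x) = x := fun x =>
    congrArg (fun T : H →L[ℂ] H => T x) (Ring.mul_inverse_cancel N hV)
  have hNx : ∀ x, N x = x - Complex.I • R (V x) := fun x => by simp [hN]
  refine ⟨fun f => ?_, fun u => ?_⟩
  · set u := Ring.inverse N (R f) with hu
    -- The fixed point form of the equation for `u` shows that `u` lies in the range of `R`, hence
    -- in the domain of `A`.
    have h1 : u = R (f + Complex.I • V u) := by
      have := hr (R f)
      rw [← hu, hNx, sub_eq_iff_eq_add] at this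
      rw [map_add, map_smul]; exact this
    obtain ⟨hd, e⟩ := hR.1 (f + Complex.I • V u)
    have hd' : u ∈ A.domain := h1 ▸ hd
    have e' : A ⟨u, hd'⟩ - z • u = f + Complex.I • V u := by
      have h2 : (⟨u, hd'⟩ : A.domain) = ⟨_, hd⟩ := Subtype.ext h1
      rw [h2]
      refine Eq.trans ?_ e
      congr 2
    refine ⟨hd', ?_⟩
    change (-Complex.I • V u + A ⟨u, hd'⟩) - z • u = f
    rw [add_sub_assoc, e']
    module
  · have hu : (u : H) ∈ A.domain := u.2
    have e := hR.2 ⟨u, hu⟩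
    change Ring.inverse N (R ((-Complex.I • V u + A ⟨u, hu⟩) - z • (u : H))) = u
    rw [add_sub_assoc, map_add, e]
    refine Eq.trans ?_ (hl u)
    rw [hNx, map_smul, neg_smul, sub_eq_neg_add]

theorem IsResolventAt.injective {A : H →ₗ.[ℂ] H} {z : ℂ} {R : H →L[ℂ] H}
    (hR : IsResolventAt A z R) : Function.Injective R := by
  rw [injective_iff_map_eq_zero]
  intro f hf
  obtain ⟨h, e⟩ := hR.1 f
  have h0 : (⟨R f, h⟩ : A.domain) = 0 := Subtype.ext hf
  rw [h0, LinearPMap.map_zero, hf, smul_zero, sub_zero] at e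
  exact e.symm

variable [CompleteSpace H]

/-- The identity `key` is ⟨f, R(A - z)u⟩ = ⟨f, u⟩ rearranged. It exhibits R*f as a vector of the
domain of A* with A*R*f = f + z̄ R*f. -/
theorem IsResolventAt.adjoint {A : H →ₗ.[ℂ] H} {z : ℂ} {R : H →L[ℂ] H}
    (hA : Dense (A.domain : Set H)) (hR : IsResolventAt A z R) :
    IsResolventAt A.adjoint ((starRingEnd ℂ) z) (ContinuousLinearMap.adjoint R) := by
  have key : ∀ f : H, ∀ u : A.domain,
      ⟪f + (starRingEnd ℂ) z • ContinuousLinearMap.adjoint R f, (u : H)⟫_ℂ =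
        ⟪ContinuousLinearMap.adjoint R f, A u⟫_ℂ := by
    intro f u
    have h := hR.2 u
    rw [map_sub, map_smul, sub_eq_iff_eq_add] at h
    rw [ContinuousLinearMap.adjoint_inner_left, h, inner_add_left, inner_add_right,
      inner_smul_left, inner_smul_right, ContinuousLinearMap.adjoint_inner_left, Complex.conj_conj]
  refine ⟨fun f => ?_, fun u => ?_⟩
  · have hd : ContinuousLinearMap.adjoint R f ∈ A.adjoint.domain :=
      LinearPMap.mem_adjoint_domain_of_exists _ ⟨_, key f⟩
    refine ⟨hd, ?_⟩
    rw [LinearPMap.adjoint_apply_eq hA ⟨_, hd⟩ (key f), add_sub_cancel_right]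
  · refine ext_inner_right ℂ fun f => ?_
    obtain ⟨hf, e⟩ := hR.1 f
    rw [ContinuousLinearMap.adjoint_inner_left, inner_sub_left,
      LinearPMap.adjoint_isFormalAdjoint hA u ⟨R f, hf⟩, inner_smul_left, Complex.conj_conj,
      ← inner_smul_right, ← inner_sub_right, e]

/-- A vector orthogonal to the domain of A* is orthogonal to the range of R*, hence is annihilated
by the injective operator R. -/
theorem IsResolventAt.dense_adjoint_domain {A : H →ₗ.[ℂ] H} {z : ℂ} {R : H →L[ℂ] H}
    (hA : Dense (A.domain : Set H)) (hR : IsResolventAt A z R) :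
    Dense (A.adjoint.domain : Set H) := by
  rw [Submodule.dense_iff_topologicalClosure_eq_top, Submodule.topologicalClosure_eq_top_iff,
    Submodule.eq_bot_iff]
  intro x hx
  refine hR.injective ?_
  rw [map_zero, ← inner_self_eq_zero (𝕜 := ℂ), ← ContinuousLinearMap.adjoint_inner_left]
  exact (Submodule.mem_orthogonal _ _).1 hx _ ((hR.adjoint hA).1 (R x)).choose

/-- The function `S` involves T* = L**. Taking adjoints of the resolvent twice avoids having to
compare L** with L. -/
theorem IsResolventAt.adjoint_adjoint {A : H →ₗ.[ℂ] H} {z : ℂ} {R : H →L[ℂ] H}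
    (hA : Dense (A.domain : Set H)) (hR : IsResolventAt A z R) :
    IsResolventAt A.adjoint.adjoint z R := by
  have h := (hR.adjoint hA).adjoint (hR.dense_adjoint_domain hA)
  rwa [Complex.conj_conj, ContinuousLinearMap.adjoint_adjoint] at h

theorem isUnit_of_re_inner_ge {T : H →L[ℂ] H} {c : ℝ} (hc : 0 < c)
    (h : ∀ x, c * ‖x‖ ^ 2 ≤ (⟪x, T x⟫_ℂ).re) : IsUnit T := by
  refine T.isUnit_of_forall_le_norm_inner_map (c := ⟨c, hc.le⟩) hc fun x => ?_
  rw [norm_inner_symm]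
  calc ‖x‖ ^ 2 * c = c * ‖x‖ ^ 2 := mul_comm _ _
    _ ≤ _ := h x
    _ ≤ _ := Complex.re_le_norm _

theorem isUnit_one_sub_of_re_inner_nonpos {T : H →L[ℂ] H}
    (h : ∀ x, (⟪x, T x⟫_ℂ).re ≤ 0) : IsUnit (1 - T) := by
  refine isUnit_of_re_inner_ge one_pos fun x => ?_
  have h1 := h x
  have h2 : (⟪x, x⟫_ℂ).re = ‖x‖ ^ 2 := inner_self_eq_norm_sq (𝕜 := ℂ) x
  simp only [_root_.sub_apply, one_apply_eq_self, inner_sub_right,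
    Complex.sub_re, h2]
  linarith

theorem sqrtFrom_comp_sqrtTo {V : H →L[ℂ] H} (hV : 0 ≤ V) (x : H) :
    sqrtFrom V (sqrtTo V x) = V x :=
  congrArg (fun T : H →L[ℂ] H => T x) (CFC.sqrt_mul_sqrt_self V hV)

theorem adjoint_sqrt (V : H →L[ℂ] H) : ContinuousLinearMap.adjoint (CFC.sqrt V) = CFC.sqrt V :=
  (CFC.sqrt_nonneg V).isSelfAdjoint

theorem inner_sqrtTo (V : H →L[ℂ] H) (e : rangeClosure V) (x : H) :
    ⟪e, sqrtTo V x⟫_ℂ = ⟪sqrtFrom V e, x⟫_ℂ := by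
  change ⟪(e : H), CFC.sqrt V x⟫_ℂ = ⟪CFC.sqrt V e, x⟫_ℂ
  rw [← ContinuousLinearMap.adjoint_inner_left, adjoint_sqrt]

/-- As √V is self-adjoint, the quadratic form of the bordered resolvent at `e` is that of i(A - z)⁻¹
at √V e. -/
theorem re_inner_borderedResolvent_nonpos {A : H →ₗ.[ℂ] H} {z : ℂ} (V : H →L[ℂ] H)
    (h : ∀ x, (⟪x, Complex.I • resolventOp A z x⟫_ℂ).re ≤ 0) (e : rangeClosure V) :
    (⟪e, borderedResolvent A V z e⟫_ℂ).re ≤ 0 := by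
  have := h (sqrtFrom V e)
  rw [inner_smul_right, ← inner_sqrtTo, ← inner_smul_right] at this
  exact this

/-- The characteristic function is the Cayley transform of the bordered resolvent. -/
theorem one_sub_borderedResolvent_mul {A : H →ₗ.[ℂ] H} {z : ℂ} {R : H →L[ℂ] H}
    (hA : Dense (A.domain : Set H)) (hR : IsResolventAt A z R) {V : H →L[ℂ] H} (hV : 0 ≤ V)
    (h : ∀ x, (⟪x, Complex.I • R x⟫_ℂ).re ≤ 0) :
    (1 - borderedResolvent A V z) *
      characteristicFunction (((-Complex.I) • (V : H →ₗ[ℂ] H)) +ᵥ A).adjoint V z =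
        1 + borderedResolvent A V z := by
  -- The operator 1 - √V(iR√V) is accretive with lower bound 1. Since 1 - XY and 1 - YX are
  -- invertible together, one factor √V can be moved to the right end.
  have hu : IsUnit (1 - Complex.I • (R * V)) := by
    have h1 : IsUnit (1 - CFC.sqrt V * (Complex.I • (R * CFC.sqrt V))) := by
      refine isUnit_one_sub_of_re_inner_nonpos fun x => ?_
      have := h (CFC.sqrt V x)
      rwa [← adjoint_sqrt V, ContinuousLinearMap.adjoint_inner_left, adjoint_sqrt V] at this
    rw [← map_one (algebraMap ℂ (H →L[ℂ] H)), ← spectrum.notMem_iff, ← Units.val_one,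
      spectrum.unit_mem_mul_comm, Units.val_one, spectrum.notMem_iff, map_one] at h1
    rwa [smul_mul_assoc, mul_assoc, CFC.sqrt_mul_sqrt_self V hV] at h1
  set L := ((-Complex.I) • (V : H →ₗ[ℂ] H)) +ᵥ A
  have hL : IsResolventAt L z _ := hR.sub_I_smul V hu
  set RL := Ring.inverse (1 - Complex.I • (R * V)) * R with hRL
  have hdense : Dense (L.domain : Set H) := hA
  -- The second resolvent identity. Bordered by √V, it is the only relation between `R` and `RL`
  -- that the Cayley identity needs; the rest is linear algebra.
  have h1 : RL = R + Complex.I • (R * V * RL) := by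
    have : (1 - Complex.I • (R * V)) * RL = R := by
      rw [hRL, ← mul_assoc, Ring.mul_inverse_cancel _ hu, one_mul]
    rw [sub_mul, one_mul, sub_eq_iff_eq_add, smul_mul_assoc] at this
    exact this
  have hT := (hL.adjoint_adjoint hdense).resolventOp_eq
  ext1 e
  have h2 : RL (sqrtFrom V e) = R (sqrtFrom V e) + Complex.I • R (V (RL (sqrtFrom V e))) :=
    congrArg (fun T : H →L[ℂ] H => T (sqrtFrom V e)) h1
  rw [characteristicFunction, borderedResolvent, hT, hR.resolventOp_eq]
  simp only [mul_apply_eq_comp, _root_.sub_apply,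
    _root_.add_apply, one_apply_eq_self, _root_.smul_apply,
    ContinuousLinearMap.comp_apply, map_add, map_smul, sqrtFrom_comp_sqrtTo hV]
  have h3 := congrArg (sqrtTo V) h2
  rw [map_add, map_smul] at h3
  generalize sqrtTo V (R (V (RL (sqrtFrom V e)))) = a at *
  generalize sqrtTo V (RL (sqrtFrom V e)) = b at *
  subst h3
  match_scalars <;> ring

end AbstractResolvent

/-! ### The free flow and its Laplace transform -/

/-- The free flow `(x, μ) ↦ (x + t μ, μ)`. -/
def shear (t : ℝ) (p : ℝ × ℝ) : ℝ × ℝ := (p.1 + t * p.2, p.2)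

theorem continuous_shear (t : ℝ) : Continuous (shear t) := by
  unfold shear; fun_prop

theorem measurePreserving_shear (t : ℝ) :
    MeasurePreserving (shear t) phaseMeasure phaseMeasure := by
  have h1 : MeasurePreserving (fun p : ℝ × ℝ => (p.1, p.2 + t * p.1))
      (angleMeasure.prod volume) (angleMeasure.prod volume) := by
    refine (MeasurePreserving.id angleMeasure).skew_product (g := fun μ x => x + t * μ)
      (by fun_prop) (Eventually.of_forall fun μ => ?_)
    exact map_add_right_eq_self volume (t * μ)
  exact Measure.measurePreserving_swap.comp (h1.comp Measure.measurePreserving_swap)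

/-- The unitary group generated by `-i (i μ ∂ₓ)`: `f(x, μ) ↦ f(x + t μ, μ)`. -/
def shift (t : ℝ) : PhaseSpace →L[ℂ] PhaseSpace :=
  (Lp.compMeasurePreservingₗᵢ ℂ (shear t) (measurePreserving_shear t)).toContinuousLinearMap

theorem coeFn_shift (t : ℝ) (f : PhaseSpace) :
    shift t f =ᵐ[phaseMeasure] fun p => f (shear t p) :=
  Lp.coeFn_compMeasurePreserving f (measurePreserving_shear t)

theorem norm_shift (t : ℝ) (f : PhaseSpace) : ‖shift t f‖ = ‖f‖ :=
  Lp.norm_compMeasurePreserving f (measurePreserving_shear t)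

theorem shift_zero (f : PhaseSpace) : shift 0 f = f := by
  refine Lp.ext ((coeFn_shift 0 f).trans (Eventually.of_forall fun p => ?_))
  simp [shear]

theorem shift_add (s t : ℝ) (f : PhaseSpace) : shift (s + t) f = shift s (shift t f) := by
  refine Lp.ext ((coeFn_shift _ f).trans (EventuallyEq.symm ((coeFn_shift _ _).trans ?_)))
  refine ((measurePreserving_shear s).quasiMeasurePreserving.ae (coeFn_shift t f)).mono
    fun p hp => ?_
  refine hp.trans ?_
  simp only [shear]
  congr 2
  ring

theorem continuous_shift (f : PhaseSpace) : Continuous fun t => shift t f := by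
  have h : Continuous fun t : ℝ => (⟨shear t, continuous_shear t⟩ : C(ℝ × ℝ, ℝ × ℝ)) := by
    refine ContinuousMap.continuous_of_continuous_uncurry _ ?_
    change Continuous fun q : ℝ × (ℝ × ℝ) => (q.2.1 + q.1 * q.2.2, q.2.2)
    fun_prop
  exact Continuous.compMeasurePreservingLp (continuous_const (y := f)) h measurePreserving_shear
    (by simp)

theorem norm_cexp_I_mul (z : ℂ) (t : ℝ) :
    ‖Complex.exp (Complex.I * z * t)‖ = Real.exp (-z.im * t) := by
  rw [Complex.norm_exp]
  simp

theorem continuous_cexp_smul_shift (z : ℂ) (f : PhaseSpace) :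
    Continuous fun t : ℝ => Complex.exp (Complex.I * z * t) • shift t f :=
  have h : Continuous fun t : ℝ => Complex.exp (Complex.I * z * t) := by fun_prop
  h.smul (continuous_shift f)

theorem integrableOn_cexp_smul_shift {z : ℂ} (hz : 0 < z.im) (f : PhaseSpace) (a : ℝ) :
    IntegrableOn (fun t : ℝ => Complex.exp (Complex.I * z * t) • shift t f) (Ioi a) := by
  refine Integrable.mono' ((integrableOn_exp_mul_Ioi (neg_lt_zero.2 hz) a).mul_const ‖f‖)
    (continuous_cexp_smul_shift z f).aestronglyMeasurable (Eventually.of_forall fun t => ?_)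
  rw [norm_smul, norm_shift, norm_cexp_I_mul]

/-- The Laplace transform of the group, for `0 < Im z`. -/
def shiftLaplace (z : ℂ) (hz : 0 < z.im) : PhaseSpace →L[ℂ] PhaseSpace :=
  LinearMap.mkContinuousOfExistsBound
    { toFun := fun f => ∫ t in Ioi (0 : ℝ), Complex.exp (Complex.I * z * t) • shift t f
      map_add' := fun f g => by
        rw [← integral_add (integrableOn_cexp_smul_shift hz f 0)
          (integrableOn_cexp_smul_shift hz g 0)]
        simp
      map_smul' := fun a f => by
        rw [RingHom.id_apply, ← integral_smul]
        simp only [map_smul]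
        congr 1; ext1 t
        rw [smul_comm] }
    ⟨∫ t in Ioi (0 : ℝ), Real.exp (-z.im * t), fun f => by
      change ‖∫ t in Ioi (0 : ℝ), Complex.exp (Complex.I * z * t) • shift t f‖ ≤ _
      rw [← integral_mul_const]
      refine norm_integral_le_of_norm_le
        ((integrableOn_exp_mul_Ioi (neg_lt_zero.2 hz) 0).mul_const ‖f‖)
        (Eventually.of_forall fun t => ?_)
      rw [norm_smul, norm_shift, norm_cexp_I_mul]⟩

theorem shiftLaplace_apply {z : ℂ} (hz : 0 < z.im) (f : PhaseSpace) :
    shiftLaplace z hz f = ∫ t in Ioi (0 : ℝ), Complex.exp (Complex.I * z * t) • shift t f := rfl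

/-- Translating the Laplace transform by the group. -/
theorem cexp_smul_shift_shiftLaplace {z : ℂ} (hz : 0 < z.im) (f : PhaseSpace) (s : ℝ) :
    Complex.exp (Complex.I * z * s) • shift s (shiftLaplace z hz f) =
      ∫ t in Ioi s, Complex.exp (Complex.I * z * t) • shift t f := by
  rw [shiftLaplace_apply, ← ContinuousLinearMap.integral_comp_comm _
    (integrableOn_cexp_smul_shift hz f 0), ← integral_smul,
    ← integral_indicator measurableSet_Ioi, ← integral_indicator measurableSet_Ioi,
    ← integral_add_right_eq_self ((Ioi s).indicator _) s]
  congr 1; ext1 t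
  by_cases ht : t ∈ Ioi (0 : ℝ)
  · rw [indicator_of_mem ht, indicator_of_mem (by simpa using ht), map_smul, ← shift_add, smul_smul,
      ← Complex.exp_add, add_comm s t]
    congr 2
    push_cast; ring
  · rw [indicator_of_notMem ht, indicator_of_notMem (by simpa using ht)]

/-- `Re ⟨∫ e^{izt} U(t) f dt, f⟩ = Im z ‖∫ e^{izt} U(t) f dt‖²`. -/
theorem re_inner_shiftLaplace {z : ℂ} (hz : 0 < z.im) (f : PhaseSpace) :
    (⟪f, shiftLaplace z hz f⟫_ℂ).re = z.im * ‖shiftLaplace z hz f‖ ^ 2 := by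
  set u := shiftLaplace z hz f with hu
  set φ : ℝ → PhaseSpace := fun t => Complex.exp (Complex.I * z * t) • shift t f with hφ
  have hφc : Continuous φ := continuous_cexp_smul_shift z f
  -- The squared norm of the tail integral over (s, ∞) is differentiated at s = 0 in two ways. The
  -- tail has derivative `-f`, which gives -2 Re⟨f, u⟩. By the translation formula its norm is
  -- e^{-(Im z)s}‖u‖, which gives -2 (Im z)‖u‖².
  have hG : ∀ s, ∫ t in Ioi s, φ t = u - ∫ t in (0 : ℝ)..s, φ t := by
    intro s
    rw [eq_sub_iff_add_eq', intervalIntegral.integral_interval_add_Ioi'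
      (hφc.intervalIntegrable _ _) (integrableOn_cexp_smul_shift hz f s)]
    rfl
  have hd : HasDerivAt (fun s => ∫ t in Ioi s, φ t) (-f) 0 := by
    have h1 : HasDerivAt (fun s => ∫ t in (0 : ℝ)..s, φ t) (φ 0) 0 :=
      hφc.integral_hasStrictDerivAt 0 0 |>.hasDerivAt
    have h2 := h1.const_sub u
    have h3 : φ 0 = f := by simp [hφ, shift_zero]
    rw [h3] at h2
    simpa only [hG] using h2
  have hn : ∀ s, ⟪∫ t in Ioi s, φ t, ∫ t in Ioi s, φ t⟫_ℂ =
      ((Real.exp (-z.im * s) ^ 2 * ‖u‖ ^ 2 : ℝ) : ℂ) := by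
    intro s
    rw [hφ, ← cexp_smul_shift_shiftLaplace hz f s, inner_self_eq_norm_sq_to_K, norm_smul,
      norm_cexp_I_mul, norm_shift, ← hu]
    norm_cast
    rw [mul_pow]
    rfl
  have h1 := hd.inner ℂ hd
  simp only [hn] at h1
  have h2 : HasDerivAt (fun s : ℝ => ((Real.exp (-z.im * s) ^ 2 * ‖u‖ ^ 2 : ℝ) : ℂ))
      ((-2 * z.im * ‖u‖ ^ 2 : ℝ) : ℂ) 0 := by
    refine HasDerivAt.ofReal_comp ?_
    have h3 := ((((hasDerivAt_id (0 : ℝ)).const_mul (-z.im)).exp).pow 2).mul_const (‖u‖ ^ 2)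
    refine h3.congr_deriv ?_
    simp
  have h4 := h1.unique h2
  rw [show ∫ t in Ioi (0 : ℝ), φ t = u from rfl, inner_neg_right, inner_neg_left,
    ← inner_conj_symm u f] at h4
  have h5 := congrArg Complex.re h4
  rw [Complex.ofReal_re] at h5
  simp only [Complex.add_re, Complex.neg_re, Complex.conj_re] at h5
  linarith

/-- `-i z (A - z)⁻¹ → I` along the imaginary axis, for the generator `A` of the group. -/
theorem tendsto_smul_shiftLaplace (f : PhaseSpace) :
    Tendsto (fun n : ℕ => ((n + 1 : ℝ) : ℂ) • shiftLaplace (Complex.I * ((n + 1 : ℝ) : ℂ))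
      (by simp; positivity) f) atTop (𝓝 f) := by
  -- The substitution s = (n + 1)t makes the exponential weight independent of `n`; what is left is
  -- strong continuity of the group at time 0 under dominated convergence.
  have h1 : ∀ n : ℕ, ((n + 1 : ℝ) : ℂ) • shiftLaplace (Complex.I * ((n + 1 : ℝ) : ℂ))
      (by simp; positivity) f =
      ∫ s in Ioi (0 : ℝ), (Real.exp (-s) : ℂ) • shift ((n + 1 : ℝ)⁻¹ * s) f := by
    intro n
    have hn : (0 : ℝ) < n + 1 := by positivity
    have h2 := integral_comp_mul_left_Ioi'
      (fun s : ℝ => (Real.exp (-s) : ℂ) • shift ((n + 1 : ℝ)⁻¹ * s) f) 0 hn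
    rw [mul_zero] at h2
    rw [← h2, shiftLaplace_apply]
    rw [Complex.coe_smul]
    congr 2; ext1 t
    rw [inv_mul_cancel_left₀ hn.ne', Complex.ofReal_exp]
    congr 2
    push_cast
    linear_combination (((n : ℂ) + 1) * t) * Complex.I_sq
  simp only [h1]
  have h2 : f = ∫ s in Ioi (0 : ℝ), (Real.exp (-s) : ℂ) • f := by
    rw [integral_smul_const, integral_complex_ofReal, integral_exp_neg_Ioi_zero,
      Complex.ofReal_one, one_smul]
  conv in 𝓝 f => rw [h2]
  refine tendsto_integral_of_dominated_convergence (fun s => Real.exp (-s) * ‖f‖) ?_ ?_ ?_ ?_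
  · intro n
    have h3 : Continuous fun s : ℝ => (Real.exp (-s) : ℂ) := by fun_prop
    refine Continuous.aestronglyMeasurable (h3.smul ?_)
    exact (continuous_shift f).comp (continuous_const.mul continuous_id)
  · have := integrableOn_exp_mul_Ioi (a := -1) (by norm_num) 0
    simp only [neg_mul, one_mul] at this
    exact this.mul_const _
  · intro n
    refine Eventually.of_forall fun s => ?_
    rw [norm_smul, norm_shift, Complex.norm_real, Real.norm_of_nonneg (Real.exp_nonneg _)]
  · refine Eventually.of_forall fun s => Tendsto.const_smul ?_ _
    have h3 : Tendsto (fun n : ℕ => (n + 1 : ℝ)⁻¹ * s) atTop (𝓝 0) := by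
      simpa using (tendsto_one_div_add_atTop_nhds_zero_nat (𝕜 := ℝ)).mul_const s
    have h4 := ((continuous_shift f).tendsto 0).comp h3
    rw [shift_zero] at h4
    exact h4

/-! ### The resolvent of the streaming operator, pointwise -/

/-- A slicewise derivative almost everywhere is a derivative almost everywhere in the product. -/
theorem ae_hasDerivAt_of_ae_ae {ν : Measure ℝ} [SFinite ν] {F D : ℝ × ℝ → ℂ} (hF : Measurable F)
    (hD : Measurable D) (hc : ∀ᵐ μ ∂ν, Continuous fun x => F (x, μ))
    (h : ∀ᵐ μ ∂ν, ∀ᵐ x : ℝ, HasDerivAt (fun x => F (x, μ)) (D (x, μ)) x) :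
    ∀ᵐ p ∂((volume : Measure ℝ).prod ν), HasDerivAt (fun x => F (x, p.2)) (D p) p.1 := by
  -- Differentiability with derivative `D` is encoded by countably many conditions on rational
  -- increments, so that the set is measurable and Fubini applies. Continuity of the slices brings
  -- back the real increments.
  set E : Set (ℝ × ℝ) := {p | ∀ n : ℕ, ∃ m : ℕ, ∀ q : ℚ, |(q : ℝ)| < 1 / ((m : ℝ) + 1) →
    ‖F (p.1 + q, p.2) - F p - (q : ℝ) • D p‖ ≤ 1 / ((n : ℝ) + 1) * |(q : ℝ)|} with hE
  have hmeas : MeasurableSet E := by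
    simp only [hE, ofPred_forall, ofPred_exists]
    refine MeasurableSet.iInter fun n => MeasurableSet.iUnion fun m => MeasurableSet.iInter fun q =>
      MeasurableSet.iInter fun _ => measurableSet_le (Measurable.norm ?_) measurable_const
    have h1 : Measurable fun p : ℝ × ℝ => F (p.1 + q, p.2) := hF.comp (by fun_prop)
    have h2 : Measurable fun p => (q : ℝ) • D p := hD.const_smul (q : ℝ)
    exact (h1.sub hF).sub h2
  have h1 : ∀ᵐ μ ∂ν, ∀ᵐ x : ℝ, (x, μ) ∈ E := by
    filter_upwards [h] with μ hμ
    filter_upwards [hμ] with x hx n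
    rw [hasDerivAt_iff_isLittleO_nhds_zero, Asymptotics.isLittleO_iff] at hx
    obtain ⟨ε, hε, hb⟩ := Metric.eventually_nhds_iff.1
      (hx (show (0 : ℝ) < 1 / ((n : ℝ) + 1) by positivity))
    obtain ⟨m, hm⟩ := exists_nat_one_div_lt hε
    refine ⟨m, fun q hq => ?_⟩
    have := hb (y := (q : ℝ)) (by
      rw [dist_zero_right, Real.norm_eq_abs]; exact hq.trans hm)
    rwa [Real.norm_eq_abs] at this
  have h2 : ∀ᵐ p ∂((volume : Measure ℝ).prod ν), p ∈ E := by
    rw [Measure.ae_prod_mem_iff_ae_ae_mem hmeas]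
    exact (Measure.ae_ae_comm (p := fun μ x => (x, μ) ∈ E) (measurable_swap hmeas)).1 h1
  filter_upwards [h2, Measure.quasiMeasurePreserving_snd.ae hc] with p hp hcp
  rw [hasDerivAt_iff_isLittleO_nhds_zero, Asymptotics.isLittleO_iff]
  intro ε hε
  obtain ⟨n, hn⟩ := exists_nat_one_div_lt hε
  obtain ⟨m, hm⟩ := hp n
  have hm0 : (0 : ℝ) < 1 / ((m : ℝ) + 1) := by positivity
  filter_upwards [Metric.ball_mem_nhds (0 : ℝ) hm0] with y hy
  have hcl : y ∈ closure (Metric.ball (0 : ℝ) (1 / ((m : ℝ) + 1)) ∩ range ((↑) : ℚ → ℝ)) :=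
    Rat.denseRange_cast.open_subset_closure_inter Metric.isOpen_ball hy
  have hclosed : IsClosed {y : ℝ | ‖F (p.1 + y, p.2) - F p - y • D p‖ ≤
      1 / ((n : ℝ) + 1) * |y|} := by
    refine isClosed_le ?_ (by fun_prop)
    have h3 : Continuous fun y : ℝ => F (p.1 + y, p.2) :=
      hcp.comp (continuous_const.add continuous_id)
    exact ((h3.sub continuous_const).sub (continuous_id.smul continuous_const)).norm
  have hsub : Metric.ball (0 : ℝ) (1 / ((m : ℝ) + 1)) ∩ range ((↑) : ℚ → ℝ) ⊆
      {y : ℝ | ‖F (p.1 + y, p.2) - F p - y • D p‖ ≤ 1 / ((n : ℝ) + 1) * |y|} := by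
    rintro _ ⟨hq, q, rfl⟩
    rw [mem_ball_zero_iff, Real.norm_eq_abs] at hq
    exact hm q hq
  refine (hclosed.closure_subset_iff.2 hsub hcl).trans ?_
  rw [Real.norm_eq_abs]
  gcongr

theorem absolutelyContinuousOnInterval_ofReal {u : ℝ → ℝ} {a b : ℝ}
    (hu : AbsolutelyContinuousOnInterval u a b) (v : ℂ) :
    AbsolutelyContinuousOnInterval (fun x => u x • v) a b :=
  hu.smul ((contDiff_const (c := v) (n := 1)).contDiffOn.absolutelyContinuousOnInterval)

theorem absolutelyContinuousOnInterval_integral {w : ℝ → ℂ} (hw : LocallyIntegrable w volume)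
    (a b c : ℝ) : AbsolutelyContinuousOnInterval (fun x => ∫ t in c..x, w t) a b := by
  have hi : ∀ x y, IntervalIntegrable w volume x y := fun x y =>
    intervalIntegrable_iff.2 ((hw.integrableOn_isCompact isCompact_uIcc).mono_set uIoc_subset_uIcc)
  have hre : ∀ x y, IntervalIntegrable (fun t => (w t).re) volume x y := fun x y =>
    ⟨(hi x y).1.re, (hi x y).2.re⟩
  have him : ∀ x y, IntervalIntegrable (fun t => (w t).im) volume x y := fun x y =>
    ⟨(hi x y).1.im, (hi x y).2.im⟩
  have e : (fun x => ∫ t in c..x, w t) = fun x => (∫ t in c..a, w t) +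
      ((∫ t in a..x, (w t).re) • (1 : ℂ) + (∫ t in a..x, (w t).im) • Complex.I) := by
    ext1 x
    rw [← intervalIntegral.integral_add_adjacent_intervals (hi c a) (hi a x)]
    congr 1
    have h1 := Complex.reCLM.intervalIntegral_comp_comm (hi a x)
    have h2 := Complex.imCLM.intervalIntegral_comp_comm (hi a x)
    simp only [Complex.reCLM_apply, Complex.imCLM_apply] at h1 h2
    rw [h1, h2]
    apply Complex.ext <;> simp
  rw [e]
  refine AbsolutelyContinuousOnInterval.add
    (contDiff_const (n := 1)).contDiffOn.absolutelyContinuousOnInterval ?_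
  exact (absolutelyContinuousOnInterval_ofReal
    ((hre a b).absolutelyContinuousOnInterval_intervalIntegral left_mem_uIcc) 1).add
    (absolutelyContinuousOnInterval_ofReal
      ((him a b).absolutelyContinuousOnInterval_intervalIntegral left_mem_uIcc) Complex.I)

/-- The solution of `i μ ∂ₓf - z f = g` on a line. -/
def lineSolution (z : ℂ) (μ : ℝ) (g : ℝ → ℂ) (x : ℝ) : ℂ :=
  Complex.I * ∫ t in Ioi (0 : ℝ), Complex.exp (Complex.I * z * t) * g (x + t * μ)

/-- Variation of constants: translating the variable of integration by x/μ pulls the exponential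
e^{-izx/μ} out and leaves a primitive in `x`. From this form the absolute continuity and the
derivative can be read off. Working with `w (μ * t)` treats both signs of μ at once. -/
theorem lineSolution_eq {z : ℂ} (hz : 0 < z.im) {μ : ℝ} (hμ : μ ≠ 0) {g : ℝ → ℂ}
    (hgm : Measurable g) (hg : MemLp g 2 volume) :
    LocallyIntegrable (fun t : ℝ => Complex.exp (Complex.I * z * (t / μ : ℝ)) * g t) volume ∧
    ∃ C : ℂ, ∀ x, lineSolution z μ g x = Complex.I * Complex.exp (-(Complex.I * z * (x / μ : ℝ))) *
      (C - (μ : ℂ)⁻¹ * ∫ t in (0 : ℝ)..x, Complex.exp (Complex.I * z * (t / μ : ℝ)) * g t) := by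
  set w : ℝ → ℂ := fun t : ℝ => Complex.exp (Complex.I * z * (t / μ : ℝ)) * g t with hw
  have hcont : Continuous fun t : ℝ => Complex.exp (Complex.I * z * (t / μ : ℝ)) := by fun_prop
  have hloc : LocallyIntegrable w volume :=
    (hg.locallyIntegrable (by norm_num)).continuous_mul hcont
  refine ⟨hloc, ∫ t in Ioi (0 : ℝ), w (μ * t), fun x => ?_⟩
  have hv : ∀ a : ℝ, IntegrableOn (fun t => w (μ * t)) (Ioi a) := by
    intro a
    have h1 : MemLp (fun t : ℝ => g (μ * t)) 2 (volume.restrict (Ioi a)) := by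
      refine MemLp.restrict _ ?_
      have hm : AEStronglyMeasurable (fun t : ℝ => g (μ * t)) volume :=
        (hgm.comp (measurable_const_mul μ)).aestronglyMeasurable
      rw [memLp_two_iff_integrable_sq_norm hm]
      exact ((memLp_two_iff_integrable_sq_norm hg.1).1 hg).comp_mul_left' hμ
    have h2 : MemLp (fun t : ℝ => Complex.exp (Complex.I * z * t)) 2 (volume.restrict (Ioi a)) := by
      rw [memLp_two_iff_integrable_sq_norm (by fun_prop)]
      have := integrableOn_exp_mul_Ioi (a := 2 * -z.im) (by linarith) a
      refine this.congr (Eventually.of_forall fun t => ?_)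
      simp only [norm_cexp_I_mul, ← Real.exp_nat_mul]
      congr 1; push_cast; ring
    have h3 := h2.integrable_mul h1
    refine h3.congr (Eventually.of_forall fun t => ?_)
    simp only [hw, Pi.mul_apply, mul_div_cancel_left₀ _ hμ]
  have h1 : ∫ t in Ioi (0 : ℝ), Complex.exp (Complex.I * z * t) * g (x + t * μ) =
      Complex.exp (-(Complex.I * z * (x / μ : ℝ))) * ∫ t in Ioi (x / μ), w (μ * t) := by
    rw [← integral_const_mul, ← integral_indicator measurableSet_Ioi,
      ← integral_indicator measurableSet_Ioi,
      ← integral_add_right_eq_self ((Ioi (x / μ)).indicator _) (x / μ)]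
    congr 1; ext1 t
    by_cases ht : t ∈ Ioi (0 : ℝ)
    · rw [indicator_of_mem ht, indicator_of_mem (by simpa using ht)]
      simp only [hw]
      rw [← mul_assoc, ← Complex.exp_add, mul_div_cancel_left₀ _ hμ]
      congr 2
      · push_cast; ring
      · field_simp; ring
    · rw [indicator_of_notMem ht, indicator_of_notMem (by simpa using ht)]
  have h2 : ∫ t in Ioi (x / μ), w (μ * t) =
      (∫ t in Ioi (0 : ℝ), w (μ * t)) - (μ : ℂ)⁻¹ * ∫ t in (0 : ℝ)..x, w t := by
    rw [eq_sub_iff_add_eq']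
    have h3 : (μ : ℂ)⁻¹ * ∫ t in (0 : ℝ)..x, w t = ∫ t in (0 : ℝ)..(x / μ), w (μ * t) := by
      rw [intervalIntegral.integral_comp_mul_left _ hμ, mul_zero, mul_div_cancel₀ _ hμ,
        Complex.real_smul, Complex.ofReal_inv]
    rw [h3]
    refine intervalIntegral.integral_interval_add_Ioi' ?_ (hv _)
    rw [intervalIntegrable_iff]
    refine (hv (min 0 (x / μ))).mono_set ?_
    exact Ioc_subset_Ioi_self
  rw [lineSolution, h1, h2, ← mul_assoc]

theorem lineSolution_spec {z : ℂ} (hz : 0 < z.im) {μ : ℝ} (hμ : μ ≠ 0) {g : ℝ → ℂ}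
    (hgm : Measurable g) (hg : MemLp g 2 volume) :
    (∀ a b, AbsolutelyContinuousOnInterval (lineSolution z μ g) a b) ∧
    ∀ᵐ x : ℝ, HasDerivAt (lineSolution z μ g)
      ((g x + z * lineSolution z μ g x) / (Complex.I * μ)) x := by
  obtain ⟨hloc, C, hC⟩ := lineSolution_eq hz hμ hgm hg
  set w : ℝ → ℂ := fun t : ℝ => Complex.exp (Complex.I * z * (t / μ : ℝ)) * g t with hw
  have hμ' : (μ : ℂ) ≠ 0 := Complex.ofReal_ne_zero.2 hμ
  set e : ℝ → ℂ := fun x : ℝ => Complex.I * Complex.exp (-(Complex.I * z * (x / μ : ℝ))) with he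
  have heq : lineSolution z μ g = fun x => e x • (C - (μ : ℂ)⁻¹ • ∫ t in (0 : ℝ)..x, w t) := by
    ext1 x; simp only [hC x, smul_eq_mul, he, hw]
  have hed : ∀ x, HasDerivAt e (-(Complex.I * z / μ) * e x) x := by
    intro x
    have h0 : HasDerivAt (fun x : ℝ => ((x / μ : ℝ) : ℂ)) ((1 / μ : ℝ) : ℂ) x :=
      ((hasDerivAt_id x).div_const μ).ofReal_comp
    refine (((h0.const_mul (Complex.I * z)).neg.cexp).const_mul Complex.I).congr_deriv ?_
    simp only [he, Pi.neg_apply]; push_cast; ring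
  have hec : ContDiff ℝ 1 e := by
    simp only [he]
    refine contDiff_const.mul (ContDiff.cexp (ContDiff.neg (contDiff_const.mul ?_)))
    exact Complex.ofRealCLM.contDiff.comp (contDiff_id.div_const μ)
  refine ⟨fun a b => ?_, ?_⟩
  · rw [heq]
    refine hec.contDiffOn.absolutelyContinuousOnInterval.smul ?_
    refine ((contDiff_const (n := 1)).contDiffOn.absolutelyContinuousOnInterval).sub ?_
    exact (absolutelyContinuousOnInterval_integral hloc a b 0).const_smul _
  · filter_upwards [LocallyIntegrable.ae_hasDerivAt_integral hloc] with x hx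
    have h1 := (hed x).mul (((hx 0).const_mul (μ : ℂ)⁻¹).const_sub C)
    rw [heq]
    refine h1.congr_deriv ?_
    have h2 : e x * w x = Complex.I * g x := by
      simp only [he, hw]
      rw [mul_assoc, ← mul_assoc (Complex.exp _), ← Complex.exp_add]
      simp
    simp only [smul_eq_mul]
    generalize (∫ t in (0 : ℝ)..x, w t) = J at *
    rw [show e x * -((μ : ℂ)⁻¹ * w x) = -(μ : ℂ)⁻¹ * (e x * w x) by ring, h2]
    field_simp
    linear_combination (-e x * (C * μ - J) * z - μ * g x) * Complex.I_sq

theorem measurePreserving_prod_shear (ν : Measure ℝ) [SFinite ν] :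
    MeasurePreserving (fun q : ℝ × (ℝ × ℝ) => (q.1, shear q.1 q.2)) (ν.prod phaseMeasure)
      (ν.prod phaseMeasure) := by
  refine (MeasurePreserving.id ν).skew_product (g := shear) ?_
    (Eventually.of_forall fun t => (measurePreserving_shear t).map_eq)
  unfold shear Function.uncurry
  fun_prop

theorem measurable_coeFn (h : PhaseSpace) : Measurable (h : ℝ × ℝ → ℂ) :=
  (Lp.stronglyMeasurable h).measurable

theorem measurable_cexp_mul_comp_shear (z : ℂ) (h : PhaseSpace) :
    Measurable fun q : ℝ × (ℝ × ℝ) => Complex.exp (Complex.I * z * q.1) * h (shear q.1 q.2) := by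
  refine Measurable.mul (by fun_prop) ((measurable_coeFn h).comp ?_)
  unfold shear
  fun_prop

/-- Justifies Fubini in `shiftLaplace_ae_eq`. A square integrable function is dominated by |h|² + 1,
which is integrable on sets of finite measure, and the shear preserves the measure. -/
theorem integrable_cexp_mul_comp_shear {z : ℂ} (hz : 0 < z.im) (h : PhaseSpace) {s : Set (ℝ × ℝ)}
    (hs : phaseMeasure s < ∞) :
    Integrable (fun q : ℝ × (ℝ × ℝ) => Complex.exp (Complex.I * z * q.1) * h (shear q.1 q.2))
      ((volume.restrict (Ioi (0 : ℝ))).prod (phaseMeasure.restrict s)) := by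
  have hexp : Integrable (fun t : ℝ => Real.exp (-z.im * t)) (volume.restrict (Ioi (0 : ℝ))) :=
    integrableOn_exp_mul_Ioi (neg_lt_zero.2 hz) 0
  have hsq : Integrable (fun p => ‖h p‖ ^ 2) phaseMeasure :=
    (Lp.memLp h).integrable_norm_pow (by norm_num)
  have h1 : Integrable (fun q : ℝ × (ℝ × ℝ) => Real.exp (-z.im * q.1) * ‖h (shear q.1 q.2)‖ ^ 2)
      ((volume.restrict (Ioi (0 : ℝ))).prod (phaseMeasure.restrict s)) := by
    have h2 := (measurePreserving_prod_shear (volume.restrict (Ioi (0 : ℝ)))).integrable_comp_of_integrable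
      (hexp.mul_prod hsq)
    refine h2.mono_measure (Measure.prod_mono le_rfl Measure.restrict_le_self)
  have h2 : Integrable (fun q : ℝ × (ℝ × ℝ) => Real.exp (-z.im * q.1) * 1)
      ((volume.restrict (Ioi (0 : ℝ))).prod (phaseMeasure.restrict s)) := by
    have : IsFiniteMeasure (phaseMeasure.restrict s) := ⟨by simpa using hs⟩
    exact hexp.mul_prod (integrable_const 1)
  refine (h1.add h2).mono' (measurable_cexp_mul_comp_shear z h).aestronglyMeasurable
    (Eventually.of_forall fun q => ?_)
  rw [norm_mul, norm_cexp_I_mul]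
  simp only [Pi.add_apply]
  rw [← mul_add]
  gcongr
  nlinarith [sq_nonneg (‖h (shear q.1 q.2)‖ - 1), norm_nonneg (h (shear q.1 q.2))]

/-- The pointwise resolvent of `i μ ∂ₓ`. -/
def streamSolution (z : ℂ) (h : PhaseSpace) (p : ℝ × ℝ) : ℂ :=
  lineSolution z p.2 (fun x => h (x, p.2)) p.1

theorem streamSolution_eq (z : ℂ) (h : PhaseSpace) (p : ℝ × ℝ) : streamSolution z h p =
    Complex.I * ∫ t in Ioi (0 : ℝ), Complex.exp (Complex.I * z * t) * h (shear t p) := rfl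

theorem measurable_streamSolution (z : ℂ) (h : PhaseSpace) : Measurable (streamSolution z h) := by
  have h1 : StronglyMeasurable (Function.uncurry fun (p : ℝ × ℝ) (t : ℝ) =>
      Complex.exp (Complex.I * z * t) * h (shear t p)) :=
    ((measurable_cexp_mul_comp_shear z h).comp measurable_swap).stronglyMeasurable
  exact (h1.integral_prod_right (ν := volume.restrict (Ioi (0 : ℝ)))).measurable.const_mul Complex.I

/-- The left side is a Bochner integral in L², the right side an integral at each point. Pairing
both with indicators of sets of finite measure and exchanging the integrals identifies them. -/
theorem shiftLaplace_ae_eq {z : ℂ} (hz : 0 < z.im) (h : PhaseSpace) :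
    (Complex.I • shiftLaplace z hz) h =ᵐ[phaseMeasure] streamSolution z h := by
  have hint : ∀ s, MeasurableSet s → phaseMeasure s < ∞ →
      IntegrableOn (streamSolution z h) s phaseMeasure := fun s _ hμs =>
    (integrable_cexp_mul_comp_shear hz h hμs).swap.integral_prod_left.const_mul Complex.I
  refine ae_eq_of_forall_setIntegral_eq_of_sigmaFinite (fun s hs hμs => ?_) hint
    (fun s hs hμs => ?_)
  · have : IsFiniteMeasure (phaseMeasure.restrict s) := ⟨by simpa using hμs⟩
    exact ((Lp.memLp _).restrict s).integrable (by norm_num)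
  · rw [← L2.inner_indicatorConstLp_one (𝕜 := ℂ) hs hμs.ne, _root_.smul_apply, inner_smul_right,
      shiftLaplace_apply, ← innerSL_apply_apply ℂ,
      ← ContinuousLinearMap.integral_comp_comm _ (integrableOn_cexp_smul_shift hz h 0)]
    simp only [streamSolution_eq]
    rw [integral_const_mul, ← integral_integral_swap (integrable_cexp_mul_comp_shear hz h hμs)]
    congr 2; ext1 t
    rw [innerSL_apply_apply, inner_smul_right, L2.inner_indicatorConstLp_one, integral_const_mul]
    congr 1
    refine integral_congr_ae (ae_restrict_of_ae (coeFn_shift t h))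

theorem ae_memLp_slice (h : PhaseSpace) :
    ∀ᵐ μ ∂angleMeasure, MemLp (fun x => h (x, μ)) 2 volume := by
  have h1 : Integrable (fun q => ‖h q‖ ^ 2) phaseMeasure :=
    (Lp.memLp h).integrable_norm_pow (by norm_num)
  filter_upwards [h1.prod_left_ae] with μ hμ
  refine (memLp_two_iff_integrable_sq_norm ?_).2 hμ
  exact ((measurable_coeFn h).comp (by fun_prop)).aestronglyMeasurable

theorem ae_angle_ne_zero : ∀ᵐ μ ∂angleMeasure, μ ≠ 0 :=
  ae_restrict_of_ae (by simp [ae_iff])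

theorem continuous_of_absolutelyContinuousOnInterval {f : ℝ → ℂ}
    (h : ∀ a b, AbsolutelyContinuousOnInterval f a b) : Continuous f := by
  rw [continuous_iff_continuousAt]
  intro y
  refine ((h (y - 1) (y + 1)).continuousOn).continuousAt ?_
  rw [uIcc_of_le (by linarith)]
  exact Icc_mem_nhds (by linarith) (by linarith)

theorem isStreamingPair_of_ae_eq {z : ℂ} (hz : 0 < z.im) {f h : PhaseSpace}
    (hf : f =ᵐ[phaseMeasure] streamSolution z h) : IsStreamingPair f (h + z • f) := by
  have hspec : ∀ᵐ μ ∂angleMeasure,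
      (∀ a b, AbsolutelyContinuousOnInterval (fun x => streamSolution z h (x, μ)) a b) ∧
      ∀ᵐ x : ℝ, HasDerivAt (fun x => streamSolution z h (x, μ))
        ((h (x, μ) + z * streamSolution z h (x, μ)) / (Complex.I * μ)) x := by
    filter_upwards [ae_memLp_slice h, ae_angle_ne_zero] with μ h1 h2
    have h3 : Measurable fun x => h (x, μ) := (measurable_coeFn h).comp measurable_prodMk_right
    obtain ⟨h4, h5⟩ := lineSolution_spec hz h2 h3 h1
    exact ⟨h4, h5⟩
  refine ⟨streamSolution z h, hf, ?_, ?_⟩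
  · exact hspec.mono fun μ hμ => hμ.1
  have hmeas := measurable_streamSolution z h
  have hmeasD : Measurable fun p : ℝ × ℝ =>
      (h p + z * streamSolution z h p) / (Complex.I * p.2) :=
    ((measurable_coeFn h).add (hmeas.const_mul z)).div (by fun_prop)
  have hd := ae_hasDerivAt_of_ae_ae hmeas hmeasD
    (hspec.mono fun μ hμ => continuous_of_absolutelyContinuousOnInterval hμ.1)
    (hspec.mono fun μ hμ => hμ.2)
  filter_upwards [hd, Measure.quasiMeasurePreserving_snd.ae ae_angle_ne_zero,
    hf, Lp.coeFn_add h (z • f),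
    Lp.coeFn_smul z f] with p h1 h2 h3 h4 h5
  refine ⟨h1.differentiableAt, ?_⟩
  rw [h1.deriv, h4, Pi.add_apply, h5, Pi.smul_apply, h3, smul_eq_mul]
  have : (p.2 : ℂ) ≠ 0 := Complex.ofReal_ne_zero.2 h2
  field_simp

theorem not_integrable_of_exp_growth {f : ℝ → ℂ} {C : ℂ} {b : ℝ} (hb : b ≠ 0)
    (hf : ∀ x, ‖f x‖ = ‖C‖ * Real.exp (b * x)) (hi : Integrable (fun x => ‖f x‖ ^ 2)) : C = 0 := by
  by_contra hC
  have hC' : 0 < ‖C‖ := norm_pos_iff.2 hC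
  have h1 := hi.measure_norm_ge_lt_top (ε := ‖C‖ ^ 2) (by positivity)
  have h2 : ∀ x, 0 ≤ b * x → x ∈ {x | ‖C‖ ^ 2 ≤ ‖‖f x‖ ^ 2‖} := by
    intro x hx
    rw [mem_ofPred_eq, Real.norm_of_nonneg (by positivity), hf]
    have : 1 ≤ Real.exp (b * x) := Real.one_le_exp hx
    gcongr
    nlinarith
  rcases lt_or_gt_of_ne hb with hb | hb
  · have h3 : Iio (0 : ℝ) ⊆ {x | ‖C‖ ^ 2 ≤ ‖‖f x‖ ^ 2‖} := fun x hx =>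
      h2 x (mul_nonneg_of_nonpos_of_nonpos hb.le (le_of_lt hx))
    exact absurd (h1.trans_le' (measure_mono h3)) (by simp)
  · have h3 : Ioi (0 : ℝ) ⊆ {x | ‖C‖ ^ 2 ≤ ‖‖f x‖ ^ 2‖} := fun x hx =>
      h2 x (mul_nonneg hb.le (le_of_lt hx))
    exact absurd (h1.trans_le' (measure_mono h3)) (by simp)

/-- With the integrating factor e^{izx/μ} almost every slice becomes absolutely continuous with
derivative zero, hence constant. So |F(·, μ)| is an exponential of nonzero rate Im z/μ, which is
square integrable only if it vanishes. -/
theorem IsStreamingPair.eq_zero_of_eigen {z : ℂ} (hz : 0 < z.im) {f : PhaseSpace}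
    (h : IsStreamingPair f (z • f)) : f = 0 := by
  obtain ⟨F, hF, hac, hd⟩ := h
  have swap : ∀ {P : ℝ × ℝ → Prop}, (∀ᵐ p ∂phaseMeasure, P p) →
      ∀ᵐ μ ∂angleMeasure, ∀ᵐ x : ℝ, P (x, μ) := fun hP =>
    Measure.ae_ae_of_ae_prod (Measure.measurePreserving_swap.quasiMeasurePreserving.ae hP)
  have h3 : ∀ᵐ μ ∂angleMeasure, ∀ x : ℝ, F (x, μ) = 0 := by
    filter_upwards [hac, swap hd, swap hF, swap (Lp.coeFn_smul z f), ae_memLp_slice f,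
      ae_angle_ne_zero] with μ hac hd hF hs hL hμ
    have hμ' : (μ : ℂ) ≠ 0 := Complex.ofReal_ne_zero.2 hμ
    set e : ℝ → ℂ := fun x : ℝ => Complex.exp (Complex.I * z * (x / μ : ℝ)) with he
    have hed : ∀ x, HasDerivAt e (Complex.I * z / μ * e x) x := by
      intro x
      have h0 : HasDerivAt (fun x : ℝ => ((x / μ : ℝ) : ℂ)) ((1 / μ : ℝ) : ℂ) x :=
        ((hasDerivAt_id x).div_const μ).ofReal_comp
      refine ((h0.const_mul (Complex.I * z)).cexp).congr_deriv ?_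
      simp only [he]; push_cast; ring
    have hec : ContDiff ℝ 1 e := by
      simp only [he]
      refine ContDiff.cexp (contDiff_const.mul ?_)
      exact Complex.ofRealCLM.contDiff.comp (contDiff_id.div_const μ)
    have hG : ∀ a b, AbsolutelyContinuousOnInterval (fun x => e x • F (x, μ)) a b := fun a b =>
      hec.contDiffOn.absolutelyContinuousOnInterval.smul (hac a b)
    have hG0 : ∀ᵐ x : ℝ, HasDerivAt (fun x => e x • F (x, μ)) 0 x := by
      filter_upwards [hd, hF, hs] with x h1 h2 h3
      refine ((hed x).mul h1.1.hasDerivAt).congr_deriv ?_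
      have h4 := h1.2
      rw [h3, Pi.smul_apply, smul_eq_mul, h2] at h4
      have h5 : deriv (fun x => F (x, μ)) x = -(Complex.I * z / μ) * F (x, μ) := by
        rw [neg_mul, div_mul_eq_mul_div, mul_assoc, h4]
        field_simp
        linear_combination (deriv (fun x => F (x, μ)) x) * Complex.I_sq
      simp only [h5]
      ring
    have hconst : ∀ x, e x * F (x, μ) = e 0 * F (0, μ) := by
      intro x
      obtain ⟨C, hC⟩ := (hG 0 x).const_of_ae_hasDerivAt_zero (hG0.mono fun _ h _ => h)
      exact (hC x right_mem_uIcc).trans (hC 0 left_mem_uIcc).symm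
    have he0 : ∀ x, e x ≠ 0 := fun x => Complex.exp_ne_zero _
    have hnorm : ∀ x, ‖F (x, μ)‖ = ‖F (0, μ)‖ * Real.exp (z.im / μ * x) := by
      intro x
      have h1 := congrArg norm (hconst x)
      have h2 : ∀ x, ‖e x‖ = Real.exp (-(z.im / μ * x)) := by
        intro x
        simp only [he]
        rw [norm_cexp_I_mul]; congr 1; ring
      rw [norm_mul, norm_mul, h2, h2, Real.exp_neg, mul_zero, neg_zero, Real.exp_zero, one_mul] at h1
      rw [← h1]
      field_simp
    have hi : Integrable (fun x => ‖F (x, μ)‖ ^ 2) := by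
      refine ((memLp_two_iff_integrable_sq_norm hL.1).1 hL).congr ?_
      filter_upwards [hF] with x hx
      rw [hx]
    have h00 : F (0, μ) = 0 := not_integrable_of_exp_growth (div_ne_zero hz.ne' hμ) hnorm hi
    intro x
    have := hconst x
    rw [h00, mul_zero] at this
    exact (mul_eq_zero.1 this).resolve_left (he0 x)
  have h4 : ∀ᵐ p ∂phaseMeasure, ∀ x : ℝ, F (x, p.2) = 0 :=
    Measure.quasiMeasurePreserving_snd.ae h3
  rw [Lp.eq_zero_iff_ae_eq_zero]
  filter_upwards [h4, hF] with p h h'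
  rw [h', Pi.zero_apply]
  exact h p.1

theorem isStreamingPair_iff {f g : PhaseSpace} :
    IsStreamingPair f g ↔ ∃ h : f ∈ streamingOp.domain, streamingOp ⟨f, h⟩ = g := by
  have h1 : streamingOp.graph = streamingGraph :=
    streamingGraph.toLinearPMap_graph_eq streamingGraph_functional
  change (f, g) ∈ streamingGraph ↔ _
  rw [← h1, LinearPMap.mem_graph_iff]
  constructor
  · rintro ⟨⟨y, hy⟩, h2, h3⟩
    simp only at h2 h3
    subst h2
    exact ⟨hy, h3⟩
  · rintro ⟨h, e⟩
    exact ⟨⟨f, h⟩, rfl, e⟩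

/-- The resolvent of `i μ ∂ₓ` in the upper half-plane. -/
theorem isResolventAt_streamingOp {z : ℂ} (hz : 0 < z.im) :
    IsResolventAt streamingOp z (Complex.I • shiftLaplace z hz) := by
  set R := Complex.I • shiftLaplace z hz with hR
  have h1 : ∀ f, ∃ h : R f ∈ streamingOp.domain, streamingOp ⟨R f, h⟩ - z • R f = f := by
    intro f
    obtain ⟨h, e⟩ := isStreamingPair_iff.1 (isStreamingPair_of_ae_eq hz (shiftLaplace_ae_eq hz f))
    exact ⟨h, by rw [e, add_sub_cancel_right]⟩
  refine ⟨h1, fun u => ?_⟩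
  obtain ⟨hd, e⟩ := h1 (streamingOp u - z • (u : PhaseSpace))
  set v := R (streamingOp u - z • (u : PhaseSpace))
  -- The difference between R(L₀ - z)u and u solves the homogeneous equation.
  have h2 : IsStreamingPair (v - u) (z • (v - u)) := by
    refine isStreamingPair_iff.2 ⟨sub_mem hd u.2, ?_⟩
    have h3 : (⟨v - u, sub_mem hd u.2⟩ : streamingOp.domain) = ⟨v, hd⟩ - u := rfl
    rw [h3, LinearPMap.map_sub, smul_sub, sub_eq_sub_iff_sub_eq_sub]
    exact e
  exact sub_eq_zero.1 (h2.eq_zero_of_eigen hz)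

theorem dense_streamingOp_domain : Dense (streamingOp.domain : Set PhaseSpace) := by
  intro f
  refine mem_closure_of_tendsto (tendsto_smul_shiftLaplace f) (Eventually.of_forall fun n => ?_)
  refine Submodule.smul_mem _ _ ?_
  obtain ⟨h, -⟩ := (isResolventAt_streamingOp (z := Complex.I * ((n + 1 : ℝ) : ℂ))
    (by simp; positivity)).1 f
  have := Submodule.smul_mem _ (-Complex.I) h
  rwa [_root_.smul_apply, smul_smul, neg_mul, Complex.I_mul_I, neg_neg, one_smul] at this

theorem resolventOp_streamingOp {z : ℂ} (hz : 0 < z.im) :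
    resolventOp streamingOp z = Complex.I • shiftLaplace z hz :=
  (isResolventAt_streamingOp hz).resolventOp_eq

theorem re_inner_I_smul_resolventOp_nonpos {z : ℂ} (hz : 0 < z.im) (f : PhaseSpace) :
    (⟪f, Complex.I • resolventOp streamingOp z f⟫_ℂ).re ≤ 0 := by
  rw [resolventOp_streamingOp hz, _root_.smul_apply, smul_smul, Complex.I_mul_I, neg_smul,
    one_smul, inner_neg_right, Complex.neg_re, re_inner_shiftLaplace hz]
  have := mul_nonneg hz.le (sq_nonneg ‖shiftLaplace z hz f‖)
  linarith

/-! ### Exponential integrals and their logarithms -/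

/-- The exponential integral `∫_a^∞ e^{izt} t^{-m-1} dt`. -/
def expTail (a : ℝ) (m : ℕ) (z : ℂ) : ℂ :=
  ∫ t in Ioi a, Complex.exp (Complex.I * z * t) * ((t : ℂ) ^ (m + 1))⁻¹

theorem norm_inv_pow_le {a t : ℝ} (ha : 0 < a) (ht : a ≤ t) (m : ℕ) :
    ‖((t : ℂ) ^ m)⁻¹‖ ≤ (a ^ m)⁻¹ := by
  rw [norm_inv, norm_pow, Complex.norm_real, Real.norm_of_nonneg (ha.le.trans ht)]
  gcongr

theorem aestronglyMeasurable_cexp_mul_inv_pow (a : ℝ) (m : ℕ) (z : ℂ) :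
    AEStronglyMeasurable (fun t : ℝ => Complex.exp (Complex.I * z * t) * ((t : ℂ) ^ m)⁻¹)
      (volume.restrict (Ioi a)) :=
  Measurable.aestronglyMeasurable (by fun_prop)

theorem integrableOn_cexp_mul_inv_pow {a : ℝ} (ha : 0 < a) (m : ℕ) {z : ℂ} (hz : 0 < z.im) :
    IntegrableOn (fun t : ℝ => Complex.exp (Complex.I * z * t) * ((t : ℂ) ^ m)⁻¹) (Ioi a) := by
  refine Integrable.mono' ((integrableOn_exp_mul_Ioi (neg_lt_zero.2 hz) a).mul_const (a ^ m)⁻¹)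
    (aestronglyMeasurable_cexp_mul_inv_pow a m z) ?_
  filter_upwards [ae_restrict_mem measurableSet_Ioi] with t ht
  rw [norm_mul, norm_cexp_I_mul]
  gcongr
  exact norm_inv_pow_le ha (le_of_lt ht) m

theorem tendsto_cexp_mul_inv_pow {a : ℝ} (ha : 0 < a) (m : ℕ) {z : ℂ} (hz : 0 < z.im) :
    Tendsto (fun t : ℝ => Complex.exp (Complex.I * z * t) * ((t : ℂ) ^ m)⁻¹) atTop (𝓝 0) := by
  have h1 : Tendsto (fun t : ℝ => Real.exp (-z.im * t) * (a ^ m)⁻¹) atTop (𝓝 0) := by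
    rw [← zero_mul (a ^ m)⁻¹]
    refine (Real.tendsto_exp_atBot.comp ?_).mul_const _
    exact tendsto_id.const_mul_atTop_of_neg (neg_lt_zero.2 hz)
  refine squeeze_zero_norm' ?_ h1
  filter_upwards [eventually_ge_atTop a] with t ht
  rw [norm_mul, norm_cexp_I_mul]
  gcongr
  exact norm_inv_pow_le ha ht m

/-- Integration by parts; the boundary term at infinity vanishes because Im z > 0. -/
theorem expTail_succ {a : ℝ} (ha : 0 < a) (m : ℕ) {z : ℂ} (hz : 0 < z.im) :
    expTail a (m + 1) z = (Complex.exp (Complex.I * z * a) * ((a : ℂ) ^ (m + 1))⁻¹ +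
      Complex.I * z * expTail a m z) / ((m : ℂ) + 1) := by
  have hd : ∀ t ∈ Ici a, HasDerivAt
      (fun t : ℝ => Complex.exp (Complex.I * z * t) * ((t : ℂ) ^ (m + 1))⁻¹)
      (Complex.I * z * (Complex.exp (Complex.I * z * t) * ((t : ℂ) ^ (m + 1))⁻¹) -
        ((m : ℂ) + 1) * (Complex.exp (Complex.I * z * t) * ((t : ℂ) ^ (m + 1 + 1))⁻¹)) t := by
    intro t ht
    have ht0 : (t : ℂ) ≠ 0 := Complex.ofReal_ne_zero.2 (ha.trans_le ht).ne'
    have h0 : HasDerivAt (fun t : ℝ => (t : ℂ)) 1 t := (hasDerivAt_id t).ofReal_comp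
    have h1 := ((h0.const_mul (Complex.I * z)).cexp).mul
      ((h0.pow (m + 1)).inv (pow_ne_zero _ ht0))
    refine h1.congr_deriv ?_
    simp only [Pi.pow_apply, Pi.inv_apply]
    field_simp
    push_cast
    ring
  have hi0 := integrableOn_cexp_mul_inv_pow ha (m + 1) hz
  have hi1 := integrableOn_cexp_mul_inv_pow ha (m + 1 + 1) hz
  have h2 := integral_Ioi_of_hasDerivAt_of_tendsto' hd
    ((hi0.const_mul _).sub (hi1.const_mul _)) (tendsto_cexp_mul_inv_pow ha (m + 1) hz)
  rw [integral_sub (hi0.const_mul _) (hi1.const_mul _), integral_const_mul,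
    integral_const_mul] at h2
  change Complex.I * z * expTail a m z - ((m : ℂ) + 1) * expTail a (m + 1) z = _ at h2
  have hm : (m : ℂ) + 1 ≠ 0 := by exact_mod_cast m.succ_ne_zero
  rw [eq_div_iff hm]
  linear_combination -h2

theorem neg_I_mul_mem_slitPlane {z : ℂ} (hz : 0 < z.im) : -Complex.I * z ∈ Complex.slitPlane := by
  left; simpa using hz

/-- Differentiation in `z` produces a factor it which cancels 1/t, leaving an explicit exponential
integral. -/
theorem hasDerivAt_expTail_zero {a : ℝ} (ha : 0 < a) {z : ℂ} (hz : 0 < z.im) :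
    HasDerivAt (expTail a 0) (-(Complex.exp (Complex.I * z * a) / z)) z := by
  have hs : {w : ℂ | z.im / 2 < w.im} ∈ 𝓝 z :=
    (isOpen_lt continuous_const Complex.continuous_im).mem_nhds (by simp; linarith)
  have hpos : ∀ w ∈ {w : ℂ | z.im / 2 < w.im}, 0 < w.im := fun w (hw : z.im / 2 < w.im) => by
    linarith
  have h1 := hasDerivAt_integral_of_dominated_loc_of_deriv_le (μ := volume.restrict (Ioi a))
    (F := fun (w : ℂ) (t : ℝ) => Complex.exp (Complex.I * w * t) * ((t : ℂ) ^ (0 + 1))⁻¹)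
    (F' := fun (w : ℂ) (t : ℝ) => Complex.I * Complex.exp (Complex.I * w * t))
    (bound := fun t => Real.exp (-(z.im / 2) * t)) (x₀ := z) hs
    (Eventually.of_forall fun w => aestronglyMeasurable_cexp_mul_inv_pow a _ w)
    (integrableOn_cexp_mul_inv_pow ha _ hz)
    (Continuous.aestronglyMeasurable (by fun_prop)) ?_
    (integrableOn_exp_mul_Ioi (by linarith) a) ?_
  · refine h1.2.congr_deriv ?_
    have hz0 : z ≠ 0 := by rintro rfl; simp at hz
    rw [integral_const_mul, integral_exp_mul_complex_Ioi (by simpa using hz)]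
    field_simp
  · filter_upwards [ae_restrict_mem measurableSet_Ioi] with t ht w hw
    have ht' : 0 < t := ha.trans ht
    rw [norm_mul, norm_cexp_I_mul, Complex.norm_I, one_mul]
    have : z.im / 2 < w.im := hw
    gcongr
  · filter_upwards [ae_restrict_mem measurableSet_Ioi] with t ht w hw
    have ht0 : (t : ℂ) ≠ 0 := Complex.ofReal_ne_zero.2 (ha.trans ht).ne'
    have h0 : HasDerivAt (fun w : ℂ => Complex.I * w * t) (Complex.I * t) w := by
      simpa using ((hasDerivAt_id w).const_mul Complex.I).mul_const (t : ℂ)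
    refine (h0.cexp.mul_const _).congr_deriv ?_
    field_simp
    simp

/-- The exponential integrals are entire up to a logarithmic term. -/
theorem exists_expTail_eq {a : ℝ} (ha : 0 < a) (m : ℕ) : ∃ h : ℂ → ℂ, Differentiable ℂ h ∧
    ∀ z : ℂ, 0 < z.im → expTail a m z =
      h z - (Complex.I * z) ^ m / (m.factorial : ℂ) * Complex.log (-Complex.I * z) := by
  induction m with
  | zero =>
    -- The derivative of `expTail a 0 z` + ln(-iz) is (1 - e^{iza})/z, whose singularity at 0 is
    -- removable. It therefore has an entire primitive `h`, and the two differ by a constant on the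
    -- half-plane. The induction step then only uses the recursion of `expTail_succ`.
    set φ : ℂ → ℂ := fun z => 1 - Complex.exp (Complex.I * z * a) with hφ
    have hφd : Differentiable ℂ φ := by simp only [hφ]; fun_prop
    have hg : Differentiable ℂ (dslope φ 0) := by
      rw [← differentiableOn_univ, Complex.differentiableOn_dslope univ_mem]
      exact hφd.differentiableOn
    obtain ⟨h, hh⟩ := hg.isExactOn_univ
    set G : ℂ → ℂ := fun z => expTail a 0 z + Complex.log (-Complex.I * z) - h z with hG
    have hGd : ∀ z : ℂ, 0 < z.im → HasDerivAt G 0 z := by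
      intro z hz
      have hz0 : z ≠ 0 := by rintro rfl; simp at hz
      have h1 : HasDerivAt (fun z : ℂ => Complex.log (-Complex.I * z)) (1 / z) z := by
        have h0 : HasDerivAt (fun w : ℂ => -Complex.I * w) (-Complex.I) z := by
          simpa using (hasDerivAt_id z).const_mul (-Complex.I)
        refine (h0.clog (neg_I_mul_mem_slitPlane hz)).congr_deriv ?_
        have := Complex.I_ne_zero
        field_simp
      refine (((hasDerivAt_expTail_zero ha hz).add h1).sub (hh z (mem_univ z))).congr_deriv ?_
      rw [dslope_of_ne _ hz0, slope_def_field]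
      simp only [hφ]
      simp
      field_simp
      ring
    have hopen : IsOpen {z : ℂ | 0 < z.im} := isOpen_lt continuous_const Complex.continuous_im
    have hconst : ∀ z : ℂ, 0 < z.im → G z = G Complex.I := fun z hz =>
      hopen.is_const_of_deriv_eq_zero (convex_halfSpace_im_gt 0).isPreconnected
        (fun w hw => (hGd w hw).differentiableAt.differentiableWithinAt)
        (fun w hw => (hGd w hw).deriv) hz (by simp)
    refine ⟨fun z => h z + G Complex.I, ?_, fun z hz => ?_⟩
    · exact Differentiable.add_const _ fun z => (hh z (mem_univ z)).differentiableAt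
    · change _ = h z + G Complex.I - _
      rw [← hconst z hz]
      simp [hG]
  | succ m ih =>
    obtain ⟨h, hd, he⟩ := ih
    refine ⟨fun z => (Complex.exp (Complex.I * z * a) * ((a : ℂ) ^ (m + 1))⁻¹ +
      Complex.I * z * h z) / ((m : ℂ) + 1), by fun_prop, fun z hz => ?_⟩
    have hm : (m : ℂ) + 1 ≠ 0 := by exact_mod_cast m.succ_ne_zero
    have hf : (m.factorial : ℂ) ≠ 0 := by exact_mod_cast m.factorial_ne_zero
    rw [expTail_succ ha m hz, he z hz, Nat.factorial_succ]
    push_cast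
    field_simp
    ring

/-! ### The square root of V and the moments -/

section Sqrt
variable {H : Type*} [NormedAddCommGroup H] [InnerProductSpace ℂ H] [CompleteSpace H]

theorem coe_sqrtTo_apply {V s : H →L[ℂ] H} (h : s * s = V) (hs : 0 ≤ s) (x : H) :
    (sqrtTo V x : H) = s x := by
  change CFC.sqrt V x = s x
  rw [CFC.sqrt_unique h hs]

theorem sqrtFrom_apply {V s : H →L[ℂ] H} (h : s * s = V) (hs : 0 ≤ s) (e : rangeClosure V) :
    sqrtFrom V e = s e := by
  change CFC.sqrt V e = s e
  rw [CFC.sqrt_unique h hs]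

end Sqrt

theorem integrable_angleMeasure_of_continuous {f : ℝ → ℝ} (hf : Continuous f) :
    Integrable f angleMeasure :=
  hf.continuousOn.integrableOn_Icc

theorem memLp_tensor {φ : ℝ → ℝ} (hφ : MemLp φ 2 volume) (p : Polynomial ℝ) :
    MemLp (fun q : ℝ × ℝ => ((φ q.1 * p.eval q.2 : ℝ) : ℂ)) 2 phaseMeasure := by
  have hm : AEStronglyMeasurable (fun q : ℝ × ℝ => ((φ q.1 * p.eval q.2 : ℝ) : ℂ))
      phaseMeasure := by
    refine Complex.continuous_ofReal.comp_aestronglyMeasurable (hφ.1.comp_fst.mul ?_)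
    exact (p.continuous.comp continuous_snd).aestronglyMeasurable
  rw [memLp_two_iff_integrable_sq_norm hm]
  have h1 := (memLp_two_iff_integrable_sq hφ.1).1 hφ
  have h2 : Integrable (fun μ => p.eval μ ^ 2) angleMeasure :=
    integrable_angleMeasure_of_continuous (p.continuous.pow 2)
  refine (h1.mul_prod h2).congr (Eventually.of_forall fun q => ?_)
  simp only [Complex.norm_real, Real.norm_eq_abs, sq_abs, mul_pow]

/-- The product vector `φ(x) p(μ)`. -/
def tensor {φ : ℝ → ℝ} (hφ : MemLp φ 2 volume) (p : Polynomial ℝ) : PhaseSpace :=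
  (memLp_tensor hφ p).toLp _

theorem coeFn_tensor {φ : ℝ → ℝ} (hφ : MemLp φ 2 volume) (p : Polynomial ℝ) :
    tensor hφ p =ᵐ[phaseMeasure] fun q : ℝ × ℝ => ((φ q.1 * p.eval q.2 : ℝ) : ℂ) :=
  (memLp_tensor hφ p).coeFn_toLp

theorem inner_tensor {φ : ℝ → ℝ} (hφ : MemLp φ 2 volume) (p : Polynomial ℝ) (f : PhaseSpace) :
    Integrable (fun t => (φ t : ℂ) * angleAverage p f t) ∧
      ⟪tensor hφ p, f⟫_ℂ = ∫ t, (φ t : ℂ) * angleAverage p f t := by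
  have hint := L2.integrable_inner (𝕜 := ℂ) (tensor hφ p) f
  have key : ∀ᵐ x : ℝ, ∫ μ, ⟪tensor hφ p (x, μ), f (x, μ)⟫_ℂ ∂angleMeasure =
      (φ x : ℂ) * angleAverage p f x := by
    filter_upwards [Measure.ae_ae_of_ae_prod (coeFn_tensor hφ p)] with x hx
    rw [angleAverage, ← integral_const_mul]
    refine integral_congr_ae ?_
    filter_upwards [hx] with μ hμ
    rw [hμ, RCLike.inner_apply, Complex.conj_ofReal]
    push_cast; ring
  refine ⟨hint.integral_prod_left.congr key, ?_⟩
  rw [L2.inner_def, integral_prod _ hint, integral_congr_ae key]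

namespace Medium
variable (d : Medium)

theorem V_nonneg : 0 ≤ d.V := by
  rw [ContinuousLinearMap.nonneg_iff_isPositive, ContinuousLinearMap.isPositive_iff_complex]
  intro u
  obtain ⟨-, h⟩ := d.inner_V_self u
  rw [h]
  refine ⟨rfl, ?_⟩
  change (0 : ℝ) ≤ ∫ x, d.c x * ∑ i, d.k i ^ 2 * ‖angleAverage (d.P i) u x‖ ^ 2
  refine integral_nonneg_of_ae ?_
  filter_upwards [d.c_nonneg] with x hx
  exact mul_nonneg hx (Finset.sum_nonneg fun i _ => by positivity)

/-- Testing the eigenvalue equation against 𝒫ⱼ shows that every 𝒫ⱼ of nonzero mean has kⱼ² = κ. This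
is what keeps the constant function an eigenfunction after the passage to the square root. -/
theorem k_sq_mul_integral {κ : ℝ} (hκ : ∀ μ ∈ Icc (-1 : ℝ) 1,
    ∑ i, d.k i ^ 2 * (∫ μ', (d.P i).eval μ' ∂angleMeasure) * (d.P i).eval μ = κ) (j : Fin d.N) :
    d.k j ^ 2 * (∫ μ, (d.P j).eval μ ∂angleMeasure) =
      κ * ∫ μ, (d.P j).eval μ ∂angleMeasure := by
  have h1 : ∫ μ, (∑ i, d.k i ^ 2 * (∫ μ', (d.P i).eval μ' ∂angleMeasure) * (d.P i).eval μ) *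
      (d.P j).eval μ ∂angleMeasure = ∫ μ, κ * (d.P j).eval μ ∂angleMeasure := by
    refine integral_congr_ae ?_
    filter_upwards [ae_restrict_mem measurableSet_Icc] with μ hμ
    rw [hκ μ hμ]
  rw [integral_const_mul] at h1
  rw [← h1]
  simp only [Finset.sum_mul, mul_assoc]
  rw [integral_finsetSum]
  · simp only [integral_const_mul, d.orthonormal]
    simp
  · intro i _
    exact integrable_angleMeasure_of_continuous (by fun_prop)

/-- The medium whose imaginary part is `√V`. -/
def root : Medium where
  c := fun x => √(d.c x)
  memLp_c := by
    obtain ⟨h, h'⟩ := d.memLp_c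
    refine memLp_top_of_bound (Real.continuous_sqrt.comp_aestronglyMeasurable h)
      √(eLpNorm d.c ∞ volume).toReal ?_
    filter_upwards [ae_le_eLpNormEssSup (f := d.c) (μ := volume)] with x hx
    have h1 := ENNReal.toReal_mono h'.ne (by simpa [eLpNorm_exponent_top] using hx)
    rw [toReal_enorm] at h1
    rw [Real.norm_of_nonneg (Real.sqrt_nonneg _)]
    exact Real.sqrt_le_sqrt ((le_abs_self _).trans h1)
  c_nonneg := Eventually.of_forall fun x => Real.sqrt_nonneg _
  c_support := by
    obtain ⟨R, hR⟩ := d.c_support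
    refine ⟨R, hR.mono fun x hx h => ?_⟩
    rw [hx h, Real.sqrt_zero]
  N := d.N
  k := fun i => √(d.k i)
  k_pos := fun i => Real.sqrt_pos.2 (d.k_pos i)
  P := d.P
  orthonormal := d.orthonormal
  const_eigen := by
    obtain ⟨κ, hκ, h⟩ := d.const_eigen
    have h1 := d.k_sq_mul_integral h
    have hpos : 0 < κ := by
      have h2 : ∃ j, (∫ μ, (d.P j).eval μ ∂angleMeasure) ≠ 0 := by
        by_contra! h3
        have := h 0 (by simp)
        simp [h3] at this
        exact hκ this.symm
      obtain ⟨j, hj⟩ := h2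
      rw [← mul_right_cancel₀ hj (h1 j)]
      exact pow_pos (d.k_pos j) 2
    -- Only the indices of nonzero mean contribute, and for these kᵢ = √κ; hence the sum with
    -- weights kᵢ is the sum with weights kᵢ² divided by √κ.
    refine ⟨√κ, (Real.sqrt_pos.2 hpos).ne', fun μ hμ => ?_⟩
    have h2 : ∀ i, √(d.k i) ^ 2 * (∫ μ', (d.P i).eval μ' ∂angleMeasure) * (d.P i).eval μ =
        (√κ)⁻¹ * (d.k i ^ 2 * (∫ μ', (d.P i).eval μ' ∂angleMeasure) * (d.P i).eval μ) := by
      intro i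
      rw [Real.sq_sqrt (d.k_pos i).le]
      by_cases h0 : (∫ μ', (d.P i).eval μ' ∂angleMeasure) = 0
      · simp [h0]
      · have h3 := mul_right_cancel₀ h0 (h1 i)
        have h4 : √κ = d.k i := by rw [← h3, Real.sqrt_sq (d.k_pos i).le]
        have := (d.k_pos i).ne'
        rw [h4]
        field_simp
    rw [Finset.sum_congr rfl fun i _ => h2 i, ← Finset.mul_sum, h μ hμ]
    rw [inv_mul_eq_div, Real.div_sqrt]

theorem coeFn_root_V (f : PhaseSpace) : d.root.V f =ᵐ[phaseMeasure] fun q =>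
    (√(d.c q.1) : ℂ) * ∑ i, (d.k i : ℂ) *
      (angleAverage (d.P i) f q.1 * ((d.P i).eval q.2 : ℝ)) := by
  refine (d.root.coeFn_V f).trans (Eventually.of_forall fun q => ?_)
  change (√(d.c q.1) : ℂ) * ∑ i, ((√(d.k i) ^ 2 : ℝ) : ℂ) *
      (angleAverage (d.P i) f q.1 * ((d.P i).eval q.2 : ℝ)) = _
  simp only [Real.sq_sqrt (d.k_pos _).le]

theorem angleAverage_root_V (f : PhaseSpace) (i : Fin d.N) :
    angleAverage (d.P i) (d.root.V f) =ᵐ[volume] fun x =>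
      (√(d.c x) : ℂ) * d.k i * angleAverage (d.P i) f x := by
  filter_upwards [Measure.ae_ae_of_ae_prod (d.coeFn_root_V f)] with x hx
  have h1 : angleAverage (d.P i) (d.root.V f) x = ∫ μ, ∑ j, (√(d.c x) : ℂ) * d.k j *
      angleAverage (d.P j) f x * (((d.P j).eval μ * (d.P i).eval μ : ℝ) : ℂ) ∂angleMeasure := by
    refine integral_congr_ae ?_
    filter_upwards [hx] with μ hμ
    rw [hμ, Finset.mul_sum, Finset.sum_mul]
    refine Finset.sum_congr rfl fun j _ => ?_
    push_cast; ring
  rw [h1, integral_finsetSum]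
  · simp only [integral_const_mul]
    rw [Finset.sum_eq_single i]
    · rw [integral_complex_ofReal, d.orthonormal, if_pos rfl, Complex.ofReal_one, mul_one]
    · intro j _ hj
      rw [integral_complex_ofReal, d.orthonormal, if_neg hj, Complex.ofReal_zero, mul_zero]
    · simp
  · intro j _
    refine Integrable.const_mul (Integrable.ofReal (integrable_angleMeasure_of_continuous ?_)) _
    exact (d.P j).continuous.mul (d.P i).continuous

/-- Orthonormality of the 𝒫ᵢ makes the angular part diagonal. By uniqueness of positive square roots
√V acquires the explicit formula of `coeFn_root_V`. -/
theorem root_V_mul_self : d.root.V * d.root.V = d.V := by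
  ext1 f
  refine Lp.ext ?_
  have h1 : ∀ᵐ x : ℝ, ∀ i, angleAverage (d.P i) (d.root.V f) x =
      (√(d.c x) : ℂ) * d.k i * angleAverage (d.P i) f x := by
    rw [ae_all_iff]; exact fun i => d.angleAverage_root_V f i
  filter_upwards [d.coeFn_root_V (d.root.V f), d.coeFn_V f,
    Measure.quasiMeasurePreserving_fst.ae h1,
    Measure.quasiMeasurePreserving_fst.ae d.c_nonneg] with q e1 e2 e3 e4
  rw [mul_apply_eq_comp, e1, e2, Finset.mul_sum, Finset.mul_sum]
  refine Finset.sum_congr rfl fun i _ => ?_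
  rw [e3 i]
  have h2 : (d.c q.1 : ℂ) = (√(d.c q.1) : ℂ) * (√(d.c q.1) : ℂ) := by
    rw [← Complex.ofReal_mul, Real.mul_self_sqrt e4]
  rw [h2]; push_cast; ring

theorem coe_sqrtTo_V (f : PhaseSpace) : (sqrtTo d.V f : PhaseSpace) = d.root.V f :=
  coe_sqrtTo_apply d.root_V_mul_self d.root.V_nonneg f

theorem sqrtFrom_V (e : d.E) : sqrtFrom d.V e = d.root.V e :=
  sqrtFrom_apply d.root_V_mul_self d.root.V_nonneg e

theorem memLp_sqrt_mul_pow (l : ℕ) : MemLp (fun x => √(d.c x) * x ^ l) 2 volume := by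
  obtain ⟨R, hR⟩ := d.c_support
  obtain ⟨h, h'⟩ : MemLp (fun x => √(d.c x)) ∞ volume := d.root.memLp_c
  obtain ⟨C, hC⟩ := (isCompact_Icc (a := -R) (b := R)).exists_bound_of_continuousOn
    (f := fun x : ℝ => x ^ l) (by fun_prop)
  set A := (eLpNorm (fun x => √(d.c x)) ∞ volume).toReal with hA
  have h1 : ∀ᵐ x : ℝ, ‖√(d.c x)‖ ≤ A := by
    filter_upwards [ae_le_eLpNormEssSup (f := fun x => √(d.c x)) (μ := volume)] with x hx
    have := ENNReal.toReal_mono h'.ne (by simpa [eLpNorm_exponent_top] using hx)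
    rwa [toReal_enorm] at this
  refine (memLp_indicator_const 2 (measurableSet_Icc (a := -R) (b := R)) (A * C)
    (Or.inr (by simp))).mono' ?_ ?_
  · exact AEStronglyMeasurable.mul h (by fun_prop)
  · filter_upwards [h1, hR] with x hx hx'
    by_cases hm : x ∈ Icc (-R) R
    · rw [indicator_of_mem hm, norm_mul]
      have := hC x hm
      gcongr
    · rw [hx' (by rw [mem_Icc, ← abs_le] at hm; exact not_le.1 hm), indicator_of_notMem hm]
      simp

/-- The vector `√c(x) x^l 𝒫ᵢ(μ)`. -/
def moment (i : Fin d.N) (l : ℕ) : PhaseSpace := tensor (d.memLp_sqrt_mul_pow l) (d.P i)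

theorem coeFn_moment (i : Fin d.N) (l : ℕ) : d.moment i l =ᵐ[phaseMeasure]
    fun q : ℝ × ℝ => (√(d.c q.1) : ℂ) * (q.1 : ℂ) ^ l * ((d.P i).eval q.2 : ℝ) := by
  refine (coeFn_tensor _ _).trans (Eventually.of_forall fun q => ?_)
  push_cast; rfl

theorem inner_moment (i : Fin d.N) (l : ℕ) (f : PhaseSpace) :
    Integrable (fun t : ℝ => (√(d.c t) : ℂ) * (t : ℂ) ^ l * angleAverage (d.P i) f t) ∧
      ⟪d.moment i l, f⟫_ℂ = ∫ t : ℝ, (√(d.c t) : ℂ) * (t : ℂ) ^ l * angleAverage (d.P i) f t := by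
  have := inner_tensor (d.memLp_sqrt_mul_pow l) (d.P i) f
  simp only [Complex.ofReal_mul, Complex.ofReal_pow] at this
  exact this

/-- The coefficient of `t^{-m-1}` in `√V U(t) √V` for large `t`. -/
def tailCoeff (m : ℕ) : PhaseSpace →L[ℂ] PhaseSpace :=
  ∑ i, ∑ j, ∑ l ∈ Finset.range (m + 1),
    ((d.k i * d.k j * (d.P j * d.P i).coeff m * (-1) ^ (m - l) * m.choose l : ℝ) : ℂ) •
      InnerProductSpace.rankOne ℂ (d.moment i (m - l)) (d.moment j l)

theorem ellFun_toLp_eq : d.memLp_ellFun.toLp d.ellFun =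
    ∑ i, ((d.k i * (d.P i).eval 0 : ℝ) : ℂ) • d.moment i 0 := by
  refine Lp.ext (d.memLp_ellFun.coeFn_toLp.trans ?_)
  refine EventuallyEq.symm ((Lp.coeFn_finsetSum _ _).trans ?_)
  have h3 : ∀ᵐ q ∂phaseMeasure, ∀ i,
      (((d.k i * (d.P i).eval 0 : ℝ) : ℂ) • d.moment i 0 : PhaseSpace) q =
      ((d.k i * (d.P i).eval 0 : ℝ) : ℂ) * ((√(d.c q.1) : ℂ) * ((d.P i).eval q.2 : ℝ)) := by
    rw [ae_all_iff]
    intro i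
    filter_upwards [d.coeFn_moment i 0,
      Lp.coeFn_smul ((d.k i * (d.P i).eval 0 : ℝ) : ℂ) (d.moment i 0)] with q h h'
    rw [h', Pi.smul_apply, h, smul_eq_mul, pow_zero, mul_one]
  filter_upwards [h3] with q hq
  rw [Finset.sum_apply, Finset.sum_congr rfl fun i _ => hq i, ellFun]
  push_cast
  rw [Finset.mul_sum]
  refine Finset.sum_congr rfl fun i _ => ?_
  ring

/-- The constant coefficient of 𝒫ⱼ𝒫ᵢ is 𝒫ⱼ(0)𝒫ᵢ(0), so the double sum factorises into a single rank
one operator. -/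
theorem tailCoeff_zero : d.tailCoeff 0 =
    InnerProductSpace.rankOne ℂ (d.memLp_ellFun.toLp d.ellFun) (d.memLp_ellFun.toLp d.ellFun) := by
  ext1 f
  rw [InnerProductSpace.rankOne_apply, ellFun_toLp_eq, sum_inner, Finset.sum_smul]
  simp only [tailCoeff, _root_.sum_apply, _root_.smul_apply, InnerProductSpace.rankOne_apply]
  rw [Finset.sum_comm]
  refine Finset.sum_congr rfl fun j _ => ?_
  rw [Finset.smul_sum]
  refine Finset.sum_congr rfl fun i _ => ?_
  simp only [zero_add, Finset.sum_range_one, inner_smul_left, Complex.conj_ofReal, smul_smul,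
    Polynomial.coeff_zero_eq_eval_zero, Polynomial.eval_mul]
  congr 1
  push_cast
  simp
  ring

end Medium

/-! ### Large times: a finite rank polynomial in 1/τ -/

namespace Medium
variable (d : Medium)

theorem ae_ae_shift_root_V (τ : ℝ) (f : PhaseSpace) :
    ∀ᵐ x : ℝ, ∀ᵐ μ ∂angleMeasure, shift τ (d.root.V f) (x, μ) =
      (√(d.c (x + τ * μ)) : ℂ) * ∑ j, (d.k j : ℂ) *
        (angleAverage (d.P j) f (x + τ * μ) * ((d.P j).eval μ : ℝ)) := by
  refine Measure.ae_ae_of_ae_prod (p := fun q : ℝ × ℝ => shift τ (d.root.V f) q =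
    (√(d.c (q.1 + τ * q.2)) : ℂ) * ∑ j, (d.k j : ℂ) *
        (angleAverage (d.P j) f (q.1 + τ * q.2) * ((d.P j).eval q.2 : ℝ))) ?_
  filter_upwards [coeFn_shift τ (d.root.V f),
    (measurePreserving_shear τ).quasiMeasurePreserving.ae (d.coeFn_root_V f)] with q h1 h2
  rw [h1, h2]
  rfl

/-- The angular average of a shifted vector, in the variable `t = x + τ μ`. -/
theorem angleAverage_shift_root_V {R τ : ℝ} (hR : ∀ᵐ x, R < |x| → d.c x = 0) (hτ : 2 * R < τ)
    (hτ0 : 0 < τ) (f : PhaseSpace) (i : Fin d.N) :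
    ∀ᵐ x : ℝ, |x| ≤ R → angleAverage (d.P i) (shift τ (d.root.V f)) x =
      (τ : ℂ)⁻¹ * ∫ t : ℝ, (√(d.c t) : ℂ) * ∑ j, (d.k j : ℂ) * angleAverage (d.P j) f t *
        (((d.P j * d.P i).eval ((t - x) / τ) : ℝ) : ℂ) := by
  filter_upwards [d.ae_ae_shift_root_V τ f] with x hx hxR
  set Φ : ℝ → ℂ := fun t => (√(d.c t) : ℂ) * ∑ j, (d.k j : ℂ) * angleAverage (d.P j) f t *
        (((d.P j * d.P i).eval ((t - x) / τ) : ℝ) : ℂ) with hΦ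
  have h1 : angleAverage (d.P i) (shift τ (d.root.V f)) x =
      ∫ μ in (-1 : ℝ)..1, Φ (x + τ * μ) := by
    rw [intervalIntegral.integral_of_le (by norm_num), ← integral_Icc_eq_integral_Ioc]
    refine integral_congr_ae ?_
    filter_upwards [hx] with μ hμ
    rw [hμ]
    simp only [hΦ, add_sub_cancel_left, mul_div_cancel_left₀ _ hτ0.ne', Polynomial.eval_mul]
    rw [mul_assoc, Finset.sum_mul]
    congr 1
    refine Finset.sum_congr rfl fun j _ => ?_
    push_cast; ring
  rw [h1, intervalIntegral.integral_comp_add_mul _ hτ0.ne', Complex.real_smul, Complex.ofReal_inv,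
    intervalIntegral.integral_of_le (by nlinarith)]
  congr 1
  -- For |x| ≤ R and τ > 2R the range (x - τ, x + τ] of t = x + τμ contains [-R, R], outside of
  -- which `c` vanishes.
  refine setIntegral_eq_integral_of_ae_compl_eq_zero ?_
  filter_upwards [hR] with t ht ht'
  have : R < |t| := by
    by_contra! hle
    rw [abs_le] at hle hxR
    exact ht' ⟨by nlinarith, by nlinarith⟩
  simp only [hΦ, ht this, Real.sqrt_zero, Complex.ofReal_zero, zero_mul]

/-- The binomial expansion of ((t - x)/τ)^m separates `x` from `t`, and the integrals over `t`
become pairings with the moments. -/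
theorem integral_polynomial_kernel {M : ℕ} (hM : ∀ i j, (d.P j * d.P i).natDegree < M)
    (f : PhaseSpace) (i : Fin d.N) (x τ : ℝ) :
    ∫ t : ℝ, (√(d.c t) : ℂ) * ∑ j, (d.k j : ℂ) * angleAverage (d.P j) f t *
        (((d.P j * d.P i).eval ((t - x) / τ) : ℝ) : ℂ) =
    ∑ m ∈ Finset.range M, ((τ : ℂ) ^ m)⁻¹ * ∑ j, ∑ l ∈ Finset.range (m + 1),
      (d.k j * (d.P j * d.P i).coeff m * (-1) ^ (m - l) * m.choose l : ℝ) * (x : ℂ) ^ (m - l) *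
        ⟪d.moment j l, f⟫_ℂ := by
  have e : ∀ t : ℝ, (√(d.c t) : ℂ) * ∑ j, (d.k j : ℂ) * angleAverage (d.P j) f t *
        (((d.P j * d.P i).eval ((t - x) / τ) : ℝ) : ℂ) =
      ∑ m ∈ Finset.range M, ∑ j, ∑ l ∈ Finset.range (m + 1), ((τ : ℂ) ^ m)⁻¹ *
        ((d.k j * (d.P j * d.P i).coeff m * (-1) ^ (m - l) * m.choose l : ℝ) *
          (x : ℂ) ^ (m - l)) * ((√(d.c t) : ℂ) * (t : ℂ) ^ l * angleAverage (d.P j) f t) := by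
    intro t
    rw [Finset.sum_comm, Finset.mul_sum]
    refine Finset.sum_congr rfl fun j _ => ?_
    rw [Polynomial.eval_eq_sum_range' (hM i j), Complex.ofReal_sum, Finset.mul_sum, Finset.mul_sum]
    refine Finset.sum_congr rfl fun m _ => ?_
    rw [div_pow, sub_eq_add_neg, add_pow]
    push_cast
    rw [Finset.sum_div, Finset.mul_sum, Finset.mul_sum, Finset.mul_sum]
    refine Finset.sum_congr rfl fun l _ => ?_
    rw [neg_pow (x : ℂ)]
    ring
  have hi : ∀ j l, Integrable
      (fun t : ℝ => (√(d.c t) : ℂ) * (t : ℂ) ^ l * angleAverage (d.P j) f t) := fun j l =>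
    (d.inner_moment j l f).1
  simp only [e]
  rw [integral_finsetSum]
  swap
  · exact fun m _ => integrable_finsetSum _ fun j _ => integrable_finsetSum _ fun l _ =>
      (hi j l).const_mul _
  refine Finset.sum_congr rfl fun m _ => ?_
  rw [integral_finsetSum, Finset.mul_sum]
  swap
  · exact fun j _ => integrable_finsetSum _ fun l _ => (hi j l).const_mul _
  refine Finset.sum_congr rfl fun j _ => ?_
  rw [integral_finsetSum, Finset.mul_sum]
  swap
  · exact fun l _ => (hi j l).const_mul _
  refine Finset.sum_congr rfl fun l _ => ?_
  rw [integral_const_mul, (d.inner_moment j l f).2]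
  ring

theorem exists_degree_bound : ∃ M : ℕ, 0 < M ∧ ∀ i j, (d.P j * d.P i).natDegree < M := by
  refine ⟨(∑ i, ∑ j, (d.P j * d.P i).natDegree) + 1, Nat.succ_pos _, fun i j => Nat.lt_succ_of_le ?_⟩
  exact (Finset.single_le_sum (f := fun j => (d.P j * d.P i).natDegree)
    (fun _ _ => Nat.zero_le _) (Finset.mem_univ j)).trans
    (Finset.single_le_sum (f := fun i => ∑ j, (d.P j * d.P i).natDegree)
      (fun _ _ => Nat.zero_le _) (Finset.mem_univ i))

theorem coeFn_tailCoeff (m : ℕ) (f : PhaseSpace) : d.tailCoeff m f =ᵐ[phaseMeasure] fun q =>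
    ∑ i, ∑ j, ∑ l ∈ Finset.range (m + 1),
      ((d.k i * d.k j * (d.P j * d.P i).coeff m * (-1) ^ (m - l) * m.choose l : ℝ) : ℂ) *
        (⟪d.moment j l, f⟫_ℂ *
          ((√(d.c q.1) : ℂ) * (q.1 : ℂ) ^ (m - l) * ((d.P i).eval q.2 : ℝ))) := by
  have e : d.tailCoeff m f = ∑ i, ∑ j, ∑ l ∈ Finset.range (m + 1),
      (((d.k i * d.k j * (d.P j * d.P i).coeff m * (-1) ^ (m - l) * m.choose l : ℝ) : ℂ) *
        ⟪d.moment j l, f⟫_ℂ) • d.moment i (m - l) := by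
    simp only [tailCoeff, _root_.sum_apply, _root_.smul_apply, InnerProductSpace.rankOne_apply,
      smul_smul]
  rw [e]
  have h : ∀ᵐ q ∂phaseMeasure, ∀ i, ∀ j, ∀ l,
      (((((d.k i * d.k j * (d.P j * d.P i).coeff m * (-1) ^ (m - l) * m.choose l : ℝ) : ℂ) *
        ⟪d.moment j l, f⟫_ℂ) • d.moment i (m - l) : PhaseSpace) : ℝ × ℝ → ℂ) q =
      ((d.k i * d.k j * (d.P j * d.P i).coeff m * (-1) ^ (m - l) * m.choose l : ℝ) : ℂ) *
        (⟪d.moment j l, f⟫_ℂ *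
          ((√(d.c q.1) : ℂ) * (q.1 : ℂ) ^ (m - l) * ((d.P i).eval q.2 : ℝ))) := by
    simp only [ae_all_iff]
    intro i j l
    refine (Lp.coeFn_smul _ _).trans ?_
    filter_upwards [d.coeFn_moment i (m - l)] with q hq
    rw [Pi.smul_apply, hq, smul_eq_mul, mul_assoc]
  refine (Lp.coeFn_finsetSum _ _).trans ?_
  have h1 : ∀ᵐ q ∂phaseMeasure, ∀ i, _ := ae_all_iff.2 fun i => Lp.coeFn_finsetSum Finset.univ
    (fun j => ∑ l ∈ Finset.range (m + 1),
      (((d.k i * d.k j * (d.P j * d.P i).coeff m * (-1) ^ (m - l) * m.choose l : ℝ) : ℂ) *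
        ⟪d.moment j l, f⟫_ℂ) • d.moment i (m - l))
  have h2 : ∀ᵐ q ∂phaseMeasure, ∀ i, ∀ j, _ := ae_all_iff.2 fun i => ae_all_iff.2 fun j =>
    Lp.coeFn_finsetSum (Finset.range (m + 1)) (fun l =>
      (((d.k i * d.k j * (d.P j * d.P i).coeff m * (-1) ^ (m - l) * m.choose l : ℝ) : ℂ) *
        ⟪d.moment j l, f⟫_ℂ) • d.moment i (m - l))
  filter_upwards [h, h1, h2] with q h h1 h2
  rw [Finset.sum_apply]
  refine Finset.sum_congr rfl fun i _ => ?_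
  rw [h1 i, Finset.sum_apply]
  refine Finset.sum_congr rfl fun j _ => ?_
  rw [h2 i j, Finset.sum_apply]
  exact Finset.sum_congr rfl fun l _ => h i j l

/-- For large times `√V U(τ) √V` is a finite rank operator, polynomial in `1 / τ`. -/
theorem root_V_shift_root_V {R τ : ℝ} (hR : ∀ᵐ x, R < |x| → d.c x = 0) (hτ : 2 * R < τ)
    (hτ0 : 0 < τ) {M : ℕ} (hM : ∀ i j, (d.P j * d.P i).natDegree < M) (f : PhaseSpace) :
    d.root.V (shift τ (d.root.V f)) =
      ∑ m ∈ Finset.range M, ((τ : ℂ) ^ (m + 1))⁻¹ • d.tailCoeff m f := by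
  refine Lp.ext ?_
  have h1 : ∀ᵐ x : ℝ, ∀ i, |x| ≤ R → angleAverage (d.P i) (shift τ (d.root.V f)) x = _ :=
    ae_all_iff.2 fun i => d.angleAverage_shift_root_V hR hτ hτ0 f i
  have h2 : ∀ᵐ q ∂phaseMeasure, ∀ m, (((τ : ℂ) ^ (m + 1))⁻¹ • d.tailCoeff m f : PhaseSpace) q =
      ((τ : ℂ) ^ (m + 1))⁻¹ * ∑ i, ∑ j, ∑ l ∈ Finset.range (m + 1),
      ((d.k i * d.k j * (d.P j * d.P i).coeff m * (-1) ^ (m - l) * m.choose l : ℝ) : ℂ) *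
        (⟪d.moment j l, f⟫_ℂ *
          ((√(d.c q.1) : ℂ) * (q.1 : ℂ) ^ (m - l) * ((d.P i).eval q.2 : ℝ))) := by
    rw [ae_all_iff]
    intro m
    refine (Lp.coeFn_smul _ _).trans ?_
    filter_upwards [d.coeFn_tailCoeff m f] with q hq
    rw [Pi.smul_apply, hq, smul_eq_mul]
  filter_upwards [d.coeFn_root_V (shift τ (d.root.V f)),
    Measure.quasiMeasurePreserving_fst.ae h1, Measure.quasiMeasurePreserving_fst.ae hR, h2,
    Lp.coeFn_finsetSum (Finset.range M) fun m => ((τ : ℂ) ^ (m + 1))⁻¹ • d.tailCoeff m f]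
    with q e1 e2 e3 e4 e5
  rw [e1, e5, Finset.sum_apply, Finset.sum_congr rfl fun m _ => e4 m]
  -- The kernel formula is available for |x| ≤ R only; elsewhere the factor √c(x) makes both sides
  -- vanish.
  by_cases hx : |q.1| ≤ R
  · have e6 : ∀ i, angleAverage (d.P i) (shift τ (d.root.V f)) q.1 = _ := fun i =>
      (e2 i hx).trans (congrArg _ (d.integral_polynomial_kernel hM f i q.1 τ))
    simp only [e6, Finset.mul_sum, Finset.sum_mul]
    rw [Finset.sum_comm]
    refine Finset.sum_congr rfl fun m _ => Finset.sum_congr rfl fun i _ =>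
      Finset.sum_congr rfl fun j _ => Finset.sum_congr rfl fun l _ => ?_
    have : (τ : ℂ) ≠ 0 := Complex.ofReal_ne_zero.2 hτ0.ne'
    push_cast
    field_simp
    ring
  · rw [e3 (not_le.1 hx)]
    simp

end Medium

/-! ### Bounded times: an entire operator function -/

/-- Lebesgue measure on the subtype `[0, a]`. -/
abbrev timeMeasure (a : ℝ) : Measure (Icc (0 : ℝ) a) := Measure.comap Subtype.val volume

instance (a : ℝ) : IsFiniteMeasure (timeMeasure a) := by
  refine ⟨?_⟩
  rw [comap_subtype_coe_apply measurableSet_Icc, image_univ, Subtype.range_coe]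
  exact measure_Icc_lt_top

theorem norm_smul_shift_le {a : ℝ} (φ : C(Icc (0 : ℝ) a, ℂ)) (f : PhaseSpace)
    (t : Icc (0 : ℝ) a) : ‖φ t • shift t f‖ ≤ ‖φ‖ * ‖f‖ := by
  rw [norm_smul, norm_shift]
  gcongr
  exact φ.norm_coe_le_norm t

theorem integrable_smul_shift {a : ℝ} (φ : C(Icc (0 : ℝ) a, ℂ)) (f : PhaseSpace) :
    Integrable (fun t : Icc (0 : ℝ) a => φ t • shift t f) (timeMeasure a) :=
  Integrable.of_bound (C := ‖φ‖ * ‖f‖)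
    (φ.continuous.smul ((continuous_shift f).comp continuous_subtype_val)).aestronglyMeasurable
    (Eventually.of_forall fun t => norm_smul_shift_le φ f t)

/-- The operator-valued integral `φ ↦ ∫_0^a φ(t) U(t) dt`. -/
def shiftIntegral (a : ℝ) : C(Icc (0 : ℝ) a, ℂ) →L[ℂ] PhaseSpace →L[ℂ] PhaseSpace :=
  LinearMap.mkContinuous₂
    (LinearMap.mk₂ ℂ
      (fun (φ : C(Icc (0 : ℝ) a, ℂ)) (f : PhaseSpace) => ∫ t, φ t • shift t f ∂timeMeasure a)
      (fun φ ψ f => by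
        rw [← integral_add (integrable_smul_shift φ f) (integrable_smul_shift ψ f)]
        simp [add_smul])
      (fun c φ f => by
        rw [← integral_smul]
        simp [smul_smul])
      (fun φ f g => by
        rw [← integral_add (integrable_smul_shift φ f) (integrable_smul_shift φ g)]
        simp)
      (fun c φ f => by
        rw [← integral_smul]
        simp only [map_smul]
        congr 1; ext1 t
        rw [smul_comm]))
    ((timeMeasure a).real univ)
    (fun φ f => by
      refine (norm_integral_le_of_norm_le_const
        (Eventually.of_forall fun t => norm_smul_shift_le φ f t)).trans_eq ?_
      ring)

/-- The function `t ↦ it` on `[0, a]`. -/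
def timeFunction (a : ℝ) : C(Icc (0 : ℝ) a, ℂ) where
  toFun t := Complex.I * (t : ℝ)
  continuous_toFun := by fun_prop

theorem exp_smul_timeFunction_apply (a : ℝ) (z : ℂ) (t : Icc (0 : ℝ) a) :
    NormedSpace.exp (z • timeFunction a) t = Complex.exp (Complex.I * z * (t : ℝ)) := by
  let _ : NormedAlgebra ℚ C(Icc (0 : ℝ) a, ℂ) := NormedAlgebra.restrictScalars ℚ ℂ _
  have h := NormedSpace.map_exp (ContinuousMap.evalAlgHom (X := Icc (0 : ℝ) a) ℂ ℂ t)
    (continuous_eval_const t) (z • timeFunction a)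
  refine Eq.trans h ?_
  rw [← Complex.exp_eq_exp_ℂ]
  congr 1
  change z * (Complex.I * (t : ℝ)) = _
  ring

theorem shiftIntegral_exp_apply (a : ℝ) (z : ℂ) (f : PhaseSpace) :
    shiftIntegral a (NormedSpace.exp (z • timeFunction a)) f =
      ∫ t in Icc (0 : ℝ) a, Complex.exp (Complex.I * z * t) • shift t f := by
  rw [← integral_subtype_comap measurableSet_Icc]
  refine integral_congr_ae (Eventually.of_forall fun t => ?_)
  simp only [exp_smul_timeFunction_apply]

/-- The group is treated only as strongly continuous, so the integral is organised as a bounded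
linear map of its weight in C([0, a]). The weight e^{izt} is an exponential in that Banach algebra,
which gives differentiability in the operator norm. -/
theorem differentiable_shiftIntegral_exp (a : ℝ) :
    Differentiable ℂ fun z : ℂ => shiftIntegral a (NormedSpace.exp (z • timeFunction a)) :=
  fun z => (shiftIntegral a).differentiableAt.comp z
    (hasDerivAt_exp_smul_const (timeFunction a) z).differentiableAt

theorem shiftLaplace_eq_add {a : ℝ} (ha : 0 ≤ a) {z : ℂ} (hz : 0 < z.im) (f : PhaseSpace) :
    shiftLaplace z hz f = shiftIntegral a (NormedSpace.exp (z • timeFunction a)) f +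
      ∫ t in Ioi a, Complex.exp (Complex.I * z * t) • shift t f := by
  have hi := integrableOn_cexp_smul_shift hz f 0
  rw [shiftIntegral_exp_apply, integral_Icc_eq_integral_Ioc, shiftLaplace_apply,
    ← Ioc_union_Ioi_eq_Ioi ha, setIntegral_union (Ioc_disjoint_Ioi le_rfl) measurableSet_Ioi
    (hi.mono_set Ioc_subset_Ioi_self) (hi.mono_set (Ioi_subset_Ioi ha))]

/-! ### The expansion of Q -/

namespace Medium
variable (d : Medium)

/-- Compression of an operator to `E`. -/
def compress (X : PhaseSpace →L[ℂ] PhaseSpace) : d.E →L[ℂ] d.E :=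
  d.E.orthogonalProjectionOnto ∘L X ∘L d.E.subtypeL

theorem compress_tailCoeff_zero :
    d.compress (d.tailCoeff 0) = InnerProductSpace.rankOne ℂ d.ell d.ell := by
  ext1 e
  have h : d.memLp_ellFun.toLp d.ellFun = (d.ell : PhaseSpace) := rfl
  rw [compress, tailCoeff_zero, h]
  simp only [ContinuousLinearMap.comp_apply, InnerProductSpace.rankOne_apply, map_smul,
    Submodule.orthogonalProjectionOnto_mem_subspace_eq_self, Submodule.subtypeL_apply,
    Submodule.coe_inner]

theorem Q_apply {z : ℂ} (hz : 0 < z.im) (e : d.E) :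
    d.Q z e = -sqrtTo d.V (shiftLaplace z hz (sqrtFrom d.V e)) := by
  change Complex.I • sqrtTo d.V (resolventOp streamingOp z (sqrtFrom d.V e)) = _
  rw [resolventOp_streamingOp hz, _root_.smul_apply, map_smul, smul_smul, Complex.I_mul_I,
    neg_smul, one_smul]

theorem root_V_tail {R a : ℝ} (hR : ∀ᵐ x, R < |x| → d.c x = 0) (ha : 2 * R ≤ a) (ha0 : 0 < a)
    {M : ℕ} (hM : ∀ i j, (d.P j * d.P i).natDegree < M) {z : ℂ} (hz : 0 < z.im) (f : PhaseSpace) :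
    d.root.V (∫ t in Ioi a, Complex.exp (Complex.I * z * t) • shift t (d.root.V f)) =
      ∑ m ∈ Finset.range M, expTail a m z • d.tailCoeff m f := by
  rw [← ContinuousLinearMap.integral_comp_comm _ (integrableOn_cexp_smul_shift hz _ a)]
  have h1 : ∀ t ∈ Ioi a, d.root.V (Complex.exp (Complex.I * z * t) • shift t (d.root.V f)) =
      ∑ m ∈ Finset.range M,
        (Complex.exp (Complex.I * z * t) * ((t : ℂ) ^ (m + 1))⁻¹) • d.tailCoeff m f := by
    intro t ht
    rw [map_smul, d.root_V_shift_root_V hR (ha.trans_lt ht) (ha0.trans ht) hM, Finset.smul_sum]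
    simp only [smul_smul]
  rw [setIntegral_congr_fun measurableSet_Ioi h1, integral_finsetSum]
  · simp only [integral_smul_const]
    rfl
  · exact fun m _ => (integrableOn_cexp_mul_inv_pow ha0 (m + 1) hz).smul_const _

/-- The bordered resolvent is an entire function up to finitely many logarithmic terms. -/
theorem exists_Q_expansion : ∃ (M : ℕ) (A : ℕ → d.E →L[ℂ] d.E) (F : ℂ → d.E →L[ℂ] d.E),
    Differentiable ℂ F ∧ A 0 = InnerProductSpace.rankOne ℂ d.ell d.ell ∧
    ∀ z : ℂ, 0 < z.im → d.Q z =
      ∑ m ∈ Finset.range (M + 1), (z ^ m * Complex.log (-Complex.I * z)) • A m + F z := by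
  obtain ⟨R, hR⟩ := d.c_support
  obtain ⟨M', hM0, hM⟩ := d.exists_degree_bound
  obtain ⟨M, rfl⟩ := Nat.exists_eq_succ_of_ne_zero hM0.ne'
  -- The splitting time must be positive, also when R is not, and at least 2R.
  set a : ℝ := 2 * |R| + 1 with ha
  have ha0 : 0 < a := by positivity
  have haR : 2 * R ≤ a := by linarith [le_abs_self R]
  choose h hd he using fun m => exists_expTail_eq ha0 m
  refine ⟨M, fun m => (Complex.I ^ m / (m.factorial : ℂ)) • d.compress (d.tailCoeff m),
    fun z => -(sqrtTo d.V ∘L shiftIntegral a (NormedSpace.exp (z • timeFunction a)) ∘L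
      sqrtFrom d.V) - ∑ m ∈ Finset.range (M + 1), h m z • d.compress (d.tailCoeff m), ?_, ?_, ?_⟩
  · have h1 : Differentiable ℂ fun _ : ℂ => sqrtTo d.V := differentiable_const _
    have h2 : Differentiable ℂ fun _ : ℂ => sqrtFrom d.V := differentiable_const _
    have h3 := (h1.clm_comp ((differentiable_shiftIntegral_exp a).clm_comp h2)).fun_neg
    exact h3.fun_sub (Differentiable.fun_sum fun m _ => (hd m).smul_const _)
  · simp [compress_tailCoeff_zero]
  · intro z hz
    ext1 e
    have h1 : ((d.Q z e : d.E) : PhaseSpace) =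
        -((sqrtTo d.V (shiftIntegral a (NormedSpace.exp (z • timeFunction a))
          (sqrtFrom d.V e)) : d.E) : PhaseSpace) -
        ∑ m ∈ Finset.range (M + 1), expTail a m z • d.tailCoeff m e := by
      rw [d.Q_apply hz, Submodule.coe_neg, shiftLaplace_eq_add ha0.le hz, map_add,
        Submodule.coe_add, neg_add, sub_eq_add_neg, d.coe_sqrtTo_V (∫ t in Ioi a, _), sqrtFrom_V,
        d.root_V_tail hR haR ha0 hM hz]
    -- The tail coefficients are operators in the whole space. Projecting the identity onto `E`
    -- fixes the terms already lying there and turns the others into compressions.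
    have h2 := congrArg d.E.orthogonalProjectionOnto h1
    rw [Submodule.orthogonalProjectionOnto_mem_subspace_eq_self, map_sub, map_neg,
      Submodule.orthogonalProjectionOnto_mem_subspace_eq_self, map_sum] at h2
    simp only [map_smul] at h2
    rw [h2]
    simp only [_root_.add_apply, _root_.sub_apply, _root_.neg_apply, _root_.sum_apply,
      _root_.smul_apply, he _ z hz, ContinuousLinearMap.comp_apply, sub_smul,
      Finset.sum_sub_distrib, compress, Submodule.subtypeL_apply, smul_smul]
    have h3 : ∀ m : ℕ, z ^ m * Complex.log (-Complex.I * z) * (Complex.I ^ m / (m.factorial : ℂ)) =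
        (Complex.I * z) ^ m / (m.factorial : ℂ) * Complex.log (-Complex.I * z) := by
      intro m
      rw [mul_pow]; ring
    simp only [h3]
    abel

end Medium

/-! ### The cut plane and logarithmic bounds -/

theorem mem_cutPlane_iff {z : ℂ} : z ∈ cutPlane ↔ -Complex.I * z ∈ Complex.slitPlane := by
  rw [Complex.mem_slitPlane_iff]
  change (z ≠ 0 ∧ z.arg ≠ -(Real.pi / 2)) ↔ _
  rw [Ne, Ne, Complex.arg_eq_neg_pi_div_two_iff]
  simp only [Complex.ext_iff, Complex.zero_re, Complex.zero_im, neg_mul, Complex.neg_re,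
    Complex.neg_im, Complex.I_mul_re, Complex.I_mul_im, neg_neg]
  constructor
  · rintro ⟨h1, h2⟩
    by_contra! h
    have h3 : z.re = 0 := by simpa using h.2
    rcases h.1.lt_or_eq with h4 | h4
    · exact h2 ⟨h3, h4⟩
    · exact h1 ⟨h3, h4⟩
  · rintro (h | h)
    · exact ⟨fun h' => h.ne' h'.2, fun h' => h.not_gt h'.2⟩
    · exact ⟨fun h' => h (by simp [h'.1]), fun h' => h (by simp [h'.1])⟩

theorem isOpen_cutPlane : IsOpen cutPlane := by
  have h : cutPlane = (fun z => -Complex.I * z) ⁻¹' Complex.slitPlane := by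
    ext z; exact mem_cutPlane_iff
  rw [h]
  exact Complex.isOpen_slitPlane.preimage (by fun_prop)

theorem mem_cutPlane_of_im_nonneg {z : ℂ} (hz : 0 ≤ z.im) (h0 : z ≠ 0) : z ∈ cutPlane := by
  refine ⟨h0, fun h => ?_⟩
  rw [Complex.arg_eq_neg_pi_div_two_iff] at h
  exact h.2.not_ge hz

theorem zero_mem_closure_upperHalf : (0 : ℂ) ∈ closure {z : ℂ | 0 < z.im} := by
  rw [Complex.closure_setOfPred_lt_im]
  exact le_refl (0 : ℝ)

theorem upperHalf_subset_cutPlane : {z : ℂ | 0 < z.im} ⊆ cutPlane := fun z hz =>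
  mem_cutPlane_of_im_nonneg (le_of_lt hz) fun h => by
    rw [h] at hz
    exact lt_irrefl (0 : ℝ) hz

theorem nhdsWithin_upperHalf_neBot : NeBot (𝓝[{z : ℂ | 0 < z.im}] 0) :=
  mem_closure_iff_nhdsWithin_neBot.1 zero_mem_closure_upperHalf

theorem nhdsWithin_cutPlane_neBot : NeBot (𝓝[cutPlane] (0 : ℂ)) :=
  nhdsWithin_upperHalf_neBot.mono (nhdsWithin_mono _ upperHalf_subset_cutPlane)

theorem norm_log_le (z : ℂ) : ‖Complex.log z‖ ≤ |Real.log ‖z‖| + Real.pi := by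
  refine (Complex.norm_le_abs_re_add_abs_im _).trans ?_
  rw [Complex.log_re, Complex.log_im]
  gcongr
  exact Complex.abs_arg_le_pi z

theorem tendsto_mul_log_zero : Tendsto (fun z : ℂ => z * Complex.log z) (𝓝 0) (𝓝 0) := by
  rw [tendsto_zero_iff_norm_tendsto_zero]
  have h1 : Tendsto (fun z : ℂ => |‖z‖ * Real.log ‖z‖| + ‖z‖ * Real.pi) (𝓝 0) (𝓝 0) := by
    have h : Continuous fun z : ℂ => |‖z‖ * Real.log ‖z‖| + ‖z‖ * Real.pi :=
      (Real.continuous_mul_log.comp continuous_norm).abs.add (by fun_prop)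
    simpa using h.tendsto 0
  refine squeeze_zero (fun _ => norm_nonneg _) (fun z => ?_) h1
  rw [norm_mul, abs_mul, abs_norm, ← mul_add]
  exact mul_le_mul_of_nonneg_left (norm_log_le z) (norm_nonneg z)

theorem log_two_le_norm_log {z : ℂ} (h0 : z ≠ 0) (hz : ‖z‖ ≤ 1 / 2) :
    Real.log 2 ≤ |Real.log ‖z‖| := by
  have h1 : Real.log ‖z‖ ≤ Real.log (1 / 2) := Real.log_le_log (norm_pos_iff.2 h0) hz
  rw [one_div, Real.log_inv] at h1
  exact le_trans (by linarith) (neg_le_abs _)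

theorem abs_log_norm_le (z : ℂ) : |Real.log ‖z‖| ≤ ‖Complex.log z‖ := by
  rw [← Complex.log_re]
  exact Complex.abs_re_le_norm _

/-- Passes from ln(-iz) to ln z. For |z| ≤ 1/2 one has |ln z| ≥ ln 2 > 1/2, so the contribution π <
4 of the argument is at most 8|ln z|. -/
theorem norm_log_neg_I_mul_le {z : ℂ} (h0 : z ≠ 0) (hz : ‖z‖ ≤ 1 / 2) :
    ‖Complex.log (-Complex.I * z)‖ ≤ 9 * ‖Complex.log z‖ ∧ 1 ≤ 2 * ‖Complex.log z‖ := by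
  have h1 := log_two_le_norm_log h0 hz
  have h2 := abs_log_norm_le z
  have h3 := norm_log_le (-Complex.I * z)
  rw [norm_mul, norm_neg, Complex.norm_I, one_mul] at h3
  have h4 := Real.log_two_gt_d9
  have h5 := Real.pi_lt_four
  constructor <;> linarith

/-! ### The remainder Θ -/

section Remainder
variable {W : Type*} [NormedAddCommGroup W] [NormedSpace ℂ W]

/-- The part of a function with logarithmic singularities which vanishes at the origin. -/
def logRemainder (M : ℕ) (A : ℕ → W) (F : ℂ → W) (z : ℂ) : W :=
  ∑ m ∈ Finset.range M, (z ^ (m + 1) * Complex.log (-Complex.I * z)) • A (m + 1) + (F z - F 0)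

theorem sum_log_smul_eq (M : ℕ) (A : ℕ → W) (F : ℂ → W) (z : ℂ) :
    ∑ m ∈ Finset.range (M + 1), (z ^ m * Complex.log (-Complex.I * z)) • A m + F z =
      Complex.log (-Complex.I * z) • A 0 + F 0 + logRemainder M A F z := by
  rw [Finset.sum_range_succ', logRemainder, pow_zero, one_mul]
  abel

theorem analyticOnNhd_logRemainder [CompleteSpace W] (M : ℕ) (A : ℕ → W) {F : ℂ → W}
    (hF : Differentiable ℂ F) : AnalyticOnNhd ℂ (logRemainder M A F) cutPlane := by
  refine DifferentiableOn.analyticOnNhd (fun z hz => DifferentiableAt.differentiableWithinAt ?_)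
    isOpen_cutPlane
  have h1 : DifferentiableAt ℂ (fun z => Complex.log (-Complex.I * z)) z :=
    DifferentiableAt.clog (by fun_prop) (mem_cutPlane_iff.1 hz)
  have h2 : DifferentiableAt ℂ (fun z => ∑ m ∈ Finset.range M,
      (z ^ (m + 1) * Complex.log (-Complex.I * z)) • A (m + 1)) z :=
    DifferentiableAt.fun_sum fun m _ => ((by fun_prop : DifferentiableAt ℂ
      (fun z : ℂ => z ^ (m + 1)) z).mul h1).smul_const _
  exact h2.fun_add ((hF z).sub_const _)

theorem exists_norm_sub_le_mul_norm [CompleteSpace W] {F : ℂ → W} (hF : Differentiable ℂ F) :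
    ∃ C : ℝ, ∀ z : ℂ, ‖z‖ ≤ 1 / 2 → ‖F z - F 0‖ ≤ C * ‖z‖ := by
  have h1 : DifferentiableOn ℂ (dslope F 0) univ :=
    (Complex.differentiableOn_dslope univ_mem).2 hF.differentiableOn
  obtain ⟨C, hC⟩ := (isCompact_closedBall (0 : ℂ) (1 / 2)).exists_bound_of_continuousOn
    (h1.continuousOn.mono (subset_univ _))
  refine ⟨C, fun z hz => ?_⟩
  rw [← sub_smul_dslope, sub_zero, norm_smul, mul_comm]
  gcongr
  exact hC z (by simpa using hz)

/-- The powers of z beyond the first are bounded by 1, and the entire part is O(|z|), which |z ln z|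
absorbs because |ln z| ≥ 1/2. -/
theorem exists_norm_logRemainder_le [CompleteSpace W] (M : ℕ) (A : ℕ → W) {F : ℂ → W}
    (hF : Differentiable ℂ F) :
    ∃ C : ℝ, ∀ z ∈ cutPlane, ‖z‖ ≤ 1 / 2 → ‖logRemainder M A F z‖ ≤ C * ‖z * Complex.log z‖ := by
  obtain ⟨K, hK⟩ := exists_norm_sub_le_mul_norm hF
  refine ⟨∑ m ∈ Finset.range M, 9 * ‖A (m + 1)‖ + 2 * |K|, fun z hz hz2 => ?_⟩
  obtain ⟨h1, h2⟩ := norm_log_neg_I_mul_le hz.1 hz2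
  rw [norm_mul, add_mul, Finset.sum_mul]
  refine (norm_add_le _ _).trans (add_le_add ((norm_sum_le _ _).trans
    (Finset.sum_le_sum fun m _ => ?_)) ((hK z hz2).trans ?_))
  · have h3 : ‖z‖ ^ m ≤ 1 := pow_le_one₀ (norm_nonneg _) (by linarith)
    rw [norm_smul, norm_mul, norm_pow, pow_succ]
    calc ‖z‖ ^ m * ‖z‖ * ‖Complex.log (-Complex.I * z)‖ * ‖A (m + 1)‖
        ≤ 1 * ‖z‖ * (9 * ‖Complex.log z‖) * ‖A (m + 1)‖ := by gcongr
      _ = _ := by ring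
  · calc K * ‖z‖ ≤ |K| * ‖z‖ * 1 := by
          rw [mul_one]; gcongr; exact le_abs_self K
      _ ≤ |K| * ‖z‖ * (2 * ‖Complex.log z‖) := by gcongr
      _ = _ := by ring

end Remainder

/-! ### Perturbation of inverses -/

section Banach
variable {𝔸 : Type*} [NormedRing 𝔸]

/-- In the application X = I - Q̃ is unbounded near 0 and only its inverse converges. This suffices:
X - Θ = X(1 - X⁻¹Θ) is inverted by a factor close to 1, and the difference of the inverses is (X -
Θ)⁻¹ Θ X⁻¹ with both outer factors bounded. -/
theorem isBigO_inverse_sub_sub_inverse [CompleteSpace 𝔸] {ι : Type*} {l : Filter ι}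
    {X Θ : ι → 𝔸} {G : 𝔸} (hX : ∀ᶠ z in l, IsUnit (X z))
    (hG : Tendsto (fun z => Ring.inverse (X z)) l (𝓝 G)) (hΘ : Tendsto Θ l (𝓝 0)) :
    (∀ᶠ z in l, IsUnit (X z - Θ z)) ∧
      (fun z => Ring.inverse (X z - Θ z) - Ring.inverse (X z)) =O[l] Θ := by
  have hN : Tendsto (fun z => 1 - Ring.inverse (X z) * Θ z) l (𝓝 1) := by
    simpa using (hG.mul hΘ).const_sub 1
  have hu : ∀ᶠ z in l, IsUnit (1 - Ring.inverse (X z) * Θ z) :=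
    hN.eventually (Units.isOpen.mem_nhds isUnit_one)
  have he : ∀ᶠ z in l, X z - Θ z = X z * (1 - Ring.inverse (X z) * Θ z) := by
    filter_upwards [hX] with z hz
    rw [mul_sub, mul_one, ← mul_assoc, Ring.mul_inverse_cancel _ hz, one_mul]
  have hU : ∀ᶠ z in l, IsUnit (X z - Θ z) := by
    filter_upwards [hX, hu, he] with z h1 h2 h3
    rw [h3]
    exact h1.mul h2
  refine ⟨hU, ?_⟩
  have hI : Tendsto (fun z => Ring.inverse (X z - Θ z)) l (𝓝 (1 * G)) := by
    have h := (NormedRing.inverse_continuousAt (1 : 𝔸ˣ)).tendsto.comp hN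
    rw [Units.val_one, Ring.inverse_one] at h
    refine (h.mul hG).congr' ?_
    filter_upwards [hX, hu, he] with z h1 h2 h3
    rw [h3, Ring.inverse_mul (Or.inl h1)]
    rfl
  have hd : (fun z => Ring.inverse (X z - Θ z) - Ring.inverse (X z)) =ᶠ[l]
      fun z => Ring.inverse (X z - Θ z) * Θ z * Ring.inverse (X z) := by
    filter_upwards [hX, hU] with z h1 h2
    have h3 : Θ z = X z - (X z - Θ z) := by abel
    conv_rhs => enter [1, 2]; rw [h3]
    rw [mul_sub, sub_mul, mul_assoc, Ring.mul_inverse_cancel _ h1, mul_one,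
      Ring.inverse_mul_cancel _ h2, one_mul]
  refine hd.trans_isBigO ?_
  have h := ((hI.isBigO_one ℝ).mul (Asymptotics.isBigO_refl Θ l).norm_right).mul (hG.isBigO_one ℝ)
  simpa using h

/-- The Sherman–Morrison formula. -/
theorem inverse_add_smul [NormedAlgebra ℂ 𝔸] {D P : 𝔸} {θ a : ℂ} (hD : IsUnit D)
    (hP : P * Ring.inverse D * P = θ • P) (ha : 1 + a * θ ≠ 0) :
    IsUnit (D + a • P) ∧ Ring.inverse (D + a • P) =
      Ring.inverse D - (a / (1 + a * θ)) • (Ring.inverse D * P * Ring.inverse D) := by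
  set J := Ring.inverse D with hJ
  have h1 : D * J = 1 := Ring.mul_inverse_cancel _ hD
  have h2 : J * D = 1 := Ring.inverse_mul_cancel _ hD
  set b := a / (1 + a * θ) with hb
  have hab : a - b - a * b * θ = 0 := by
    rw [hb]; field_simp; ring
  have e1 : (D + a • P) * (J - b • (J * P * J)) = 1 := by
    have h3 : D * (J * P * J) = P * J := by rw [← mul_assoc, ← mul_assoc, h1, one_mul]
    have h4 : P * (J * P * J) = θ • (P * J) := by
      rw [← mul_assoc, ← mul_assoc, hP, smul_mul_assoc]
    rw [add_mul, mul_sub, mul_sub, h1, mul_smul_comm, mul_smul_comm, h3, smul_mul_assoc,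
      smul_mul_assoc, h4]
    calc _ = 1 + (a - b - a * b * θ) • (P * J) := by module
      _ = 1 := by rw [hab, zero_smul, add_zero]
  have e2 : (J - b • (J * P * J)) * (D + a • P) = 1 := by
    have h3 : J * P * J * D = J * P := by rw [mul_assoc, h2, mul_one]
    have h4 : J * P * J * P = θ • (J * P) := by
      rw [mul_assoc J, mul_assoc J, hP, mul_smul_comm]
    rw [mul_add, sub_mul, sub_mul, h2, smul_mul_assoc, smul_mul_assoc, mul_smul_comm, h3,
      mul_smul_comm, h4]
    calc _ = 1 + (a - b - a * b * θ) • (J * P) := by module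
      _ = 1 := by rw [hab, zero_smul, add_zero]
  exact ⟨⟨⟨_, _, e1, e2⟩, rfl⟩, Ring.inverse_unit ⟨_, _, e1, e2⟩⟩

end Banach

/-! ### Operator functions with a rank one logarithm -/

theorem tendsto_alpha {δ : ℝ} (hδ : 0 < δ) :
    Tendsto (alpha δ) (𝓝[cutPlane] 0) (Bornology.cobounded ℂ) := by
  rw [← tendsto_norm_atTop_iff_cobounded]
  have h1 : Tendsto (fun z : ℂ => ‖z‖ / δ) (𝓝[cutPlane] 0) (𝓝[≠] 0) := by
    rw [tendsto_nhdsWithin_iff]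
    refine ⟨?_, ?_⟩
    · have h : Continuous fun z : ℂ => ‖z‖ / δ := by fun_prop
      simpa using (h.tendsto 0).mono_left nhdsWithin_le_nhds
    · filter_upwards [self_mem_nhdsWithin] with z hz
      exact div_ne_zero (norm_ne_zero_iff.2 hz.1) hδ.ne'
  have h2 := tendsto_abs_atBot_atTop.comp (Real.tendsto_log_nhdsNE_zero.comp h1)
  refine tendsto_atTop_mono (fun z => ?_) h2
  have h3 : ‖-(Complex.I * z) / δ‖ = ‖z‖ / δ := by
    rw [norm_div, norm_neg, norm_mul, Complex.norm_I, one_mul, Complex.norm_real,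
      Real.norm_of_nonneg hδ.le]
  rw [alpha, norm_neg]
  simp only [Function.comp_apply]
  rw [← h3]
  exact abs_log_norm_le _

/-- A positive factor can be taken out of the principal logarithm without crossing the cut. -/
theorem log_neg_I_mul_eq {δ : ℝ} (hδ : 0 < δ) {z : ℂ} (hz : z ≠ 0) :
    Complex.log (-Complex.I * z) =
      Complex.log (-Complex.I * (Complex.I * δ)) - alpha δ z := by
  have h1 : -Complex.I * (Complex.I * δ) = (δ : ℂ) := by
    rw [← mul_assoc, neg_mul, Complex.I_mul_I, neg_neg, one_mul]
  have h2 : -Complex.I * z = (δ : ℂ) * (-(Complex.I * z) / δ) := by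
    have : (δ : ℂ) ≠ 0 := by exact_mod_cast hδ.ne'
    field_simp
  have h3 : -(Complex.I * z) / δ ≠ 0 :=
    div_ne_zero (neg_ne_zero.2 (mul_ne_zero Complex.I_ne_zero hz)) (by exact_mod_cast hδ.ne')
  rw [h1, alpha, sub_neg_eq_add, h2, Complex.log_ofReal_mul hδ h3, Complex.ofReal_log hδ.le]

section Accretive
variable {W : Type*} [NormedAddCommGroup W] [InnerProductSpace ℂ W]

/-- An operator function with a rank one logarithmic singularity at the origin. -/
def logLeading (ℓ : W) (B : W →L[ℂ] W) (z : ℂ) : W →L[ℂ] W :=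
  Complex.log (-Complex.I * z) • InnerProductSpace.rankOne ℂ ℓ ℓ + B

theorem inner_logLeading (ℓ : W) (B : W →L[ℂ] W) (z : ℂ) (u : W) :
    ⟪u, logLeading ℓ B z u⟫_ℂ =
      Complex.log (-Complex.I * z) * (⟪ℓ, u⟫_ℂ * ⟪u, ℓ⟫_ℂ) + ⟪u, B u⟫_ℂ := by
  simp only [logLeading, _root_.add_apply, _root_.smul_apply, InnerProductSpace.rankOne_apply,
    inner_add_right, inner_smul_right]

theorem one_sub_logLeading (ℓ : W) (B : W →L[ℂ] W) {δ : ℝ} (hδ : 0 < δ) {z : ℂ} (hz : z ≠ 0) :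
    1 - logLeading ℓ B z = (1 - logLeading ℓ B (Complex.I * δ)) +
      alpha δ z • InnerProductSpace.rankOne ℂ ℓ ℓ := by
  rw [logLeading, logLeading, log_neg_I_mul_eq hδ hz]
  module

theorem analyticOnNhd_logLeading (ℓ : W) (B : W →L[ℂ] W) :
    AnalyticOnNhd ℂ (logLeading ℓ B) cutPlane := by
  intro z hz
  have h : AnalyticAt ℂ (fun z => Complex.log (-Complex.I * z)) z :=
    AnalyticAt.clog (by fun_prop) (mem_cutPlane_iff.1 hz)
  exact (h.smul analyticAt_const).add analyticAt_const

theorem rankOne_mul_mul_rankOne (ℓ : W) (J : W →L[ℂ] W) :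
    InnerProductSpace.rankOne ℂ ℓ ℓ * J * InnerProductSpace.rankOne ℂ ℓ ℓ =
      ⟪ℓ, J ℓ⟫_ℂ • InnerProductSpace.rankOne ℂ ℓ ℓ := by
  ext1 e
  simp only [mul_apply_eq_comp, InnerProductSpace.rankOne_apply, map_smul, _root_.smul_apply,
    smul_smul]
  rw [mul_comm]

theorem mul_rankOne_mul [CompleteSpace W] (x y : W) (J K : W →L[ℂ] W) :
    J * InnerProductSpace.rankOne ℂ x y * K =
      InnerProductSpace.rankOne ℂ (J x) (ContinuousLinearMap.adjoint K y) := by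
  ext1 e
  simp only [mul_apply_eq_comp, InnerProductSpace.rankOne_apply, map_smul,
    ContinuousLinearMap.adjoint_inner_left]

theorem adjoint_inverse [CompleteSpace W] (D : W →L[ℂ] W) :
    ContinuousLinearMap.adjoint (Ring.inverse D) =
      Ring.inverse (ContinuousLinearMap.adjoint D) := by
  rw [← ContinuousLinearMap.star_eq_adjoint, ← ContinuousLinearMap.star_eq_adjoint,
    Ring.inverse_star]

theorem continuous_re_inner_apply (u : W) :
    Continuous fun T : W →L[ℂ] W => (⟪u, T u⟫_ℂ).re :=
  Complex.continuous_re.comp ((innerSL ℂ u).continuous.comp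
    (ContinuousLinearMap.apply ℂ W u).continuous)

/-- Operator functions of the form `ln(-iz) ⟨·, ℓ⟩ ℓ + B + Θ(z)` whose real part is nonpositive in
the upper half-plane. -/
structure IsLogAccretive (ℓ : W) (B : W →L[ℂ] W) (Θ : ℂ → W →L[ℂ] W) : Prop where
  ne_zero : ℓ ≠ 0
  analyticOnNhd : AnalyticOnNhd ℂ Θ cutPlane
  isBigO : Θ =O[𝓝[cutPlane] 0] fun z => z * Complex.log z
  re_inner_nonpos : ∀ z : ℂ, 0 < z.im → ∀ u, (⟪u, (logLeading ℓ B z + Θ z) u⟫_ℂ).re ≤ 0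

namespace IsLogAccretive
variable {ℓ : W} {B : W →L[ℂ] W} {Θ : ℂ → W →L[ℂ] W}

theorem tendsto_zero (h : IsLogAccretive ℓ B Θ) : Tendsto Θ (𝓝[cutPlane] 0) (𝓝 0) :=
  h.isBigO.trans_tendsto (tendsto_mul_log_zero.mono_left nhdsWithin_le_nhds)

/-- The sign passes to the real axis by continuity, which holds everywhere off the cut. -/
theorem re_inner_nonpos_of_im_nonneg (h : IsLogAccretive ℓ B Θ) {z : ℂ} (hz : 0 ≤ z.im)
    (h0 : z ≠ 0) (u : W) :
    (⟪u, (logLeading ℓ B z + Θ z) u⟫_ℂ).re ≤ 0 := by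
  have hc : z ∈ cutPlane := mem_cutPlane_of_im_nonneg hz h0
  have h1 : ContinuousAt (fun z => logLeading ℓ B z + Θ z) z :=
    ((analyticOnNhd_logLeading ℓ B z hc).add (h.analyticOnNhd z hc)).continuousAt
  have h2 : ContinuousAt (fun z => (⟪u, (logLeading ℓ B z + Θ z) u⟫_ℂ).re) z :=
    (continuous_re_inner_apply u).continuousAt.comp h1
  refine ContinuousWithinAt.closure_le (s := {z : ℂ | 0 < z.im}) ?_ h2.continuousWithinAt
    continuousWithinAt_const fun z hz => h.re_inner_nonpos z hz u
  rw [Complex.closure_setOfPred_lt_im]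
  exact hz

/-- Orthogonally to ℓ the logarithm drops out, so the inequality survives the limit z → 0. -/
theorem re_inner_nonpos_of_inner_eq_zero (h : IsLogAccretive ℓ B Θ) {u : W} (hu : ⟪ℓ, u⟫_ℂ = 0) :
    (⟪u, B u⟫_ℂ).re ≤ 0 := by
  have := nhdsWithin_upperHalf_neBot
  have h1 := ((continuous_re_inner_apply u).tendsto _).comp ((h.tendsto_zero.mono_left
    (nhdsWithin_mono _ upperHalf_subset_cutPlane)).const_add B)
  rw [add_zero] at h1
  refine le_of_tendsto h1 ?_
  filter_upwards [self_mem_nhdsWithin] with z hz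
  have h3 := h.re_inner_nonpos z hz u
  rw [_root_.add_apply, inner_add_right, inner_logLeading, hu, zero_mul, mul_zero, zero_add,
    ← inner_add_right] at h3
  exact h3

/-- Suppose u = (I - Q̃(iδ))⁻¹ℓ is orthogonal to ℓ. Then ⟨u, (I - Q̃(iδ))u⟩ = ⟨u, ℓ⟩ = 0 and the
logarithmic term is absent, so ‖u‖² = Re⟨u, Bu⟩ ≤ 0. Hence u = 0 and ℓ = 0. -/
theorem theta_ne_zero (h : IsLogAccretive ℓ B Θ) {δ : ℝ}
    (hu : IsUnit (1 - logLeading ℓ B (Complex.I * δ))) :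
    ⟪ℓ, Ring.inverse (1 - logLeading ℓ B (Complex.I * δ)) ℓ⟫_ℂ ≠ 0 := by
  intro h0
  set D := 1 - logLeading ℓ B (Complex.I * δ) with hD
  set u := Ring.inverse D ℓ with hu'
  have h1 : D u = ℓ := congrArg (fun T : W →L[ℂ] W => T ℓ) (Ring.mul_inverse_cancel D hu)
  have h2 := h.re_inner_nonpos_of_inner_eq_zero h0
  have h3 : ⟪u, D u⟫_ℂ = 0 := by
    rw [h1, ← inner_conj_symm, h0, map_zero]
  rw [hD, _root_.sub_apply, one_apply_eq_self, inner_sub_right, inner_logLeading, h0, zero_mul,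
    mul_zero, zero_add, sub_eq_zero] at h3
  rw [← h3] at h2
  have h4 : u = 0 := by
    have h5 : (⟪u, u⟫_ℂ).re = ‖u‖ ^ 2 := inner_self_eq_norm_sq (𝕜 := ℂ) u
    rw [h5] at h2
    exact norm_eq_zero.1 (pow_eq_zero_iff two_ne_zero |>.1 (le_antisymm h2 (sq_nonneg _)))
  exact h.ne_zero (by rw [← h1, h4, map_zero])

theorem tendsto_one_add_alpha_mul (h : IsLogAccretive ℓ B Θ) {δ : ℝ} (hδ : 0 < δ)
    (hu : IsUnit (1 - logLeading ℓ B (Complex.I * δ))) :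
    Tendsto (fun z => 1 + alpha δ z *
        ⟪ℓ, Ring.inverse (1 - logLeading ℓ B (Complex.I * δ)) ℓ⟫_ℂ)
      (𝓝[cutPlane] 0) (Bornology.cobounded ℂ) := by
  refine (tendsto_const_add_cobounded 1).comp ?_
  exact (tendsto_mul_right_cobounded (h.theta_ne_zero hu)).comp (tendsto_alpha hδ)

theorem eventually_inverse_eq (h : IsLogAccretive ℓ B Θ) {δ : ℝ} (hδ : 0 < δ)
    (hu : IsUnit (1 - logLeading ℓ B (Complex.I * δ))) : ∀ᶠ z in 𝓝[cutPlane] 0,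
    IsUnit (1 - logLeading ℓ B z) ∧ Ring.inverse (1 - logLeading ℓ B z) =
      Ring.inverse (1 - logLeading ℓ B (Complex.I * δ)) -
        (1 / ⟪ℓ, Ring.inverse (1 - logLeading ℓ B (Complex.I * δ)) ℓ⟫_ℂ -
          1 / (⟪ℓ, Ring.inverse (1 - logLeading ℓ B (Complex.I * δ)) ℓ⟫_ℂ * (1 + alpha δ z *
            ⟪ℓ, Ring.inverse (1 - logLeading ℓ B (Complex.I * δ)) ℓ⟫_ℂ))) •
        (Ring.inverse (1 - logLeading ℓ B (Complex.I * δ)) * InnerProductSpace.rankOne ℂ ℓ ℓ *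
          Ring.inverse (1 - logLeading ℓ B (Complex.I * δ))) := by
  have h0 := h.theta_ne_zero hu
  have h1 := (h.tendsto_one_add_alpha_mul hδ hu).eventually_ne_cobounded 0
  filter_upwards [h1, self_mem_nhdsWithin] with z hz hc
  have h2 := inverse_add_smul hu (rankOne_mul_mul_rankOne ℓ _) hz
  rw [← one_sub_logLeading ℓ B hδ hc.1] at h2
  refine ⟨h2.1, h2.2.trans ?_⟩
  -- The coefficient α/(1 + αϑ) is split as 1/ϑ - 1/(ϑ(1 + αϑ)), its limit and a term tending to 0.
  congr 2
  field_simp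
  ring

theorem tendsto_inverse (h : IsLogAccretive ℓ B Θ) {δ : ℝ} (hδ : 0 < δ)
    (hu : IsUnit (1 - logLeading ℓ B (Complex.I * δ))) :
    Tendsto (fun z => Ring.inverse (1 - logLeading ℓ B z)) (𝓝[cutPlane] 0)
    (𝓝 (Ring.inverse (1 - logLeading ℓ B (Complex.I * δ)) -
        (1 / ⟪ℓ, Ring.inverse (1 - logLeading ℓ B (Complex.I * δ)) ℓ⟫_ℂ) •
        (Ring.inverse (1 - logLeading ℓ B (Complex.I * δ)) * InnerProductSpace.rankOne ℂ ℓ ℓ *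
          Ring.inverse (1 - logLeading ℓ B (Complex.I * δ))))) := by
  set J := Ring.inverse (1 - logLeading ℓ B (Complex.I * δ)) with hJ
  set θ := ⟪ℓ, J ℓ⟫_ℂ with hθ
  have h1 : Tendsto (fun z => 1 / (θ * (1 + alpha δ z * θ))) (𝓝[cutPlane] 0) (𝓝 0) := by
    have h2 := (tendsto_inv₀_cobounded.comp (h.tendsto_one_add_alpha_mul hδ hu)).const_mul θ⁻¹
    rw [mul_zero] at h2
    refine h2.congr fun z => ?_
    rw [one_div, mul_inv]
    rfl
  have h2 := ((h1.const_sub (1 / θ)).smul_const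
    (J * InnerProductSpace.rankOne ℂ ℓ ℓ * J)).const_sub J
  rw [sub_zero] at h2
  refine h2.congr' ?_
  filter_upwards [h.eventually_inverse_eq hδ hu] with z hz
  exact hz.2.symm

variable [CompleteSpace W]

theorem isUnit_of_im_nonneg (h : IsLogAccretive ℓ B Θ) {z : ℂ} (hz : 0 ≤ z.im) (h0 : z ≠ 0) :
    IsUnit (1 - (logLeading ℓ B z + Θ z)) :=
  isUnit_one_sub_of_re_inner_nonpos (h.re_inner_nonpos_of_im_nonneg hz h0)

/-- For small δ the operator I - Q̃(iδ) differs from I - Q(iδ), whose real part is at least I, by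
Θ(iδ) of norm less than 1/2. -/
theorem exists_isUnit (h : IsLogAccretive ℓ B Θ) :
    ∃ δ : ℝ, 0 < δ ∧ IsUnit (1 - logLeading ℓ B (Complex.I * δ)) := by
  have h1 : Tendsto (fun δ : ℝ => Complex.I * δ) (𝓝[>] 0) (𝓝[cutPlane] 0) := by
    rw [tendsto_nhdsWithin_iff]
    constructor
    · have h : Continuous fun δ : ℝ => Complex.I * δ := by fun_prop
      simpa using (h.tendsto 0).mono_left nhdsWithin_le_nhds
    · filter_upwards [self_mem_nhdsWithin] with δ hδ
      exact upperHalf_subset_cutPlane (by simpa using hδ)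
  have h2 := (h.tendsto_zero.comp h1).norm.eventually_lt_const
    (by simp : ‖(0 : W →L[ℂ] W)‖ < 1 / 2)
  obtain ⟨δ, h3, hδ⟩ := (h2.and self_mem_nhdsWithin).exists
  refine ⟨δ, hδ, isUnit_of_re_inner_ge (c := 1 / 2) (by norm_num) fun x => ?_⟩
  have h4 := h.re_inner_nonpos (Complex.I * δ) (by simpa using hδ) x
  have h5 : (⟪x, x⟫_ℂ).re = ‖x‖ ^ 2 := inner_self_eq_norm_sq (𝕜 := ℂ) x
  have h6 : -(⟪x, Θ (Complex.I * δ) x⟫_ℂ).re ≤ 1 / 2 * ‖x‖ ^ 2 := by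
    refine (neg_le_abs _).trans ((Complex.abs_re_le_norm _).trans
      ((norm_inner_le_norm _ _).trans ?_))
    have h7 := (Θ (Complex.I * δ)).le_of_opNorm_le (le_of_lt h3) x
    calc ‖x‖ * ‖Θ (Complex.I * δ) x‖ ≤ ‖x‖ * (1 / 2 * ‖x‖) := by gcongr
      _ = _ := by ring
  rw [_root_.add_apply, inner_add_right, Complex.add_re] at h4
  rw [_root_.sub_apply, one_apply_eq_self, inner_sub_right, Complex.sub_re, h5]
  linarith

/-- Below the real axis no sign is available; invertibility near 0 comes from the explicit inverse
of I - Q̃ and the smallness of Θ. -/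
theorem eventually_isUnit (h : IsLogAccretive ℓ B Θ) :
    ∀ᶠ z in 𝓝[cutPlane] 0, IsUnit (1 - (logLeading ℓ B z + Θ z)) := by
  obtain ⟨δ, hδ, hu⟩ := h.exists_isUnit
  refine (isBigO_inverse_sub_sub_inverse
    ((h.eventually_inverse_eq hδ hu).mono fun z hz => hz.1)
    (h.tendsto_inverse hδ hu) h.tendsto_zero).1.mono fun z hz => ?_
  rwa [sub_sub] at hz

theorem analyticAt_inverse (h : IsLogAccretive ℓ B Θ) {z : ℂ} (hz : z ∈ cutPlane)
    (hu : IsUnit (1 - (logLeading ℓ B z + Θ z))) :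
    AnalyticAt ℂ (fun z => Ring.inverse (1 - (logLeading ℓ B z + Θ z))) z := by
  obtain ⟨U, hU⟩ := hu
  refine AnalyticAt.fun_comp (g := Ring.inverse) ?_
    (analyticAt_const.sub ((analyticOnNhd_logLeading ℓ B z hz).add (h.analyticOnNhd z hz)))
  change AnalyticAt ℂ Ring.inverse (1 - (logLeading ℓ B z + Θ z))
  rw [← hU]
  exact _root_.analyticAt_inverse U

end IsLogAccretive
end Accretive

/-! ### The Cayley transform near the origin -/

section Cayley
variable {W : Type*} [NormedAddCommGroup W] [InnerProductSpace ℂ W]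

/-- The limit at the origin of the Cayley transform `(I - Q(z))⁻¹ (I + Q(z))`, for a function `Q`
with leading part `logLeading ℓ B`. -/
def cayleyLimit (ℓ : W) (B : W →L[ℂ] W) (δ : ℝ) : W →L[ℂ] W :=
  (1 + logLeading ℓ B (Complex.I * δ)) * Ring.inverse (1 - logLeading ℓ B (Complex.I * δ)) -
    (2 / ⟪ℓ, Ring.inverse (1 - logLeading ℓ B (Complex.I * δ)) ℓ⟫_ℂ) •
      (Ring.inverse (1 - logLeading ℓ B (Complex.I * δ)) * InnerProductSpace.rankOne ℂ ℓ ℓ *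
        Ring.inverse (1 - logLeading ℓ B (Complex.I * δ)))

theorem one_add_mul_inverse_one_sub {R : Type*} [Ring R] [Algebra ℂ R] {X : R}
    (hX : IsUnit (1 - X)) :
    (1 + X) * Ring.inverse (1 - X) = (2 : ℂ) • Ring.inverse (1 - X) - 1 := by
  have h1 := Ring.mul_inverse_cancel _ hX
  have h2 : 1 + X = (2 : ℂ) • (1 : R) - (1 - X) := by module
  rw [h2, sub_mul, h1, smul_mul_assoc, one_mul]

namespace IsLogAccretive
variable {ℓ : W} {B : W →L[ℂ] W} {Θ : ℂ → W →L[ℂ] W}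

/-- The continuation of the Cayley transform `(I - Q(z))⁻¹ (I + Q(z))` to the origin and to the
cut plane. -/
def cayley (ℓ : W) (B : W →L[ℂ] W) (Θ : ℂ → W →L[ℂ] W) (S₀ : W →L[ℂ] W) : ℂ → W →L[ℂ] W :=
  Function.update (fun z => (2 : ℂ) • Ring.inverse (1 - (logLeading ℓ B z + Θ z)) - 1) 0 S₀

theorem cayley_zero (S₀ : W →L[ℂ] W) : cayley ℓ B Θ S₀ 0 = S₀ := Function.update_self ..

theorem cayley_eventuallyEq (S₀ : W →L[ℂ] W) {z : ℂ} (hz : z ≠ 0) : cayley ℓ B Θ S₀ =ᶠ[𝓝 z]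
    fun z => (2 : ℂ) • Ring.inverse (1 - (logLeading ℓ B z + Θ z)) - 1 := by
  filter_upwards [isOpen_ne.mem_nhds hz] with w hw
  exact Function.update_of_ne hw _ _

variable [CompleteSpace W]

theorem isBigO_inverse_sub (h : IsLogAccretive ℓ B Θ) {δ : ℝ} (hδ : 0 < δ)
    (hu : IsUnit (1 - logLeading ℓ B (Complex.I * δ))) :
    (fun z => Ring.inverse (1 - (logLeading ℓ B z + Θ z)) - Ring.inverse (1 - logLeading ℓ B z))
      =O[𝓝[cutPlane] 0] Θ := by
  simp only [← sub_sub]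
  exact (isBigO_inverse_sub_sub_inverse
    ((h.eventually_inverse_eq hδ hu).mono fun z hz => hz.1)
    (h.tendsto_inverse hδ hu) h.tendsto_zero).2

theorem tendsto_cayley (h : IsLogAccretive ℓ B Θ) {δ : ℝ} (hδ : 0 < δ)
    (hu : IsUnit (1 - logLeading ℓ B (Complex.I * δ))) :
    Tendsto (fun z => (2 : ℂ) • Ring.inverse (1 - (logLeading ℓ B z + Θ z)) - 1)
      (𝓝[cutPlane] 0) (𝓝 (cayleyLimit ℓ B δ)) := by
  have h1 := ((h.isBigO_inverse_sub hδ hu).trans_tendsto h.tendsto_zero).add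
    (h.tendsto_inverse hδ hu)
  simp only [sub_add_cancel, zero_add] at h1
  have h2 := (h1.const_smul (2 : ℂ)).sub_const 1
  rw [smul_sub, smul_smul, mul_one_div, sub_right_comm, ← one_add_mul_inverse_one_sub hu] at h2
  exact h2

theorem isBigO_cayley_sub (h : IsLogAccretive ℓ B Θ) {δ : ℝ} (hδ : 0 < δ)
    (hu : IsUnit (1 - logLeading ℓ B (Complex.I * δ))) :
    (fun z => (2 : ℂ) • Ring.inverse (1 - (logLeading ℓ B z + Θ z)) - 1 - (cayleyLimit ℓ B δ +
        (2 / (⟪ℓ, Ring.inverse (1 - logLeading ℓ B (Complex.I * δ)) ℓ⟫_ℂ * (1 + alpha δ z *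
            ⟪ℓ, Ring.inverse (1 - logLeading ℓ B (Complex.I * δ)) ℓ⟫_ℂ))) •
          (Ring.inverse (1 - logLeading ℓ B (Complex.I * δ)) * InnerProductSpace.rankOne ℂ ℓ ℓ *
            Ring.inverse (1 - logLeading ℓ B (Complex.I * δ)))))
      =O[𝓝[cutPlane] 0] fun z => z * Complex.log z := by
  refine EventuallyEq.trans_isBigO ?_
    (((h.isBigO_inverse_sub hδ hu).const_smul_left (2 : ℂ)).trans h.isBigO)
  filter_upwards [h.eventually_inverse_eq hδ hu] with z hz
  rw [Pi.smul_apply, hz.2, cayleyLimit, one_add_mul_inverse_one_sub hu]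
  simp only [← mul_one_div (2 : ℂ)]
  module

theorem analyticAt_cayley (h : IsLogAccretive ℓ B Θ) (S₀ : W →L[ℂ] W) {z : ℂ} (hz : z ∈ cutPlane)
    (hu : IsUnit (1 - (logLeading ℓ B z + Θ z))) : AnalyticAt ℂ (cayley ℓ B Θ S₀) z := by
  refine AnalyticAt.congr ?_ (cayley_eventuallyEq S₀ hz.1).symm
  exact ((h.analyticAt_inverse hz hu).const_smul (c := (2 : ℂ))).sub analyticAt_const

theorem exists_analyticAt_cayley (h : IsLogAccretive ℓ B Θ) (S₀ : W →L[ℂ] W) :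
    ∃ δ₀ : ℝ, 0 < δ₀ ∧ ∀ z ∈ slitDisc δ₀, AnalyticAt ℂ (cayley ℓ B Θ S₀) z := by
  obtain ⟨ε, hε, h1⟩ := Metric.mem_nhdsWithin_iff.1 h.eventually_isUnit
  -- The slit disc includes its bounding circle, hence the smaller radius.
  refine ⟨ε / 2, half_pos hε, fun z hz => h.analyticAt_cayley S₀ hz.1 (h1 ⟨?_, hz.1⟩)⟩
  rw [mem_ball_zero_iff]
  linarith [hz.2]

theorem continuousOn_cayley (h : IsLogAccretive ℓ B Θ) {δ : ℝ} (hδ : 0 < δ)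
    (hu : IsUnit (1 - logLeading ℓ B (Complex.I * δ))) :
    ContinuousOn (cayley ℓ B Θ (cayleyLimit ℓ B δ)) {z | 0 ≤ z.im} := by
  intro z hz
  by_cases h0 : z = 0
  · subst h0
    rw [cayley, continuousWithinAt_update_same]
    refine (h.tendsto_cayley hδ hu).mono_left (nhdsWithin_mono _ ?_)
    exact fun z hz => mem_cutPlane_of_im_nonneg hz.1 hz.2
  · exact (h.analyticAt_cayley _ (mem_cutPlane_of_im_nonneg hz h0)
      (h.isUnit_of_im_nonneg hz h0)).continuousAt.continuousWithinAt

end IsLogAccretive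
theorem eq_of_one_sub_mul_eq_one_add {Q S : W →L[ℂ] W} (hu : IsUnit (1 - Q))
    (h : (1 - Q) * S = 1 + Q) : S = (2 : ℂ) • Ring.inverse (1 - Q) - 1 := by
  have h1 : S = Ring.inverse (1 - Q) * (1 + Q) := by
    rw [← h, ← mul_assoc, Ring.inverse_mul_cancel _ hu, one_mul]
  have h2 : 1 + Q = (2 : ℂ) • (1 : W →L[ℂ] W) - (1 - Q) := by module
  rw [h1, h2, mul_sub, Ring.inverse_mul_cancel _ hu, mul_smul_comm, mul_one]

theorem exists_isLogAccretive_of_expansion [CompleteSpace W] {ℓ : W} (hℓ : ℓ ≠ 0)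
    {Q F : ℂ → W →L[ℂ] W} {M : ℕ} {A : ℕ → W →L[ℂ] W} (hF : Differentiable ℂ F)
    (hA : A 0 = InnerProductSpace.rankOne ℂ ℓ ℓ)
    (hQ : ∀ z : ℂ, 0 < z.im → Q z =
      ∑ m ∈ Finset.range (M + 1), (z ^ m * Complex.log (-Complex.I * z)) • A m + F z)
    (hre : ∀ z : ℂ, 0 < z.im → ∀ u, (⟪u, Q z u⟫_ℂ).re ≤ 0) {B : W →L[ℂ] W}
    (hB : B = limUnder (𝓝[{z : ℂ | 0 < z.im}] 0) fun z =>
      Q z - Complex.log (-Complex.I * z) • InnerProductSpace.rankOne ℂ ℓ ℓ) :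
    ∃ Θ : ℂ → W →L[ℂ] W, IsLogAccretive ℓ B Θ ∧
      (∃ C : ℝ, ∀ z ∈ cutPlane, ‖z‖ ≤ 1 / 2 → ‖Θ z‖ ≤ C * ‖z * Complex.log z‖) ∧
      ∀ z : ℂ, 0 < z.im → Q z = logLeading ℓ B z + Θ z := by
  obtain ⟨C, hC⟩ := exists_norm_logRemainder_le M A hF
  have hO : logRemainder M A F =O[𝓝[cutPlane] 0] fun z => z * Complex.log z := by
    refine Asymptotics.IsBigO.of_bound C ?_
    filter_upwards [self_mem_nhdsWithin, mem_nhdsWithin_of_mem_nhds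
      (Metric.closedBall_mem_nhds (0 : ℂ) one_half_pos)] with z hz hz2
    exact hC z hz (by simpa using hz2)
  have hQ' : ∀ z : ℂ, 0 < z.im → Q z = logLeading ℓ (F 0) z + logRemainder M A F z := by
    intro z hz
    rw [hQ z hz, sum_log_smul_eq, hA, logLeading]
  -- The limit defining `B` exists because the remainder is O(|z ln z|), so `limUnder` is its actual
  -- value.
  have hBF : B = F 0 := by
    have := nhdsWithin_upperHalf_neBot
    rw [hB]
    refine Tendsto.limUnder_eq ?_
    have h1 : Tendsto (fun z => F 0 + logRemainder M A F z) (𝓝[{z : ℂ | 0 < z.im}] 0)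
        (𝓝 (F 0 + 0)) :=
      ((hO.trans_tendsto (tendsto_mul_log_zero.mono_left nhdsWithin_le_nhds)).mono_left
        (nhdsWithin_mono _ upperHalf_subset_cutPlane)).const_add _
    rw [add_zero] at h1
    refine h1.congr' ?_
    filter_upwards [self_mem_nhdsWithin] with z hz
    rw [hQ' z hz, logLeading]
    abel
  subst hBF
  refine ⟨logRemainder M A F, ⟨hℓ, analyticOnNhd_logRemainder M A hF, hO,
    fun z hz u => ?_⟩, ⟨C, hC⟩, hQ'⟩
  rw [← hQ' z hz]
  exact hre z hz u

end Cayley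

/-! ### Application to the transport operator -/

namespace Medium
variable (d : Medium)

theorem integral_sum_mul_eval (a : Fin d.N → ℝ) (j : Fin d.N) :
    ∫ μ, (∑ i, a i * (d.P i).eval μ) * (d.P j).eval μ ∂angleMeasure = a j := by
  simp only [Finset.sum_mul, mul_assoc]
  rw [integral_finsetSum]
  · simp only [integral_const_mul, d.orthonormal]
    simp
  · intro i _
    exact integrable_angleMeasure_of_continuous (by fun_prop)

/-- If ℓ = 0 then, at a point with c(x) > 0, orthonormality gives 𝒫ⱼ(0) = 0 for all j. The
eigenvalue equation of the constant function, taken at μ = 0, would then give κ = 0. -/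
theorem ell_ne_zero (hc : ¬ d.c =ᵐ[volume] 0) : d.ell ≠ 0 := by
  intro h0
  have h1 : d.memLp_ellFun.toLp d.ellFun = 0 := congrArg Subtype.val h0
  have h2 : d.ellFun =ᵐ[phaseMeasure] 0 := by
    exact (MemLp.toLp_eq_toLp_iff d.memLp_ellFun MemLp.zero).1 (h1.trans (MemLp.toLp_zero _).symm)
  refine hc ?_
  filter_upwards [Measure.ae_ae_of_ae_prod h2, d.c_nonneg] with x hx hcx
  by_contra hne
  have hs : √(d.c x) ≠ 0 := (Real.sqrt_pos.2 (lt_of_le_of_ne hcx (Ne.symm hne))).ne'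
  have h3 : ∀ᵐ μ ∂angleMeasure, ∑ i, d.k i * (d.P i).eval 0 * (d.P i).eval μ = 0 := by
    filter_upwards [hx] with μ hμ
    exact (mul_eq_zero.1 (Complex.ofReal_eq_zero.1 hμ)).resolve_left hs
  have h4 : ∀ j, (d.P j).eval 0 = 0 := by
    intro j
    have h5 := d.integral_sum_mul_eval (fun i => d.k i * (d.P i).eval 0) j
    rw [integral_eq_zero_of_ae] at h5
    · exact (mul_eq_zero.1 h5.symm).resolve_left (d.k_pos j).ne'
    · filter_upwards [h3] with μ hμ
      simp only [hμ, zero_mul, Pi.zero_apply]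
  obtain ⟨κ, hκ, h⟩ := d.const_eigen
  refine hκ ?_
  rw [← h 0 (by simp)]
  simp [h4]

theorem re_inner_Q_nonpos {z : ℂ} (hz : 0 < z.im) (e : d.E) : (⟪e, d.Q z e⟫_ℂ).re ≤ 0 :=
  re_inner_borderedResolvent_nonpos d.V (re_inner_I_smul_resolventOp_nonpos hz) e

theorem one_sub_Q_mul_S {z : ℂ} (hz : 0 < z.im) : (1 - d.Q z) * d.S z = 1 + d.Q z := by
  have h1 := isResolventAt_streamingOp hz
  refine one_sub_borderedResolvent_mul dense_streamingOp_domain h1 d.V_nonneg fun x => ?_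
  rw [← h1.resolventOp_eq]
  exact re_inner_I_smul_resolventOp_nonpos hz x

theorem S_eq {z : ℂ} (hz : 0 < z.im) : d.S z = (2 : ℂ) • Ring.inverse (1 - d.Q z) - 1 := by
  have hu := isUnit_one_sub_of_re_inner_nonpos (d.re_inner_Q_nonpos hz)
  exact eq_of_one_sub_mul_eq_one_add hu (d.one_sub_Q_mul_S hz)

/-- The logarithmic singularity of `Q` at the origin. -/
theorem exists_isLogAccretive (hc : ¬ d.c =ᵐ[volume] 0) :
    ∃ Θ : ℂ → d.E →L[ℂ] d.E, IsLogAccretive d.ell d.B Θ ∧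
      (∃ C : ℝ, ∀ z ∈ cutPlane, ‖z‖ ≤ 1 / 2 → ‖Θ z‖ ≤ C * ‖z * Complex.log z‖) ∧
      ∀ z : ℂ, 0 < z.im → d.Q z = d.Qtilde z + Θ z := by
  obtain ⟨M, A, F, hF, hA, hQ⟩ := d.exists_Q_expansion
  exact exists_isLogAccretive_of_expansion (d.ell_ne_zero hc) hF hA hQ
    (fun z hz => d.re_inner_Q_nonpos hz) rfl

theorem rankOneTerm_eq (δ : ℝ) : d.rankOneTerm δ =
    d.qInv δ * InnerProductSpace.rankOne ℂ d.ell d.ell * d.qInv δ := by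
  rw [mul_rankOne_mul, rankOneTerm, qAdjInv]
  congr 2
  rw [qInv, adjoint_inverse, map_sub, ContinuousLinearMap.adjoint_one]

end Medium

end
end SlabTransport


theorem mainTheorem5 (d : SlabTransport.Medium) (hc : ¬ d.c =ᵐ[volume] 0) :
    (∃ Θ : ℂ → d.E →L[ℂ] d.E,
      AnalyticOnNhd ℂ Θ SlabTransport.cutPlane ∧
      (∃ C : ℝ, ∀ z ∈ SlabTransport.cutPlane, ‖z‖ ≤ 1 / 2 → ‖Θ z‖ ≤ C * ‖z * Complex.log z‖) ∧
      ∀ z : ℂ, 0 < z.im → d.Q z = d.Qtilde z + Θ z) ∧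
    (∃ δ : ℝ, 0 < δ ∧ IsUnit (1 - d.Qtilde (Complex.I * δ))) ∧
    ∃ (δ₀ : ℝ) (S' : ℂ → d.E →L[ℂ] d.E), 0 < δ₀ ∧
      (∀ z : ℂ, 0 < z.im → S' z = d.S z) ∧
      AnalyticOnNhd ℂ S'
        ({z | 0 < z.im} ∪ {z | z.im = 0 ∧ z ≠ 0} ∪ SlabTransport.slitDisc δ₀) ∧
      ContinuousOn S' {z | 0 ≤ z.im} ∧
      ∀ δ : ℝ, 0 < δ → IsUnit (1 - d.Qtilde (Complex.I * δ)) →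
        d.theta δ ≠ 0 ∧
        S' 0 = (1 + d.Qtilde (Complex.I * δ)) * d.qInv δ - (2 / d.theta δ) • d.rankOneTerm δ ∧
        (fun z => S' z - (S' 0 +
            (2 / (d.theta δ * (1 + SlabTransport.alpha δ z * d.theta δ))) • d.rankOneTerm δ))
          =O[𝓝[SlabTransport.slitDisc δ₀] 0] fun z => z * Complex.log z := by
  obtain ⟨Θ, h, hΘ, hQ⟩ := d.exists_isLogAccretive hc
  refine ⟨⟨Θ, h.analyticOnNhd, hΘ, hQ⟩, h.exists_isUnit, ?_⟩
  obtain ⟨δ₁, hδ₁, hu₁⟩ := h.exists_isUnit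
  obtain ⟨δ₀, hδ₀, han⟩ := h.exists_analyticAt_cayley (SlabTransport.cayleyLimit d.ell d.B δ₁)
  have hreal : ∀ z : ℂ, 0 ≤ z.im → z ≠ 0 → AnalyticAt ℂ (SlabTransport.IsLogAccretive.cayley
      d.ell d.B Θ (SlabTransport.cayleyLimit d.ell d.B δ₁)) z := fun z hz h0 =>
    h.analyticAt_cayley _ (SlabTransport.mem_cutPlane_of_im_nonneg hz h0)
      (h.isUnit_of_im_nonneg hz h0)
  refine ⟨δ₀, _, hδ₀, fun z hz => ?_, ?_, h.continuousOn_cayley hδ₁ hu₁, fun δ hδ hu => ?_⟩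
  · rw [d.S_eq hz, hQ z hz]
    exact (SlabTransport.IsLogAccretive.cayley_eventuallyEq _
      (SlabTransport.upperHalf_subset_cutPlane hz).1).self_of_nhds
  · rintro z ((hz | hz) | hz)
    · exact hreal z (le_of_lt hz) (SlabTransport.upperHalf_subset_cutPlane hz).1
    · exact hreal z hz.1.ge hz.2
    · exact han z hz
  · have := SlabTransport.nhdsWithin_cutPlane_neBot
    -- The continuation was built with one auxiliary δ₁, while the formulas are claimed for every
    -- admissible δ. Both expressions are limits at 0 of the same function, so they agree.
    have hlim : SlabTransport.cayleyLimit d.ell d.B δ₁ = SlabTransport.cayleyLimit d.ell d.B δ :=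
      tendsto_nhds_unique (h.tendsto_cayley hδ₁ hu₁) (h.tendsto_cayley hδ hu)
    rw [SlabTransport.IsLogAccretive.cayley_zero, d.rankOneTerm_eq, hlim]
    refine ⟨h.theta_ne_zero hu, rfl, ?_⟩
    refine EventuallyEq.trans_isBigO ?_ ((h.isBigO_cayley_sub hδ hu).mono
      (nhdsWithin_mono _ fun z hz => hz.1))
    filter_upwards [self_mem_nhdsWithin] with z hz
    rw [(SlabTransport.IsLogAccretive.cayley_eventuallyEq _ hz.1.1).self_of_nhds]
    rfl
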